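/- **Setting.** Let $p$ be an odd prime and $F$ a finite extension of $\mathbb{Q}_p$ with valuation ring $\mathcal{O}_F$. Let $K=F$ (with $\bar a=a$), or $K=F\oplus F$ (with $\overline{(x,y)}=(y,x)$), or $K$ an unramified quadratic field extension of $F$ (with $a\mapsto\bar a$ the nontrivial automorphism of $K/F$). Let $\mathcal{O}$ be the integral closure of $\mathcal{O}_F$ in $K$, and $|z|=|N_{K/\mathbb{Q}_p}(z)|_p$ the normalized absolute value of $K$. Let $n\ge m\ge 1$ and $\epsilon\in\{0,1\}$. Let $$J_{2m}=\begin{bmatrix}0&\mathbf 1_m\\ \mathbf 1_m&0\end{bmatrix},\qquad J_{2m+1}=\begin{bmatrix}J_{2m}&0\\0&1\end{bmatrix},$$ $$H=\{h\in \mathrm{GL}_{2m+\epsilon}(K): {}^t\bar h J_{2m+\epsilon}h=J_{2m+\epsilon}\},\qquad G_0=\left\{g\in\mathrm{GL}_{2n}(K):{}^t\bar g\begin{bmatrix}0&\mathbf 1_n\\-\mathbf 1_n&0\end{bmatrix}g=\begin{bmatrix}0&\mathbf 1_n\\-\mathbf 1_n&0\end{bmatrix}\right\}.$$ The four cases are: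 (OS0) $K=F$, $\epsilon=0$, $(G,H)=(\mathrm{Sp}_{2n},\mathrm{O}_{2m})$; (OS1) $K=F$, $\epsilon=1$, $(G,H)=(\mathrm{Mp}_{2n},\mathrm{O}_{2m+1})$, where $\mathrm{Mp}_{2n}=\mathrm{Sp}_{2n}(F)\times\{\pm1\}$ as a set; (U0), (U1) $[K:F]=2$, $\epsilon=0,1$, $(G,H)=(\mathrm{U}_{n,n},\mathrm{U}_{2m+\epsilon})$. So $G=G_0$, except that in case (OS1) $G$ is the double cover of $G_0$. Let $U_{\mathrm{GL}_n,\mathcal{O}}$ be the group of upper triangular unipotent matrices in $\mathrm{GL}_n(\mathcal{O})$. Let $U_{G,\mathcal{O}}$ be the group of unipotent $\begin{bmatrix}A&B\\0&D\end{bmatrix}\in G_0\cap \mathrm{GL}_{2n}(\mathcal{O})$ with $A$ upper and $D$ lower triangular (embedded as $U_{G,\mathcal O}\times\{1\}$ in case (OS1)), and $U_{H,\mathcal{O}}$ the group of unipotent elements of $H\cap\mathrm{GL}_{2m+\epsilon}(\mathcal{O})$ which are upper triangular with respect to the ordering $1,\dots,m,(2m+1\text{ if }\epsilon=1),2m,\dots,m+1$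 of the basis. Give these three groups their Haar measures of total volume $1$. Let $T^+_G$, $T^+_H$ be the sets of diagonal elements $t$ of $G$, $H$ with $tU_{G,\mathcal{O}}t^{-1}\subset U_{G,\mathcal{O}}$, resp. $tU_{H,\mathcal{O}}t^{-1}\subset U_{H,\mathcal{O}}$. Let $\psi$ be a continuous additive character of $F$ of conductor $\mathcal{O}_F$ (i.e. $\psi(x\mathcal{O}_F)=1$ if and only if $x\in\mathcal{O}_F$). For a nontrivial additive character $\eta$ of $F$ let $\gamma(\eta)$ be the Weil index of $x\mapsto\eta(x^2)$, and $\gamma(a,\eta)=\gamma(a\eta)/\gamma(\eta)$ with $(a\eta)(x)=\eta(ax)$. In the cases (U0), (U1) let $\tilde\chi$ be a continuous character of $K^\times$ extending the character $\chi_{K/F}$ of $F^\times$ attached to $K/F$ by class field theory. On functions on $M_{2m+\epsilon,n}(K)$ let $\omega$ be the Weil representation: $\omega(1,h)\phi(X)=\phi({}^thX)$ for $h\in H$, and for $g=\begin{bmatrix}A&B\\0&{}^t\bar A^{-1}\end{bmatrix}$ in $G_0$, $$\omega(g,1)\phi(X)=\psi\!\left(\tfrac12\mathrm{Tr}\,B\,{}^t\!\bar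 A\,{}^t\!\bar XJ_{2m+\epsilon}X\right)\,c(\det A)\,|\det A|^{\frac{2m+\epsilon}{2}}\phi(XA),$$ with $c=1$ in cases (OS0), (U0), $c=\tilde\chi$ in case (U1), and, in case (OS1), $c(x)=s\,\gamma(x,\tfrac12\psi)^{-1}$ for the action of $(g,s)\in \mathrm{Mp}_{2n}$, $s=\pm1$. Put $$U^G_{t}=\int_{U_{G,\mathcal{O}}}(\text{action by }wt)\,dw\quad(t\in T^+_G),\qquad U^H_t=\int_{U_{H,\mathcal{O}}}(\text{action by }wt)\,dw\quad(t\in T^+_H).$$ Let $\chi_1,\dots,\chi_m$ be finite-order continuous characters of $\mathcal{O}^\times$. For $X=\begin{bmatrix}X_1&X_2\\X_3&X_4\end{bmatrix}\in M_{2m+\epsilon,n}(K)$ with $X_1$ of size $m\times m$, let $$\phi_{\underline\chi}(X)=\prod_{j=1}^m\chi_j(D_j(X_1))\cdot\mathbf 1_{B^-_m(\mathcal{O})B_m(\mathcal{O})}(X_1)\,\mathbf 1_{M_{m,n-m}(\mathcal{O})}(X_2)\,\mathbf 1_{M_{m+\epsilon,n}(\mathcal{O})}(X_3,X_4),$$ where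 $D_j$ is the upper left $j\times j$ minor and $B_m(\mathcal{O})$, $B_m^-(\mathcal{O})$ are the groups of upper, resp. lower, triangular matrices in $\mathrm{GL}_m(\mathcal{O})$. **Theorem.** Let $a_1,\dots,a_m,u,d\in K^\times$. Let $t=\mathrm{diag}(a_1,\dots,a_m,\bar a_1^{-1},\dots,\bar a_m^{-1})$ if $\epsilon=0$, and $t=\mathrm{diag}(a_1,\dots,a_m,\bar a_1^{-1},\dots,\bar a_m^{-1},u)$ if $\epsilon=1$. Let $A(\breve t)=\mathrm{diag}(a_1,\dots,a_m,d,\dots,d)\in\mathrm{GL}_n(K)$ and $$\breve t=\mathrm{diag}(a_1,\dots,a_m,d,\dots,d,\bar a_1^{-1},\dots,\bar a_m^{-1},\bar d^{-1},\dots,\bar d^{-1})$$ (in case (OS1): the element $(\breve t,1)$ of $\mathrm{Mp}_{2n}$). Suppose that $t\in T^+_H$ and $\breve t\in T^+_G$, and, in case (U1) with $n>m$ and $K=F\oplus F$, that $du^{-1}\in\mathcal{O}^\times$. Then $$\mathrm{vol}(tU_{H,\mathcal{O}}t^{-1})^{-1}\,U^H_t\phi_{\underline\chi}=\kappa\cdot|\det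 A(\breve t)|^{-\frac{2m+\epsilon}{2}}\,\mathrm{vol}\big(A(\breve t)U_{\mathrm{GL}_n,\mathcal{O}}A(\breve t)^{-1}\big)^{-1}\,U^G_{\breve t}\phi_{\underline\chi},$$ where $\kappa=1$ in cases (OS0) and (U0), $\kappa=\gamma(\det A(\breve t),\tfrac12\psi)$ in case (OS1), and $\kappa=\tilde\chi(\det A(\breve t))^{-1}$ in case (U1). -/

import Mathlib

open MeasureTheory Matrix Filter Topology

noncomputable section

namespace UpEquiv

/-! ### The four cases -/

/-- The four families of dual pairs `(G, H)`:
`OS0 = (Sp_{2n}, O_{2m})`, `OS1 = (Mp_{2n}, O_{2m+1})`,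
`U0 = (U_{n,n}, U_{2m})`, `U1 = (U_{n,n}, U_{2m+1})`. -/
inductive DualPair
  | OS0
  | OS1
  | U0
  | U1

/-- The parity `ε` of the degree `2m + ε` of `H`. -/
def DualPair.eps : DualPair → ℕ
  | .OS0 => 0
  | .OS1 => 1
  | .U0 => 0
  | .U1 => 1

/-! ### The coefficient rings -/

section Coefficients

variable (p : ℕ) [Fact p.Prime] (F : Type*) [Field F] [Algebra ℚ_[p] F]
  (K : Type*) [CommRing K] [Algebra F K] [StarRing K]

/-- The valuation ring of the `p`-adic field `F`: the integral closure of `ℤ_p` in `F`. -/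
abbrev intF : Subalgebra (PadicInt.subring p) F := integralClosure (PadicInt.subring p) F

/-- The ring `𝒪` of integers of `K`, the integral closure of `𝒪_F` in `K`: it is `𝒪_F` if `K = F`,
`𝒪_F ⊕ 𝒪_F` if `K = F ⊕ F`, and the valuation ring of `K` if `K` is a field. -/
abbrev intK : Subalgebra (intF p F) K := integralClosure (intF p F) K

/-- `K = F`, with trivial involution. -/
def IsBaseField : Prop :=
  Function.Bijective (algebraMap F K) ∧ ∀ x : K, star x = x

/-- `K = F ⊕ F`, with the swap as involution. -/
def IsSplit : Prop :=
  ∃ e : K ≃ₐ[F] F × F, ∀ x : K, e (star x) = (e x).swap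

/-- `K` is an unramified quadratic field extension of `F`, and the involution is the nontrivial
`F`-automorphism of `K`. -/
def IsUnramifiedQuadratic : Prop :=
  IsField K ∧ Module.finrank F K = 2 ∧
    (∀ x : F, star (algebraMap F K x) = algebraMap F K x) ∧ (∃ x : K, star x ≠ x) ∧
    Algebra.FormallyUnramified (intF p F) (intK p F K)

/-- The condition on `K` in each of the four cases. -/
def DualPair.Admissible : DualPair → Prop
  | .OS0 => IsBaseField F K
  | .OS1 => IsBaseField F K
  | .U0 => IsSplit F K ∨ IsUnramifiedQuadratic p F K
  | .U1 => IsSplit F K ∨ IsUnramifiedQuadratic p F K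

variable {K}

/-- The element of `F` whose image in `K` is `z` (only used for `z` in the image of `F`). -/
def toBase (z : K) : F := Function.invFun (algebraMap F K) z

/-- The normalized absolute value of `K` (the product of those of the two factors if
`K = F ⊕ F`): `|z| = |N_{K/ℚ_p}(z)|_p`. -/
def absK (z : K) : ℝ := ‖Algebra.norm ℚ_[p] (Algebra.norm F z)‖

variable (K)

/-- `χ̃ : Kˣ → ℂˣ` is a continuous character whose restriction to `Fˣ` is the character
`χ_{K/F}` attached to `K/F` by class field theory: trivial on the norms from `Kˣ`, and `-1` on the
other elements of `Fˣ` (of which there are none if `K = F ⊕ F`). -/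
def ExtendsQuadraticCharacter [TopologicalSpace K] (χt : Kˣ →* ℂˣ) : Prop :=
  Continuous χt ∧
    ∀ x : Fˣ,
      ((∃ y : Kˣ, (y : K) * star (y : K) = algebraMap F K x) →
        χt (Units.map (algebraMap F K : F →* K) x) = 1) ∧
      ((¬ ∃ y : Kˣ, (y : K) * star (y : K) = algebraMap F K x) →
        χt (Units.map (algebraMap F K : F →* K) x) = -1)

variable {F}

/-- `ψ` is a continuous additive character of `F` of conductor `𝒪_F`: the largest `𝒪_F`-submodule
of `F` on which `ψ` is trivial is `𝒪_F`. -/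
def HasConductorIntegers [TopologicalSpace F] (ψ : AddChar F ℂ) : Prop :=
  Continuous ψ ∧ ∀ x : F, (∀ y ∈ intF p F, ψ (x * y) = 1) ↔ x ∈ intF p F

/-! ### Weil indices -/

/-- The Weil index of the character of second degree `x ↦ η (x ^ 2)` of `F`: the phase of
`∫ η (x ^ 2) dx`, the integral being over `p^{-k} 𝒪_F` for `k` large. The Haar measure `ν` on `F`
serves to write the integral; the phase does not depend on it. -/
def weilIndex [MeasurableSpace F] (ν : Measure F) (η : F → ℂ) : ℂ :=
  limUnder atTop fun k : ℕ =>
    (∫ x in {x : F | (p : F) ^ k * x ∈ intF p F}, η (x ^ 2) ∂ν) /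
      (‖∫ x in {x : F | (p : F) ^ k * x ∈ intF p F}, η (x ^ 2) ∂ν‖ : ℂ)

/-- `γ(a, η) = γ(aη) / γ(η)`, where `(aη)(x) = η (a x)`. -/
def relWeilIndex [MeasurableSpace F] (ν : Measure F) (a : F) (η : F → ℂ) : ℂ :=
  weilIndex p ν (fun x => η (a * x)) / weilIndex p ν η

end Coefficients

/-! ### Matrix groups -/

section Groups

variable {ι : Type*} [Fintype ι] [DecidableEq ι]

/-- The diagonal matrix `diag(f)` in `GL(K)`. -/
def diagGL {K : Type*} [CommRing K] (f : ι → Kˣ) : GL ι K where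
  val := diagonal fun i => (f i : K)
  inv := diagonal fun i => ((f i)⁻¹ : Kˣ)
  val_inv := by simp
  inv_val := by simp

/-- `{g ∈ GL(K) : ᵗḡ J g = J}`. -/
def isomGroup {K : Type*} [CommRing K] [StarRing K] (J : Matrix ι ι K) : Subgroup (GL ι K) where
  carrier := {g | (g : Matrix ι ι K)ᴴ * J * (g : Matrix ι ι K) = J}
  one_mem' := by simp
  mul_mem' := by
    intro g h hg hh
    simp only [Set.mem_ofPred_eq, Units.val_mul, conjTranspose_mul] at *
    calc (h : Matrix ι ι K)ᴴ * (g : Matrix ι ι K)ᴴ * J * (g * h)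
        = (h : Matrix ι ι K)ᴴ * ((g : Matrix ι ι K)ᴴ * J * g) * h := by
          simp only [Matrix.mul_assoc]
      _ = J := by rw [hg, hh]
  inv_mem' := by
    intro g hg
    simp only [Set.mem_ofPred_eq] at *
    have h1 : (g : Matrix ι ι K) * ((g⁻¹ : GL ι K) : Matrix ι ι K) = 1 := by
      rw [← Units.val_mul, mul_inv_cancel, Units.val_one]
    have h2 : ((g⁻¹ : GL ι K) : Matrix ι ι K)ᴴ * (g : Matrix ι ι K)ᴴ = 1 := by
      rw [← conjTranspose_mul, h1, conjTranspose_one]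
    calc ((g⁻¹ : GL ι K) : Matrix ι ι K)ᴴ * J * ((g⁻¹ : GL ι K) : Matrix ι ι K)
        = ((g⁻¹ : GL ι K) : Matrix ι ι K)ᴴ * ((g : Matrix ι ι K)ᴴ * J * g) *
            ((g⁻¹ : GL ι K) : Matrix ι ι K) := by rw [hg]
      _ = (((g⁻¹ : GL ι K) : Matrix ι ι K)ᴴ * (g : Matrix ι ι K)ᴴ) * J *
            ((g : Matrix ι ι K) * ((g⁻¹ : GL ι K) : Matrix ι ι K)) := by
          simp only [Matrix.mul_assoc]
      _ = J := by rw [h1, h2, Matrix.one_mul, Matrix.mul_one]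

/-- `GL(𝒪)` inside `GL(K)`, for a subring `𝒪` of `K`. -/
def intGL {R K : Type*} [CommRing R] [CommRing K] [Algebra R K] (O : Subalgebra R K) :
    Subgroup (GL ι K) where
  carrier := {g | ∀ i j, (g : Matrix ι ι K) i j ∈ O ∧ ((g⁻¹ : GL ι K) : Matrix ι ι K) i j ∈ O}
  one_mem' := by
    intro i j
    have : (1 : Matrix ι ι K) i j ∈ O := by
      rw [Matrix.one_apply]
      split_ifs
      · exact O.one_mem
      · exact O.zero_mem
    simpa using this
  mul_mem' := by
    intro g h hg hh i j
    rw [_root_.mul_inv_rev]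
    simp only [Units.val_mul, Matrix.mul_apply]
    exact ⟨O.sum_mem fun k _ => O.mul_mem (hg i k).1 (hh k j).1,
      O.sum_mem fun k _ => O.mul_mem (hh i k).2 (hg k j).2⟩
  inv_mem' := by
    intro g hg i j
    rw [inv_inv]
    exact (hg i j).symm

/-- The unipotent upper triangular matrices with respect to the ordering of the basis vectors
`i` by increasing `b i`: zero below the diagonal, and `1` on the diagonal. (If `b` is not
injective, this is the unipotent radical of the block upper triangular matrices.) -/
def unipUpper (K : Type*) [CommRing K] (b : ι → ℤ) : Subgroup (GL ι K) where
  carrier := {g | ∀ i j, b j ≤ b i → (g : Matrix ι ι K) i j = (1 : Matrix ι ι K) i j}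
  one_mem' := by
    intro i j _
    simp
  mul_mem' := by
    intro g h hg hh i j hij
    rw [Units.val_mul, Matrix.mul_apply, ← hh i j hij, Finset.sum_eq_single i]
    · rw [hg i i le_rfl, Matrix.one_apply_eq, one_mul]
    · intro k _ hk
      rcases le_or_gt (b k) (b i) with h1 | h1
      · rw [hg i k h1, Matrix.one_apply_ne (Ne.symm hk), zero_mul]
      · have hkj : k ≠ j := by
          rintro rfl
          exact absurd hij (not_le.mpr h1)
        rw [hh k j (hij.trans h1.le), Matrix.one_apply_ne hkj, mul_zero]
    · intro h1
      exact absurd (Finset.mem_univ i) h1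
  inv_mem' := by
    intro g hg i j hij
    have htri : BlockTriangular (g : Matrix ι ι K) b := by
      intro i j hij
      have hne : i ≠ j := by
        rintro rfl
        exact lt_irrefl _ hij
      rw [hg i j hij.le, Matrix.one_apply_ne hne]
    have : Invertible (g : Matrix ι ι K) := g.invertible
    have hinv : BlockTriangular ((g⁻¹ : GL ι K) : Matrix ι ι K) b := by
      rw [Matrix.coe_units_inv]
      exact blockTriangular_inv_of_blockTriangular htri
    have h1 : ((g⁻¹ : GL ι K) : Matrix ι ι K) * (g : Matrix ι ι K) = 1 := by
      rw [← Units.val_mul, inv_mul_cancel, Units.val_one]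
    rw [← h1, Matrix.mul_apply, Finset.sum_eq_single j]
    · rw [hg j j le_rfl, Matrix.one_apply_eq, mul_one]
    · intro k _ hk
      rcases lt_or_ge (b k) (b i) with h2 | h2
      · rw [hinv h2, zero_mul]
      · rw [hg k j (hij.trans h2), Matrix.one_apply_ne hk, mul_zero]
    · intro h1
      exact absurd (Finset.mem_univ j) h1

/-- The semigroup of the diagonal `t ∈ G` with `t U t⁻¹ ⊆ U`. -/
def TPlus {K : Type*} [CommRing K] (G U : Subgroup (GL ι K)) : Set (GL ι K) :=
  {t | t ∈ G ∧ (t : Matrix ι ι K).IsDiag ∧ ∀ w ∈ U, t * w * t⁻¹ ∈ U}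

/-- The volume of `t U t⁻¹ ∩ U` in `U` (of `t U t⁻¹`, if it is contained in `U`). -/
def conjVol {K : Type*} [CommRing K] (U : Subgroup (GL ι K)) [MeasurableSpace U] (μ : Measure U)
    (t : GL ι K) : ℝ :=
  μ.real {w : U | ∃ v ∈ U, (w : GL ι K) = t * v * t⁻¹}

end Groups

section DualPairs

variable (p : ℕ) [Fact p.Prime] (F : Type*) [Field F] [Algebra ℚ_[p] F]
  (K : Type*) [CommRing K] [Algebra F K] [StarRing K] (m n ε : ℕ)

/-- The indices `1, …, m`, then `m + 1, …, 2m`, then `2m + 1` if `ε = 1`. -/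
abbrev Row (m ε : ℕ) : Type := (Fin m ⊕ Fin m) ⊕ Fin ε

/-- The skew form `[0, 1; -1, 0]` of degree `2n`. -/
def formG : Matrix (Fin n ⊕ Fin n) (Fin n ⊕ Fin n) K := fromBlocks 0 1 (-1) 0

/-- The form `J_{2m+ε}`: `[0, 1; 1, 0]`, with an additional diagonal entry `1` if `ε = 1`. -/
def formH : Matrix (Row m ε) (Row m ε) K := fromBlocks (fromBlocks 0 1 1 0) 0 0 1

/-- `Sp_{2n}(F)` if `K = F`, and `U_{n,n}` otherwise. -/
def groupG : Subgroup (GL (Fin n ⊕ Fin n) K) := isomGroup (formG K n)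

/-- `O_{2m+ε}` if `K = F`, and `U_{2m+ε}` otherwise. -/
def groupH : Subgroup (GL (Row m ε) K) := isomGroup (formH K m ε)

/-- The ordering `1, …, n, 2n, …, n + 1`: with respect to it, a matrix `[A, B; C, D]` is upper
triangular iff `A` is upper triangular, `D` is lower triangular, and `C = 0`. -/
def orderG : Fin n ⊕ Fin n → ℤ := Sum.elim (fun i => (i : ℤ) - n) (fun i => (n : ℤ) - i)

/-- The ordering `1, …, m, 2m + 1, 2m, …, m + 1` (without `2m + 1` if `ε = 0`). -/
def orderH : Row m ε → ℤ :=
  Sum.elim (Sum.elim (fun i => (i : ℤ) - m) (fun i => (m : ℤ) - i)) (fun _ => 0)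

/-- `U_{G, 𝒪}`: the `𝒪`-points of the unipotent radical of the Borel subgroup of `G`. For
`G = Mp_{2n}` this stands for its copy `U_{G, 𝒪} × {1}` in `Mp_{2n}`. -/
def unipG : Subgroup (GL (Fin n ⊕ Fin n) K) :=
  groupG K n ⊓ unipUpper K (orderG n) ⊓ intGL (intK p F K)

/-- `U_{H, 𝒪}`: the `𝒪`-points of the unipotent radical of the Borel subgroup of `H`. -/
def unipH : Subgroup (GL (Row m ε) K) :=
  groupH K m ε ⊓ unipUpper K (orderH m ε) ⊓ intGL (intK p F K)

/-- `U_{GL_n, 𝒪}`: the upper triangular unipotent matrices in `GL_n(𝒪)`. -/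
def unipGL : Subgroup (GL (Fin n) K) :=
  unipUpper K (fun i : Fin n => (i : ℤ)) ⊓ intGL (intK p F K)

variable {K m n}

/-- `t = diag(a₁, …, a_m, ā₁⁻¹, …, ā_m⁻¹)`, followed by `u` if `ε = 1`. -/
def torusH (a : Fin m → Kˣ) (u : Kˣ) : GL (Row m ε) K :=
  diagGL (Sum.elim (Sum.elim a fun i => (star (a i))⁻¹) fun _ => u)

/-- `(a₁, …, a_m, d, …, d)`, of length `n`. -/
def breveEntries (n : ℕ) (a : Fin m → Kˣ) (d : Kˣ) : Fin n → Kˣ :=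
  fun j => if h : (j : ℕ) < m then a ⟨j, h⟩ else d

/-- `A(t̆) = diag(a₁, …, a_m, d, …, d)`. -/
def breveA (n : ℕ) (a : Fin m → Kˣ) (d : Kˣ) : GL (Fin n) K := diagGL (breveEntries n a d)

/-- `t̆ = diag(a₁, …, a_m, d, …, d, ā₁⁻¹, …, ā_m⁻¹, d̄⁻¹, …, d̄⁻¹)`. -/
def breveT (n : ℕ) (a : Fin m → Kˣ) (d : Kˣ) : GL (Fin n ⊕ Fin n) K :=
  diagGL (Sum.elim (breveEntries n a d) fun j => (star (breveEntries n a d j))⁻¹)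

/-! ### The Weil representation on functions on `M_{2m+ε, n}(K)` -/

variable {F ε}

/-- `ω(1, h) φ (X) = φ(ᵗh X)`. -/
def weilH (h : GL (Row m ε) K) (φ : Matrix (Row m ε) (Fin n) K → ℂ) :
    Matrix (Row m ε) (Fin n) K → ℂ :=
  fun X => φ ((h : Matrix (Row m ε) (Row m ε) K)ᵀ * X)

/-- The Weil-index and character factor, as a function of `det A`, by which `([A, B; 0, ᵗĀ⁻¹], s)`
acts: `s γ(det A, ψ/2)⁻¹` for `Mp_{2n}`, and `χ̃(det A)^ε` in the other cases. -/
def siegelFactor [MeasurableSpace F] (P : DualPair) (ψ : AddChar F ℂ) (ν : Measure F)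
    (χt : Kˣ →* ℂˣ) (s : ℤˣ) (x : K) : ℂ :=
  match P with
  | .OS0 => 1
  | .OS1 => ((s : ℤ) : ℂ) * (relWeilIndex p ν (toBase F x) fun y => ψ (y / 2))⁻¹
  | .U0 => 1
  | .U1 => MulChar.ofUnitHom χt x

/-- The action of the Siegel parabolic subgroup of `G`, whose elements are the
`g = [A, B; 0, ᵗĀ⁻¹]`:
`ω(g, 1) φ (X) = ψ(½ Tr B ᵗĀ ᵗX̄ J X) · (factor) · |det A|^{(2m+ε)/2} · φ(X A)`.
For `G = Mp_{2n} = Sp_{2n} × {±1}` (as a set) this is the action of `(g, s)`; in the other cases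
there is no sign, and `s` is not used. -/
def weilG [MeasurableSpace F] (P : DualPair) (ψ : AddChar F ℂ) (ν : Measure F) (χt : Kˣ →* ℂˣ)
    (g : GL (Fin n ⊕ Fin n) K) (s : ℤˣ) (φ : Matrix (Row m P.eps) (Fin n) K → ℂ) :
    Matrix (Row m P.eps) (Fin n) K → ℂ :=
  fun X =>
    let A := (g : Matrix (Fin n ⊕ Fin n) (Fin n ⊕ Fin n) K).toBlocks₁₁
    let B := (g : Matrix (Fin n ⊕ Fin n) (Fin n ⊕ Fin n) K).toBlocks₁₂
    ψ (2⁻¹ * toBase F (trace (B * Aᴴ * (Xᴴ * formH K m P.eps * X)))) *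
      siegelFactor p P ψ ν χt s A.det *
      ((absK p F A.det ^ ((2 * (m : ℝ) + P.eps) / 2) : ℝ) : ℂ) *
      φ (X * A)

/-! ### The `U_p`-operators -/

/-- The operator `∫_{U_{H, 𝒪}} (action by w t) dw`. -/
def upH [MeasurableSpace (unipH p F K m ε)] (μ : Measure (unipH p F K m ε)) (t : GL (Row m ε) K)
    (φ : Matrix (Row m ε) (Fin n) K → ℂ) : Matrix (Row m ε) (Fin n) K → ℂ :=
  fun X => ∫ w : unipH p F K m ε, weilH ((w : GL (Row m ε) K) * t) φ X ∂μ

/-- The operator `∫_{U_{G, 𝒪}} (action by w (t, s)) dw`: the element `w` of `U_{G, 𝒪}` (which is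
`(w, 1)` if `G = Mp_{2n}`) acts after `(t, s)`. The sign `s` plays a role only for `Mp_{2n}`. -/
def upG [MeasurableSpace F] [MeasurableSpace (unipG p F K n)] (P : DualPair) (ψ : AddChar F ℂ)
    (ν : Measure F) (χt : Kˣ →* ℂˣ) (μ : Measure (unipG p F K n)) (t : GL (Fin n ⊕ Fin n) K)
    (s : ℤˣ) (φ : Matrix (Row m P.eps) (Fin n) K → ℂ) : Matrix (Row m P.eps) (Fin n) K → ℂ :=
  fun X => ∫ w : unipG p F K n,
    weilG p P ψ ν χt (w : GL (Fin n ⊕ Fin n) K) 1 (weilG p P ψ ν χt t s φ) X ∂μ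

/-! ### The test Schwartz function -/

variable (F)

open Classical in
/-- A character of `𝒪ˣ`, extended by zero to `K`. -/
def extendByZero (χ : (intK p F K)ˣ →* ℂˣ) (x : K) : ℂ :=
  if h : x ∈ intK p F K then MulChar.ofUnitHom χ ⟨x, h⟩ else 0

/-- `B⁻_m(𝒪) B_m(𝒪)`: the products of a lower and an upper triangular matrix in `GL_m(𝒪)`. -/
def bigCell (m : ℕ) : Set (Matrix (Fin m) (Fin m) K) :=
  {Y | ∃ b₁ ∈ intGL (ι := Fin m) (intK p F K), ∃ b₂ ∈ intGL (ι := Fin m) (intK p F K),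
    (∀ i j, i < j → (b₁ : Matrix (Fin m) (Fin m) K) i j = 0) ∧
    (∀ i j, j < i → (b₂ : Matrix (Fin m) (Fin m) K) i j = 0) ∧
    Y = (b₁ : Matrix (Fin m) (Fin m) K) * (b₂ : Matrix (Fin m) (Fin m) K)}

/-- The upper left `(j + 1) × (j + 1)` minor. -/
def leadingMinor (Y : Matrix (Fin m) (Fin m) K) (j : Fin m) : K :=
  (Y.submatrix (Fin.castLE (Nat.succ_le_of_lt j.isLt))
    (Fin.castLE (Nat.succ_le_of_lt j.isLt))).det

/-- The upper left `m × m` block `X₁` of `X`, where `m ≤ n`. -/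
def upperLeft (hmn : m ≤ n) (X : Matrix (Row m ε) (Fin n) K) : Matrix (Fin m) (Fin m) K :=
  X.submatrix (fun i => Sum.inl (Sum.inl i)) (Fin.castLE hmn)

open Classical in
/-- The Schwartz function `φ_χ` on `M_{2m+ε, n}(K)`: for `X = [X₁, X₂; X₃, X₄]` with
`X₁ ∈ B⁻_m(𝒪) B_m(𝒪)` and `X₂, X₃, X₄` integral, its value is the product of the
`χ_j (D_j(X₁))`, and it is zero elsewhere. -/
def phiChi (hmn : m ≤ n) (χ : Fin m → ((intK p F K)ˣ →* ℂˣ)) (X : Matrix (Row m ε) (Fin n) K) : ℂ :=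
  if upperLeft hmn X ∈ bigCell p F m ∧
      (∀ (i : Fin m) (j : Fin n), m ≤ (j : ℕ) → X (Sum.inl (Sum.inl i)) j ∈ intK p F K) ∧
      (∀ (i : Fin m) (j : Fin n), X (Sum.inl (Sum.inr i)) j ∈ intK p F K) ∧
      (∀ (i : Fin ε) (j : Fin n), X (Sum.inr i) j ∈ intK p F K)
  then ∏ j : Fin m, extendByZero p F (χ j) (leadingMinor (upperLeft hmn X) j)
  else 0

/-- The Weil-index and character factor of the equivariance, as a function of `det A(t̆)`:
`γ(det A(t̆), ψ/2)` for `(Mp_{2n}, O_{2m+1})`, `χ̃(det A(t̆))⁻¹` for `(U_{n,n}, U_{2m+1})`, and `1`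
if `ε = 0`. -/
def equivFactor {F : Type*} [Field F] [Algebra ℚ_[p] F] [Algebra F K] [MeasurableSpace F]
    (P : DualPair) (ψ : AddChar F ℂ) (ν : Measure F) (χt : Kˣ →* ℂˣ) (x : Kˣ) : ℂ :=
  match P with
  | .OS0 => 1
  | .OS1 => relWeilIndex p ν (toBase F (x : K)) fun y => ψ (y / 2)
  | .U0 => 1
  | .U1 => ((χt x)⁻¹ : ℂˣ)

end DualPairs

end UpEquiv

end

noncomputable section

namespace UpEquiv

/-! ### Rings of integers of `F` and `K`: finiteness, openness, compactness -/

section BaseField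

variable (p : ℕ) [Fact p.Prime] (F : Type*) [Field F] [Algebra ℚ_[p] F]

/-! Evaluate both sides at a matrix X. Once the scalars attached to `t̆` are pulled out, the G-side
is `siegelIntegral`: the integral over w = [A, B; 0, D] in U_G of ψ(½ Tr S·ᵗX̄JX) φ(X A A(t̆)),
where S = B ᵗĀ is Hermitian. The H-side is the integral of φ(ᵗt ᵗw X) over U_H. Both are invariant
under X ↦ ᵗvX for v in U_H and under X ↦ XA for A in U_GL: one invariance on each side is a
translation of Haar measure. The other holds because φ is invariant under the integral unipotent
groups, which preserve the big cell and the leading minors, and because v preserves the Gram matrix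
ᵗX̄JX. So it is enough to compare the sides on representatives of double cosets.

If either side is nonzero at X, the double coset of X contains a matrix in the normal form
`IsNormal`. On the H-side, some ᵗt ᵗw X lies in the support of φ; it is reduced by integral row and
column operations, and the row operations pass through t because t contracts U_H
(`exists_isNormal_of_isSupported_torusH_mul`). On the G-side there are two pieces of information:
some X A A(t̆) lies in the support, and averaging over S forces ᵗX̄JX to be integral, because the
trace pairing on Hermitian matrices is perfect (K/F is unramified and p is odd). A Siegel unipotent
of H makes the relevant part of the middle rows Hermitian, after which integrality of the Gram
matrix is exactly integrality of the middle rows of ᵗtX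
(`exists_isNormal_of_isSupported_mul_breveA`). The last row, present if ε = 1, is controlled by ūu =
1 and d d̄ ∈ 𝒪 when K is a field, and by du⁻¹ ∈ 𝒪ˣ when K = F ⊕ F.

At a normal X each integrand is constant on the part of the group coming from t U t⁻¹ and zero
elsewhere, since an element of U that keeps a reduced matrix in the support after conjugation by t⁻¹
must be integral after this conjugation. The integrals are therefore vol · φ(ᵗtX)
(`IsNormal.upH_eq`) and vol · φ(X A(t̆)) (`IsNormal.siegelIntegral_eq`). The two values of φ agree,
as both arguments are integral with the same upper left block diag(c).

The scalars then cancel. In case (OS1) this requires that the Weil indices do not vanish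
(`weilIndex_ne_zero`), which is a computation with Gauss integrals. -/

instance isFractionRing_subring : IsFractionRing (PadicInt.subring p) ℚ_[p] :=
  inferInstanceAs (IsFractionRing ℤ_[p] ℚ_[p])

instance isDiscreteValuationRing_subring : IsDiscreteValuationRing (PadicInt.subring p) :=
  inferInstanceAs (IsDiscreteValuationRing ℤ_[p])

instance isIntegralClosure_intF : IsIntegralClosure (intF p F) (PadicInt.subring p) F :=
  inferInstance

instance isScalarTower_subring : IsScalarTower (PadicInt.subring p) ℚ_[p] F := inferInstance

variable {F} in
theorem inv_two_mem_intF (hp : p ≠ 2) : (2⁻¹ : F) ∈ intF p F := by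
  have h2 : (2⁻¹ : ℚ_[p]) ∈ PadicInt.subring p := by
    have hn : ‖((2 : ℕ) : ℚ_[p])‖ = 1 := by
      rw [Padic.norm_natCast_eq_one_iff]
      exact (Nat.coprime_primes Fact.out Nat.prime_two).2 hp
    rw [PadicInt.mem_subring_iff, norm_inv]
    push_cast at hn
    rw [hn, inv_one]
  have := (intF p F).algebraMap_mem ⟨2⁻¹, h2⟩
  have e : algebraMap (PadicInt.subring p) F ⟨2⁻¹, h2⟩ = algebraMap ℚ_[p] F 2⁻¹ := rfl
  rwa [e, map_inv₀, map_ofNat] at this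

variable [FiniteDimensional ℚ_[p] F]

instance isFractionRing_intF : IsFractionRing (intF p F) F :=
  integralClosure.isFractionRing_of_finite_extension ℚ_[p] F

instance finite_intF : Module.Finite (PadicInt.subring p) (intF p F) :=
  IsIntegralClosure.finite (PadicInt.subring p) ℚ_[p] F (intF p F)

instance isNoetherianRing_intF : IsNoetherianRing (intF p F) :=
  integralClosure.isNoetherianRing (A := PadicInt.subring p) (K := ℚ_[p]) (L := F)

instance isIntegrallyClosed_intF : IsIntegrallyClosed (intF p F) :=
  integralClosure.isIntegrallyClosedOfFiniteExtension ℚ_[p]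

end BaseField

section Openness

/-- In a finite free algebra over a topological field, with the module topology, the integral
closure of an open subring with full fraction field is open. -/
theorem isOpen_integralClosure {k V : Type*} [Field k] [TopologicalSpace k] [CommRing V]
    [Algebra k V] [FiniteDimensional k V] [TopologicalSpace V] [IsTopologicalRing k]
    [IsModuleTopology k V]
    {R : Type*} [CommRing R] [IsDomain R] [Algebra R k] [IsFractionRing R k] [Algebra R V]
    [IsScalarTower R k V] (hR : IsOpen (Set.range (algebraMap R k))) :
    IsOpen (integralClosure R V : Set V) := by
  have : IsTopologicalRing V := IsModuleTopology.isTopologicalRing k V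
  have halg : ∀ v : V, ∃ c : R, c ≠ 0 ∧ IsIntegral R (c • v) := by
    intro v
    have : IsAlgebraic k v := (Algebra.IsIntegral.isIntegral v).isAlgebraic
    exact ((IsFractionRing.isAlgebraic_iff R k V).2 this).exists_integral_multiple
  let b := Module.finBasis k V
  -- Each basis vector has an integral multiple `c i • b i`. The vectors whose i-th coordinate lies
  -- in `c i` R for every i form an open neighbourhood of 0 inside the integral closure.
  choose c hc0 hci using fun i => halg (b i)
  let O := (integralClosure R V).toSubring.toAddSubgroup
  refine O.isOpen_of_mem_nhds (g := 0) ?_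
  have hcont : ∀ i, Continuous fun v : V => (algebraMap R k (c i))⁻¹ * b.repr v i := fun i =>
    continuous_const.mul
      (IsModuleTopology.continuous_of_linearMap ((Finsupp.lapply i).comp b.repr.toLinearMap))
  have hopen : IsOpen (⋂ i, (fun v : V => (algebraMap R k (c i))⁻¹ * b.repr v i) ⁻¹'
      Set.range (algebraMap R k)) := isOpen_iInter_of_finite fun i => hR.preimage (hcont i)
  refine mem_of_superset (hopen.mem_nhds ?_) ?_
  · simp only [Set.mem_iInter, Set.mem_preimage]
    exact fun i => ⟨0, by simp⟩
  · intro v hv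
    simp only [Set.mem_iInter, Set.mem_preimage] at hv
    choose r hr using hv
    rw [← b.sum_repr v]
    refine O.sum_mem fun i _ => ?_
    have hne : algebraMap R k (c i) ≠ 0 := by
      simpa using hc0 i
    have e : b.repr v i • b i = r i • c i • b i := by
      rw [← IsScalarTower.algebraMap_smul k (r i), ← IsScalarTower.algebraMap_smul k (c i),
        smul_smul, hr, mul_right_comm, inv_mul_cancel₀ hne, one_mul]
    change IsIntegral R _
    rw [e]
    exact (hci i).smul (r i)

end Openness

section Topology

variable (p : ℕ) [Fact p.Prime] (F : Type*) [Field F] [Algebra ℚ_[p] F] [FiniteDimensional ℚ_[p] F]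
  [TopologicalSpace F] [IsModuleTopology ℚ_[p] F]

theorem isOpen_intF : IsOpen (intF p F : Set F) := by
  refine isOpen_integralClosure (k := ℚ_[p]) ?_
  have : Set.range (algebraMap (PadicInt.subring p) ℚ_[p]) = Metric.closedBall 0 1 := by
    ext x
    constructor
    · rintro ⟨y, rfl⟩
      exact mem_closedBall_zero_iff.2 y.2
    · intro hx
      exact ⟨⟨x, by simpa using hx⟩, rfl⟩
  rw [this]
  exact IsUltrametricDist.isOpen_closedBall _ one_ne_zero

/-- Finiteness over ℤ_p makes 𝒪_F the continuous image of a finite product of closed unit balls of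
ℚ_p. -/
theorem isCompact_intF : IsCompact (intF p F : Set F) := by
  have : IsTopologicalRing F := IsModuleTopology.isTopologicalRing ℚ_[p] F
  obtain ⟨s, hs⟩ := (finite_intF p F).fg_top
  have hball : IsCompact (Metric.closedBall (0 : ℚ_[p]) 1) := isCompact_closedBall _ _
  have hc : IsCompact (Set.pi Set.univ fun _ : s => Metric.closedBall (0 : ℚ_[p]) 1) :=
    isCompact_univ_pi fun _ => hball
  have hcont : Continuous fun c : s → ℚ_[p] => ∑ i, c i • ((i : intF p F) : F) :=
    continuous_finsetSum _ fun i _ => (continuous_apply i).smul continuous_const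
  convert hc.image hcont using 1
  ext x
  constructor
  · intro hx
    have hx' : (⟨x, hx⟩ : intF p F) ∈ Submodule.span (PadicInt.subring p) (s : Set (intF p F)) := by
      rw [hs]
      trivial
    obtain ⟨f, hf⟩ := (Submodule.mem_span_finset' ).1 hx'
    refine ⟨fun i => f i, ?_, ?_⟩
    · intro i _
      exact mem_closedBall_zero_iff.2 (f i).2
    · have := congrArg (Subtype.val) hf
      simpa [Subring.smul_def] using this
  · rintro ⟨c, hcm, rfl⟩
    refine Subalgebra.sum_mem _ fun i _ => ?_
    have : ‖c i‖ ≤ 1 := by simpa using hcm i (Set.mem_univ i)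
    exact (intF p F).smul_mem i.1.2 (⟨c i, this⟩ : PadicInt.subring p)

theorem secondCountable_of_finiteDimensional (k V : Type*) [NontriviallyNormedField k]
    [SecondCountableTopology k] [AddCommGroup V] [Module k V] [FiniteDimensional k V]
    [TopologicalSpace V] [IsModuleTopology k V] : SecondCountableTopology V := by
  have := IsModuleTopology.toContinuousAdd k V
  let e := (Module.finBasis k V).equivFun
  let h : V ≃ₜ (Fin (Module.finrank k V) → k) :=
    { e.toEquiv with
      continuous_toFun := IsModuleTopology.continuous_of_linearMap e.toLinearMap
      continuous_invFun := IsModuleTopology.continuous_of_linearMap e.symm.toLinearMap }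
  exact h.secondCountableTopology

variable (K : Type*) [CommRing K] [Algebra F K] [TopologicalSpace K] [IsModuleTopology F K]
  [FiniteDimensional F K]

theorem isClopen_intK : IsClopen (intK p F K : Set K) := by
  have : IsTopologicalRing F := IsModuleTopology.isTopologicalRing ℚ_[p] F
  have : IsTopologicalRing K := IsModuleTopology.isTopologicalRing F K
  have ho : IsOpen (intK p F K : Set K) := by
    refine isOpen_integralClosure (k := F) ?_
    convert isOpen_intF p F
    ext x
    constructor
    · rintro ⟨y, rfl⟩
      exact y.2
    · intro hx
      exact ⟨⟨x, hx⟩, rfl⟩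
  exact ⟨(intK p F K).toSubring.toAddSubgroup.isClosed_of_isOpen ho, ho⟩

end Topology

/-! ### Integrality through the spectral norm -/

section SpectralNorm

variable (p : ℕ) [Fact p.Prime] {L : Type*} [Field L] [Algebra ℚ_[p] L] [FiniteDimensional ℚ_[p] L]

/-- The spectral norm is at most 1 iff the minimal polynomial over ℚ_p has coefficients in ℤ_p. As
ℤ_p is integrally closed, this is integrality. -/
theorem isIntegral_subring_iff (x : L) :
    IsIntegral (PadicInt.subring p) x ↔ spectralNorm ℚ_[p] L x ≤ 1 := by
  have hx : IsIntegral ℚ_[p] x := Algebra.IsIntegral.isIntegral x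
  rw [spectralNorm, spectralValue_le_one_iff (minpoly.monic hx)]
  constructor
  · intro h n
    rw [minpoly.isIntegrallyClosed_eq_field_fractions' ℚ_[p] h, Polynomial.coeff_map]
    exact ((minpoly (PadicInt.subring p) x).coeff n).2
  · intro h
    have hc : (↑(minpoly ℚ_[p] x).coeffs : Set ℚ_[p]) ⊆ PadicInt.subring p := by
      intro c hc
      obtain ⟨n, -, rfl⟩ := Polynomial.mem_coeffs_iff.1 hc
      exact h n
    refine ⟨(minpoly ℚ_[p] x).toSubring _ hc, (Polynomial.monic_toSubring _ _ _).2
      (minpoly.monic hx), ?_⟩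
    have e := minpoly.aeval ℚ_[p] x
    rw [← Polynomial.map_toSubring (minpoly ℚ_[p] x) (PadicInt.subring p) hc, Polynomial.aeval_def,
      Polynomial.eval₂_map] at e
    exact e

/-- The spectral norm is multiplicative and invariant under automorphisms, so x·σx has norm |x|². -/
theorem isIntegral_subring_of_mul_algEquiv (σ : L ≃ₐ[ℚ_[p]] L) {x : L}
    (h : IsIntegral (PadicInt.subring p) (x * σ x)) : IsIntegral (PadicInt.subring p) x := by
  rw [isIntegral_subring_iff, ← spectralMulAlgNorm_def, map_mul, spectralMulAlgNorm_def,
    spectralMulAlgNorm_def, ← spectralNorm_eq_of_equiv] at h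
  rw [isIntegral_subring_iff]
  by_contra! hlt
  nlinarith

end SpectralNorm

/-! ### Triviality of the different of an unramified extension -/

section Unramified

/-- In an unramified domain, the ideal generated by the `x - σ x`, for an endomorphism `σ`, is
idempotent, and therefore trivial. -/
theorem span_sub_eq_bot_or_top {R A : Type*} [CommRing R] [CommRing A] [IsDomain A]
    [IsNoetherianRing A] [Algebra R A] [Algebra.FormallyUnramified R A] (σ : A →ₐ[R] A) :
    Ideal.span (Set.range fun x => x - σ x) = ⊥ ∨ Ideal.span (Set.range fun x => x - σ x) = ⊤ := by
  set J : Ideal A := Ideal.span (Set.range fun x => x - σ x)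
  have hJmem : ∀ x, x - σ x ∈ J := fun x => Ideal.subset_span ⟨x, rfl⟩
  have hJ2 : J ≤ J ^ 2 := by
    let q := Ideal.Quotient.mkₐ R (J ^ 2)
    let I : Ideal (A ⧸ J ^ 2) := J.map (Ideal.Quotient.mk (J ^ 2))
    have hI : IsNilpotent I := ⟨2, by
      change (J.map (Ideal.Quotient.mk (J ^ 2))) ^ 2 = ⊥
      rw [← Ideal.map_pow, Ideal.map_quotient_self]⟩
    -- The projection to A/J² and its composite with σ agree modulo the square-zero ideal J/J².
    -- Formal unramifiedness makes them equal, that is, x - σx ∈ J² for all x.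
    have heq : q = q.comp σ := by
      refine Algebra.FormallyUnramified.ext I hI fun x => ?_
      rw [Ideal.Quotient.eq]
      have := Ideal.mem_map_of_mem (Ideal.Quotient.mk (J ^ 2)) (hJmem x)
      rwa [map_sub] at this
    refine Ideal.span_le.2 ?_
    rintro _ ⟨x, rfl⟩
    rw [SetLike.mem_coe, ← Ideal.Quotient.eq]
    exact DFunLike.congr_fun heq x
  have hidem : IsIdempotentElem J := by
    rw [IsIdempotentElem, ← pow_two]
    exact le_antisymm (Ideal.pow_le_self two_ne_zero) hJ2
  exact (Ideal.isIdempotentElem_iff_eq_bot_or_top J (IsNoetherian.noetherian J)).1 hidem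

/-- For nontrivial σ the ideal generated by the x - σx is not zero, hence is everything. This is the
form in which unramifiedness is used. -/
theorem one_mem_of_forall_sub_mem {R A : Type*} [CommRing R] [CommRing A] [IsDomain A]
    [IsNoetherianRing A] [Algebra R A] [Algebra.FormallyUnramified R A] (σ : A →ₐ[R] A)
    (hσ : ∃ x, σ x ≠ x) (I : Ideal A) (hI : ∀ x, x - σ x ∈ I) : (1 : A) ∈ I := by
  have hle : Ideal.span (Set.range fun x => x - σ x) ≤ I := by
    refine Ideal.span_le.2 ?_
    rintro _ ⟨x, rfl⟩
    exact hI x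
  rcases span_sub_eq_bot_or_top σ with hbot | htop
  · obtain ⟨x, hx⟩ := hσ
    have hz : x - σ x ∈ Ideal.span (Set.range fun x => x - σ x) := Ideal.subset_span ⟨x, rfl⟩
    rw [hbot, Ideal.mem_bot] at hz
    exact absurd (sub_eq_zero.1 hz).symm hx
  · exact hle (htop ▸ Submodule.mem_top)

end Unramified

/-! ### The coefficient algebra `K`: involution and trace pairing -/

section Coefficient

variable (p : ℕ) [Fact p.Prime] (F : Type*) [Field F] [Algebra ℚ_[p] F]
  (K : Type*) [CommRing K] [Algebra F K] [StarRing K]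

/-- `K` is `F`, or `F ⊕ F`, or an unramified quadratic field extension of `F`. -/
def IsCoefficientAlgebra : Prop :=
  IsBaseField F K ∨ IsSplit F K ∨ IsUnramifiedQuadratic p F K

variable {p F K}

theorem DualPair.Admissible.isCoefficientAlgebra {P : DualPair} (h : P.Admissible p F K) :
    IsCoefficientAlgebra p F K := by
  cases P
  · exact Or.inl h
  · exact Or.inl h
  · exact Or.inr h
  · exact Or.inr h

theorem IsUnramifiedQuadratic.nontrivial (h : IsUnramifiedQuadratic p F K) : Nontrivial K :=
  h.1.nontrivial

namespace IsCoefficientAlgebra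

variable (h : IsCoefficientAlgebra p F K)

include h

theorem finiteDimensional : FiniteDimensional F K := by
  rcases h with h | ⟨e, -⟩ | h
  · exact Module.Finite.of_surjective (Algebra.linearMap F K) h.1.surjective
  · exact Module.Finite.equiv e.symm.toLinearEquiv
  · exact Module.finite_of_finrank_pos (by rw [h.2.1]; norm_num)

theorem algebraMap_injective : Function.Injective (algebraMap F K) := by
  rcases h with h | ⟨e, -⟩ | h
  · exact h.1.injective
  · have : Nontrivial K := e.toEquiv.nontrivial
    exact (algebraMap F K).injective
  · have : Nontrivial K := h.nontrivial
    exact (algebraMap F K).injective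

theorem star_algebraMap (x : F) : star (algebraMap F K x) = algebraMap F K x := by
  rcases h with h | ⟨e, he⟩ | h
  · exact h.2 _
  · apply e.injective
    rw [he, e.commutes]
    rfl
  · exact h.2.2.1 x

theorem exists_algebraMap_eq {x : K} (hx : star x = x) : ∃ y, algebraMap F K y = x := by
  have hstar := h.star_algebraMap
  rcases h with h | ⟨e, he⟩ | h
  · exact h.1.surjective x
  · refine ⟨(e x).1, e.injective ?_⟩
    have h1 := he x
    rw [hx] at h1
    rw [e.commutes]
    exact Prod.ext rfl (congrArg Prod.fst h1)
  · have : Nontrivial K := h.nontrivial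
    have : Module.Finite F K := Module.finite_of_finrank_pos (by rw [h.2.1]; norm_num)
    let Fix : Submodule F K :=
      { carrier := {y | star y = y}
        add_mem' := fun {a b} ha hb => by
          change star (a + b) = a + b
          rw [star_add, ha, hb]
        zero_mem' := star_zero K
        smul_mem' := fun c y hy => by
          change star (c • y) = c • y
          rw [Algebra.smul_def, star_mul', hstar, hy] }
    -- The fixed space is a proper subspace of a plane and contains the line F·1, so it is that
    -- line.
    have hlt : Fix < ⊤ := by
      refine lt_top_iff_ne_top.2 fun htop => ?_
      obtain ⟨y, hy⟩ := h.2.2.2.1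
      exact hy (htop ▸ Submodule.mem_top : y ∈ Fix)
    have hle : Submodule.span F {(1 : K)} ≤ Fix := by
      rw [Submodule.span_singleton_le_iff_mem]
      exact star_one K
    have hfr := Submodule.finrank_lt hlt.ne
    rw [h.2.1] at hfr
    have heq := Submodule.eq_of_le_of_finrank_le hle (by
      rw [finrank_span_singleton (one_ne_zero)]
      omega)
    have hxF : x ∈ Submodule.span F {(1 : K)} := heq ▸ hx
    obtain ⟨c, hc⟩ := Submodule.mem_span_singleton.1 hxF
    exact ⟨c, by rw [← hc, Algebra.smul_def, mul_one]⟩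

theorem toBase_algebraMap (x : F) : toBase F (algebraMap F K x) = x :=
  Function.leftInverse_invFun h.algebraMap_injective x

theorem algebraMap_toBase {x : K} (hx : star x = x) : algebraMap F K (toBase F x) = x := by
  obtain ⟨y, rfl⟩ := h.exists_algebraMap_eq hx
  rw [h.toBase_algebraMap]

omit [StarRing K] h in
theorem algebraMap_mem_intK {x : F} (hx : x ∈ intF p F) : algebraMap F K x ∈ intK p F K :=
  (intK p F K).algebraMap_mem ⟨x, hx⟩

theorem mem_intF_of_algebraMap_mem [FiniteDimensional ℚ_[p] F] {x : F}
    (hx : algebraMap F K x ∈ intK p F K) : x ∈ intF p F := by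
  have hi : IsIntegral (intF p F) x := (isIntegral_algebraMap_iff h.algebraMap_injective).1 hx
  obtain ⟨y, hy⟩ := (isIntegrallyClosed_iff F).1 (isIntegrallyClosed_intF p F) hi
  rw [← hy]
  exact y.2

/-- The involution of `K`, as an automorphism over `F`. -/
def starAlgEquiv : K ≃ₐ[F] K where
  toFun := star
  invFun := star
  left_inv := star_star
  right_inv := star_star
  map_mul' := star_mul'
  map_add' := star_add
  commutes' := h.star_algebraMap

theorem star_mem {x : K} (hx : x ∈ intK p F K) : star x ∈ intK p F K := by
  have : IsIntegral (intF p F) x := hx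
  exact this.map (h.starAlgEquiv.toAlgHom.restrictScalars (intF p F))

omit [StarRing K] h in
theorem inv_two_mem (hp : p ≠ 2) : algebraMap F K 2⁻¹ ∈ intK p F K :=
  algebraMap_mem_intK (inv_two_mem_intF p hp)

omit [StarRing K] h in
theorem two_mul_inv_two [CharZero F] : (2 : K) * algebraMap F K 2⁻¹ = 1 := by
  rw [← map_ofNat (algebraMap F K) 2, ← map_mul, mul_inv_cancel₀ two_ne_zero, map_one]

omit h in
-- The z ∈ 𝒪 with zy ∈ 𝒪 form an ideal containing every x - x̄, and by unramifiedness this ideal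
-- contains 1.
theorem mem_of_forall_sub_star [FiniteDimensional ℚ_[p] F] (h : IsUnramifiedQuadratic p F K) {y : K}
    (hy : ∀ x ∈ intK p F K, (x - star x) * y ∈ intK p F K) : y ∈ intK p F K := by
  have hC : IsCoefficientAlgebra p F K := Or.inr (Or.inr h)
  have : IsDomain K := h.1.isDomain
  have hfd : FiniteDimensional F K := hC.finiteDimensional
  have : CharZero F := charZero_of_injective_algebraMap (algebraMap ℚ_[p] F).injective
  have hnoeth : IsNoetherianRing (intK p F K) := by
    let _ : Field K := h.1.toField
    exact integralClosure.isNoetherianRing (A := intF p F) (K := F) (L := K)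
  have := h.2.2.2.2
  let σ : intK p F K →ₐ[intF p F] intK p F K :=
    ((hC.starAlgEquiv.toAlgHom.restrictScalars (intF p F)).comp (intK p F K).val).codRestrict _
      fun x => hC.star_mem x.2
  -- An element moved by the involution becomes integral after scaling by some c ∈ 𝒪_F, and is still
  -- moved.
  have hσ : ∃ x, σ x ≠ x := by
    obtain ⟨x, hx⟩ := h.2.2.2.1
    have halg : IsAlgebraic (intF p F) x :=
      (IsFractionRing.isAlgebraic_iff (intF p F) F K).2
        (Algebra.IsIntegral.isIntegral (R := F) x).isAlgebraic
    obtain ⟨c, hc, hci⟩ := halg.exists_integral_multiple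
    refine ⟨⟨c • x, hci⟩, fun hz => hx ?_⟩
    have hz' : star (c • x) = c • x := congrArg Subtype.val hz
    have hcx : c • x = algebraMap F K c * x := by
      rw [← Algebra.smul_def]
      rfl
    have hcne : algebraMap F K c ≠ 0 := by
      rw [Ne, map_eq_zero_iff _ hC.algebraMap_injective]
      exact fun h0 => hc (Subtype.ext h0)
    rw [hcx, star_mul', hC.star_algebraMap] at hz'
    exact mul_left_cancel₀ hcne hz'
  let I : Ideal (intK p F K) :=
    { carrier := {z | (z : K) * y ∈ intK p F K}
      add_mem' := fun {a b} ha hb => by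
        change ((a : K) + b) * y ∈ intK p F K
        rw [add_mul]
        exact add_mem ha hb
      zero_mem' := by
        change (0 : K) * y ∈ intK p F K
        rw [zero_mul]
        exact zero_mem _
      smul_mem' := fun c a ha => by
        change ((c : K) * a) * y ∈ intK p F K
        rw [mul_assoc]
        exact mul_mem c.2 ha }
  have h1 : (1 : K) * y ∈ intK p F K :=
    one_mem_of_forall_sub_mem (R := intF p F) (A := intK p F K) σ hσ I fun x => hy x x.2
  rwa [one_mul] at h1

/-- The trace form of `K` over `F` is a perfect pairing on the rings of integers. -/
theorem mem_of_forall_trace_mem [FiniteDimensional ℚ_[p] F] (hp : p ≠ 2) {y : K}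
    (hy : ∀ s ∈ intK p F K, s * y + star (s * y) ∈ intK p F K) : y ∈ intK p F K := by
  have hC := h
  have : CharZero F := charZero_of_injective_algebraMap (algebraMap ℚ_[p] F).injective
  rcases h with h | ⟨e, he⟩ | h
  -- If K = F, taking s = 1 gives 2y ∈ 𝒪, and 2 is a unit.
  · have h1 := hy 1 (one_mem _)
    rw [h.2, one_mul, ← two_mul] at h1
    have h2 := mul_mem (inv_two_mem (K := K) (F := F) hp) h1
    rwa [← mul_assoc, mul_comm _ (2 : K), two_mul_inv_two, one_mul] at h2
  -- If K = F ⊕ F, testing against the two idempotents recovers both coordinates of y.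
  · have hidem : ∀ i : F × F, i * i = i → e.symm i ∈ intK p F K := by
      intro i hi
      refine ⟨Polynomial.X ^ 2 - Polynomial.X, Polynomial.monic_X_pow_sub
        (by rw [Polynomial.degree_X]; norm_num), ?_⟩
      rw [Polynomial.eval₂_sub, Polynomial.eval₂_pow, Polynomial.eval₂_X, pow_two, ← map_mul, hi,
        sub_self]
    have m1 := hidem (1, 0) (by simp)
    have m2 := hidem (0, 1) (by simp)
    have e1 : e.symm (1, 0) * y + star (e.symm (1, 0) * y) = algebraMap F K (e y).1 := by
      apply e.injective
      rw [map_add, he, map_mul, e.apply_symm_apply, e.commutes]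
      ext <;> simp
    have e2 : e.symm (0, 1) * y + star (e.symm (0, 1) * y) = algebraMap F K (e y).2 := by
      apply e.injective
      rw [map_add, he, map_mul, e.apply_symm_apply, e.commutes]
      ext <;> simp
    have hy' : y = e.symm (1, 0) * algebraMap F K (e y).1 +
        e.symm (0, 1) * algebraMap F K (e y).2 := by
      apply e.injective
      rw [map_add, map_mul, map_mul, e.apply_symm_apply, e.apply_symm_apply, e.commutes, e.commutes]
      ext <;> simp
    rw [hy', ← e1, ← e2]
    exact add_mem (mul_mem m1 (hy _ m1)) (mul_mem m2 (hy _ m2))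
  · refine mem_of_forall_sub_star h fun x hx => ?_
    -- With tr z = z + z̄, this reads (x - x̄) y = tr(xy) - x̄ tr(y).
    have e : (x - star x) * y = (x * y + star (x * y)) - star x * (1 * y + star (1 * y)) := by
      rw [star_mul', one_mul]
      ring
    rw [e]
    exact sub_mem (hy x hx) (mul_mem (hC.star_mem hx) (hy 1 (one_mem _)))

omit h in
-- In a field |x x̄| = |x|². The split case has to be excluded: (p⁻¹, p) has norm 1 without being
-- integral. This is where the extra condition on du⁻¹ in case (U1) comes from.
theorem mem_of_mul_star_mem [FiniteDimensional ℚ_[p] F]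
    (h : IsBaseField F K ∨ IsUnramifiedQuadratic p F K) {x : K}
    (hx : x * star x ∈ intK p F K) : x ∈ intK p F K := by
  have hC : IsCoefficientAlgebra p F K := h.elim Or.inl fun h => Or.inr (Or.inr h)
  rcases h with h | h
  · rw [h.2, ← pow_two] at hx
    exact IsIntegral.of_pow two_pos hx
  · let _ : Field K := h.1.toField
    let _ : Algebra ℚ_[p] K := ((algebraMap F K).comp (algebraMap ℚ_[p] F)).toAlgebra
    have : IsScalarTower ℚ_[p] F K := IsScalarTower.of_algebraMap_eq fun _ => rfl
    have hfd : FiniteDimensional F K := hC.finiteDimensional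
    have : FiniteDimensional ℚ_[p] K := FiniteDimensional.trans ℚ_[p] F K
    have : IsScalarTower (PadicInt.subring p) (intF p F) K := IsScalarTower.of_algebraMap_eq
      fun _ => rfl
    have hx' : IsIntegral (PadicInt.subring p) (x * star x) := isIntegral_trans _ hx
    exact (isIntegral_subring_of_mul_algEquiv p (hC.starAlgEquiv.restrictScalars ℚ_[p])
      hx').tower_top

end IsCoefficientAlgebra

end Coefficient

/-! ### Gauss integrals over open compact subgroups -/

section GaussIntegrals

variable {F : Type*} [Field F] [TopologicalSpace F] [IsTopologicalRing F]
  [LocallyCompactSpace F] [SecondCountableTopology F] [MeasurableSpace F] [BorelSpace F]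
  (ν : Measure F) [ν.IsAddHaarMeasure] {ψ : AddChar F ℂ}

omit [LocallyCompactSpace F] [SecondCountableTopology F] in
theorem setIntegral_add_right_of_mem {E : Type*} [NormedAddCommGroup E] [NormedSpace ℝ E]
    {M : AddSubgroup F} (hM : IsOpen (M : Set F)) (f : F → E) {y : F} (hy : y ∈ M) :
    ∫ x in M, f (x + y) ∂ν = ∫ x in M, f x ∂ν := by
  have hm : MeasurableSet (M : Set F) := hM.measurableSet
  rw [← integral_indicator hm, ← integral_indicator hm,
    ← integral_add_right_eq_self ((M : Set F).indicator f) y]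
  congr 1
  ext x
  have hiff : x + y ∈ M ↔ x ∈ M := AddSubgroup.add_mem_cancel_right M hy
  by_cases hx : x ∈ M
  · rw [Set.indicator_of_mem (hiff.2 hx), Set.indicator_of_mem hx]
  · rw [Set.indicator_of_notMem (mt hiff.1 hx), Set.indicator_of_notMem hx]

open Classical in
omit [LocallyCompactSpace F] [SecondCountableTopology F] in
-- Orthogonality of characters: translating by y ∈ M multiplies the integral by ψ(zy).
theorem setIntegral_addChar {M : AddSubgroup F} (hM : IsOpen (M : Set F)) (z : F) :
    ∫ y in M, ψ (z * y) ∂ν = if ∀ y ∈ M, ψ (z * y) = 1 then (ν.real M : ℂ) else 0 := by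
  split_ifs with h
  · rw [setIntegral_congr_fun hM.measurableSet (g := fun _ => (1 : ℂ)) fun y hy => h y hy]
    simp
  · push Not at h
    obtain ⟨y, hy, hne⟩ := h
    have h1 := setIntegral_add_right_of_mem ν hM (fun x => ψ (z * x)) hy
    simp only [mul_add, AddChar.map_add_eq_mul] at h1
    rw [integral_mul_const] at h1
    have h2 : (∫ x in M, ψ (z * x) ∂ν) * (ψ (z * y) - 1) = 0 := by
      rw [mul_sub, h1, mul_one, sub_self]
    exact (mul_eq_zero.1 h2).resolve_right (sub_ne_zero.2 hne)

theorem setIntegral_swap_of_isCompact {M L : AddSubgroup F} (hMo : IsOpen (M : Set F))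
    (hMc : IsCompact (M : Set F)) (hLo : IsOpen (L : Set F)) (hLc : IsCompact (L : Set F)) {f : F → F → ℂ}
    (hf : Continuous (Function.uncurry f)) :
    ∫ x in M, ∫ y in L, f x y ∂ν ∂ν = ∫ y in L, ∫ x in M, f x y ∂ν ∂ν := by
  refine integral_integral_swap ?_
  rw [Measure.prod_restrict]
  exact hf.continuousOn.integrableOn_compact' (hMc.prod hLc)
    (hMo.measurableSet.prod hLo.measurableSet)

/-- The elements `x` orthogonal to `L` with respect to the pairing `(x, y) ↦ ψ (c x y)`. -/
def perp (ψ : AddChar F ℂ) (c : F) (L : AddSubgroup F) : Set F :=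
  {x | ∀ y ∈ L, ψ (c * x * y) = 1}

omit [IsTopologicalRing F] [TopologicalSpace F] [LocallyCompactSpace F] [SecondCountableTopology F] [BorelSpace F]
  [ν.IsAddHaarMeasure] in
open Classical in
theorem setIntegral_ite_perp (c : F) {M L : AddSubgroup F}
    (hmeas : MeasurableSet (perp ψ c L)) (f : F → ℂ) :
    ∫ x in M, f x * (if ∀ y ∈ L, ψ (c * x * y) = 1 then (ν.real L : ℂ) else 0) ∂ν =
      (ν.real L : ℂ) * ∫ x in (M : Set F) ∩ perp ψ c L, f x ∂ν := by
  have : ∀ x, f x * (if ∀ y ∈ L, ψ (c * x * y) = 1 then (ν.real L : ℂ) else 0) =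
      (ν.real L : ℂ) * (perp ψ c L).indicator f x := by
    intro x
    by_cases hx : ∀ y ∈ L, ψ (c * x * y) = 1
    · rw [if_pos hx, Set.indicator_of_mem (show x ∈ perp ψ c L from hx), mul_comm]
    · rw [if_neg hx, Set.indicator_of_notMem (show x ∉ perp ψ c L from hx), mul_zero, mul_zero]
  simp_rw [this]
  rw [integral_const_mul, setIntegral_indicator hmeas]

/-- Replace x by x + y and average over y ∈ L. Since ψ(by²) = 1, the integrand only acquires the
factor ψ(2bxy), and its average over L is the indicator function of the orthogonal complement of L.
-/
theorem setIntegral_gauss_eq (hψ : Continuous ψ) (b : F) {M L : AddSubgroup F}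
    (hMo : IsOpen (M : Set F)) (hMc : IsCompact (M : Set F)) (hLo : IsOpen (L : Set F))
    (hLc : IsCompact (L : Set F)) (hLM : L ≤ M) (hL : ∀ y ∈ L, ψ (b * y ^ 2) = 1)
    (hmeas : MeasurableSet (perp ψ (2 * b) L)) :
    ∫ x in M, ψ (b * x ^ 2) ∂ν = ∫ x in (M : Set F) ∩ perp ψ (2 * b) L, ψ (b * x ^ 2) ∂ν := by
  classical
  have hpos : (ν.real L : ℂ) ≠ 0 := by
    rw [Complex.ofReal_ne_zero, measureReal_def]
    exact (ENNReal.toReal_pos (hLo.measure_pos ν ⟨0, L.zero_mem⟩).ne' hLc.measure_lt_top.ne).ne'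
  apply mul_left_cancel₀ hpos
  rw [← setIntegral_ite_perp ν (2 * b) hmeas]
  simp_rw [← setIntegral_addChar ν hLo, ← integral_const_mul]
  rw [setIntegral_swap_of_isCompact ν hMo hMc hLo hLc]
  · rw [setIntegral_congr_fun hLo.measurableSet (g := fun _ => ∫ x in M, ψ (b * x ^ 2) ∂ν)]
    · rw [setIntegral_const, Complex.real_smul, integral_const_mul]
    · intro y hy
      simp only
      rw [← setIntegral_add_right_of_mem ν hMo (fun x => ψ (b * x ^ 2)) (hLM hy)]
      congr 1
      ext x
      rw [show b * (x + y) ^ 2 = b * x ^ 2 + 2 * b * x * y + b * y ^ 2 by ring,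
        AddChar.map_add_eq_mul, AddChar.map_add_eq_mul, hL y hy, mul_one]
  · simp only [Function.uncurry_def]
    fun_prop

/-- The computation of |Gauss sum|²: substitute x + y for x, so that bx² - by² becomes bx² + 2bxy,
and integrate over y. It serves to show that a Gauss integral is not zero. -/
theorem setIntegral_gauss_mul (hψ : Continuous ψ) (b : F) {M : AddSubgroup F}
    (hMo : IsOpen (M : Set F)) (hMc : IsCompact (M : Set F))
    (hmeas : MeasurableSet (perp ψ (2 * b) M)) :
    (∫ x in M, ψ (b * x ^ 2) ∂ν) * ∫ y in M, ψ (-(b * y ^ 2)) ∂ν =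
      (ν.real M : ℂ) * ∫ x in (M : Set F) ∩ perp ψ (2 * b) M, ψ (b * x ^ 2) ∂ν := by
  classical
  rw [← setIntegral_ite_perp ν (2 * b) hmeas, ← integral_const_mul]
  simp_rw [← setIntegral_addChar ν hMo, ← integral_const_mul]
  rw [setIntegral_swap_of_isCompact ν hMo hMc hMo hMc]
  · refine setIntegral_congr_fun hMo.measurableSet fun y hy => ?_
    rw [← setIntegral_add_right_of_mem ν hMo (fun x => ψ (b * x ^ 2)) hy, ← integral_mul_const]
    congr 1
    ext x
    rw [← AddChar.map_add_eq_mul, ← AddChar.map_add_eq_mul]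
    congr 1
    ring
  · simp only [Function.uncurry_def]
    fun_prop

end GaussIntegrals

/-! ### Nonvanishing of Weil indices -/

section WeilIndex

variable (p : ℕ) [Fact p.Prime] {F : Type*} [Field F] [Algebra ℚ_[p] F] [FiniteDimensional ℚ_[p] F]
  [TopologicalSpace F] [IsModuleTopology ℚ_[p] F] [MeasurableSpace F] [BorelSpace F]

/-- The fractional ideal `c⁻¹ 𝒪_F`. -/
def fracIdeal (c : F) : AddSubgroup F :=
  (intF p F).toSubring.toAddSubgroup.comap (AddMonoidHom.mulLeft c)

omit [FiniteDimensional ℚ_[p] F] [TopologicalSpace F] [IsModuleTopology ℚ_[p] F]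
  [MeasurableSpace F] [BorelSpace F] in
theorem mem_fracIdeal {c x : F} : x ∈ fracIdeal p c ↔ c * x ∈ intF p F := Iff.rfl

omit [MeasurableSpace F] [BorelSpace F] in
theorem isOpen_fracIdeal (c : F) : IsOpen (fracIdeal p c : Set F) := by
  have : IsTopologicalRing F := IsModuleTopology.isTopologicalRing ℚ_[p] F
  exact (isOpen_intF p F).preimage (continuous_const_mul c)

omit [MeasurableSpace F] [BorelSpace F] in
theorem isCompact_fracIdeal {c : F} (hc : c ≠ 0) : IsCompact (fracIdeal p c : Set F) := by
  have : IsTopologicalRing F := IsModuleTopology.isTopologicalRing ℚ_[p] F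
  convert (isCompact_intF p F).image (continuous_const_mul c⁻¹)
  ext x
  constructor
  · intro hx
    exact ⟨c * x, hx, inv_mul_cancel_left₀ hc x⟩
  · rintro ⟨y, hy, rfl⟩
    rw [SetLike.mem_coe, mem_fracIdeal, mul_inv_cancel_left₀ hc]
    exact hy

omit [FiniteDimensional ℚ_[p] F] [IsModuleTopology ℚ_[p] F]
  [MeasurableSpace F] [BorelSpace F] in
theorem perp_fracIdeal {ψ : AddChar F ℂ} (hψ : HasConductorIntegers p ψ) (b : F) {c : F}
    (hc : c ≠ 0) : perp ψ b (fracIdeal p c) = fracIdeal p (b * c⁻¹) := by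
  ext x
  rw [SetLike.mem_coe, mem_fracIdeal, ← hψ.2]
  constructor
  · intro h y hy
    have := h (c⁻¹ * y) (by rwa [mem_fracIdeal, mul_inv_cancel_left₀ hc])
    rw [← this]
    congr 1
    ring
  · intro h y hy
    rw [← h (c * y) hy]
    congr 1
    field_simp

omit [FiniteDimensional ℚ_[p] F] [IsModuleTopology ℚ_[p] F]
  [MeasurableSpace F] [BorelSpace F] in
theorem HasConductorIntegers.eq_one {ψ : AddChar F ℂ} (hψ : HasConductorIntegers p ψ) {x : F}
    (hx : x ∈ intF p F) : ψ x = 1 := by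
  simpa using (hψ.2 1).2 (one_mem _) x hx

variable (F) in
omit [FiniteDimensional ℚ_[p] F] [TopologicalSpace F] [IsModuleTopology ℚ_[p] F]
  [MeasurableSpace F] [BorelSpace F] in
theorem natCast_prime_ne_zero : (p : F) ≠ 0 := by
  have : CharZero F := charZero_of_injective_algebraMap (algebraMap ℚ_[p] F).injective
  exact Nat.cast_ne_zero.2 (Fact.out : p.Prime).ne_zero

omit [MeasurableSpace F] [BorelSpace F] in
theorem eventually_pow_mul_mem_intF (x : F) : ∀ᶠ k : ℕ in atTop, (p : F) ^ k * x ∈ intF p F := by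
  have : IsTopologicalRing F := IsModuleTopology.isTopologicalRing ℚ_[p] F
  have hcont : Continuous fun c : ℚ_[p] => c • x := by fun_prop
  have hlim : Tendsto (fun k : ℕ => (p : ℚ_[p]) ^ k • x) atTop (𝓝 0) := by
    have h0 : Tendsto (fun k : ℕ => (p : ℚ_[p]) ^ k) atTop (𝓝 0) :=
      tendsto_pow_atTop_nhds_zero_of_norm_lt_one Padic.norm_p_lt_one
    have h1 := (hcont.tendsto 0).comp h0
    rwa [zero_smul] at h1
  filter_upwards [hlim.eventually ((isOpen_intF p F).mem_nhds (zero_mem _))] with k hk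
  rwa [Algebra.smul_def, map_pow, map_natCast] at hk

/-- The Gauss integrals over p⁻ᵏ𝒪_F do not depend on k for k large, and their common value I is not
zero. Both facts matter: a quotient 0/0 would be 0, and a divergent sequence would give the default
value of `limUnder`. -/
theorem weilIndex_ne_zero {ψ : AddChar F ℂ} (hψ : HasConductorIntegers p ψ)
    (ν : Measure F) [ν.IsAddHaarMeasure] {b : F} (hb : b ≠ 0) :
    weilIndex p ν (fun x => ψ (b * x)) ≠ 0 := by
  have : IsTopologicalRing F := IsModuleTopology.isTopologicalRing ℚ_[p] F
  have : LocallyCompactSpace F := (isCompact_intF p F).locallyCompactSpace_of_mem_nhds_of_addGroup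
    ((isOpen_intF p F).mem_nhds (zero_mem _))
  have : SecondCountableTopology F := secondCountable_of_finiteDimensional ℚ_[p] F
  have : CharZero F := charZero_of_injective_algebraMap (algebraMap ℚ_[p] F).injective
  have hp0 := natCast_prime_ne_zero p F
  have h2b : 2 * b ≠ 0 := mul_ne_zero two_ne_zero hb
  -- With pʲb integral, L = pʲ𝒪_F satisfies ψ(by²) = 1 for y ∈ L. M is its orthogonal complement for
  -- ψ(2bxy), and L is in turn that of M.
  obtain ⟨j, hj⟩ := (eventually_pow_mul_mem_intF p b).exists
  have hpO : (p : F) ∈ intF p F := natCast_mem _ _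
  have hq0 : ((p : F) ^ j)⁻¹ ≠ 0 := inv_ne_zero (pow_ne_zero _ hp0)
  set L := fracIdeal p ((p : F) ^ j)⁻¹
  set M := fracIdeal p (2 * b * ((p : F) ^ j)⁻¹⁻¹) with hMdef
  have hM0 : 2 * b * ((p : F) ^ j)⁻¹⁻¹ ≠ 0 := mul_ne_zero h2b (inv_ne_zero hq0)
  have hperpL : perp ψ (2 * b) L = M := perp_fracIdeal p hψ _ hq0
  have hperpM : perp ψ (2 * b) M = L := by
    rw [hMdef, perp_fracIdeal p hψ _ hM0]
    congr 2
    field_simp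
  have hLmem : ∀ y ∈ L, y ∈ intF p F ∧ b * y ^ 2 ∈ intF p F := by
    intro y hy
    have hy' : ((p : F) ^ j)⁻¹ * y ∈ intF p F := hy
    have e : y = (p : F) ^ j * (((p : F) ^ j)⁻¹ * y) := by field_simp
    have hyO : y ∈ intF p F := by
      rw [e]
      exact mul_mem (pow_mem hpO _) hy'
    refine ⟨hyO, ?_⟩
    have e2 : b * y ^ 2 = ((p : F) ^ j * b) * (((p : F) ^ j)⁻¹ * y) * y := by field_simp
    rw [e2]
    exact mul_mem (mul_mem hj hy') hyO
  have hL1 : ∀ y ∈ L, ψ (b * y ^ 2) = 1 := fun y hy => hψ.eq_one p (hLmem y hy).2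
  set I : ℂ := ∫ x in M, ψ (b * x ^ 2) ∂ν with hI
  -- The product of I with its counterpart for -b is vol(M)·vol(M ∩ L), because ψ(bx²) = 1 on the
  -- complement L of M.
  have hI0 : I ≠ 0 := by
    have hmul := setIntegral_gauss_mul ν hψ.1 b (isOpen_fracIdeal p _) (isCompact_fracIdeal p hM0)
      (by rw [hperpM]; exact (isOpen_fracIdeal p _).measurableSet)
    rw [hperpM] at hmul
    have hML : IsOpen ((M : Set F) ∩ L) := (isOpen_fracIdeal p _).inter (isOpen_fracIdeal p _)
    rw [setIntegral_congr_fun hML.measurableSet (g := fun _ => (1 : ℂ))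
      (fun y hy => hL1 y hy.2)] at hmul
    have hreal : ∀ S : Set F, IsOpen S → (0 : F) ∈ S → S ⊆ M → (ν.real S : ℂ) ≠ 0 := by
      intro S hS h0 hSM
      rw [Complex.ofReal_ne_zero, measureReal_def]
      exact (ENNReal.toReal_pos (hS.measure_pos ν ⟨0, h0⟩).ne'
        ((measure_mono hSM).trans_lt (isCompact_fracIdeal p hM0).measure_lt_top).ne).ne'
    intro h0
    rw [← hI, h0, zero_mul] at hmul
    simp only [integral_const, measureReal_restrict_apply_univ] at hmul
    rw [Complex.real_smul, mul_one] at hmul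
    exact mul_ne_zero (hreal M (isOpen_fracIdeal p _) M.zero_mem le_rfl)
      (hreal _ hML ⟨M.zero_mem, L.zero_mem⟩ Set.inter_subset_left) hmul.symm
  -- As soon as M ⊆ p⁻ᵏ𝒪_F, averaging over L reduces the integral over p⁻ᵏ𝒪_F to M.
  have hev : ∀ᶠ k : ℕ in atTop,
      ∫ x in {x : F | (p : F) ^ k * x ∈ intF p F}, ψ (b * x ^ 2) ∂ν = I := by
    filter_upwards [eventually_pow_mul_mem_intF p (2 * b * ((p : F) ^ j)⁻¹⁻¹)⁻¹] with k hk
    have hk0 : (p : F) ^ k ≠ 0 := pow_ne_zero _ hp0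
    have h1 := setIntegral_gauss_eq ν hψ.1 b (isOpen_fracIdeal p ((p : F) ^ k))
      (isCompact_fracIdeal p hk0) (isOpen_fracIdeal p _) (isCompact_fracIdeal p hq0)
      (fun y hy => mul_mem (pow_mem hpO k) (hLmem y hy).1) hL1
      (by rw [hperpL]; exact (isOpen_fracIdeal p _).measurableSet)
    have hsub : (M : Set F) ⊆ fracIdeal p ((p : F) ^ k) := by
      intro x hx
      have hx' : 2 * b * ((p : F) ^ j)⁻¹⁻¹ * x ∈ intF p F := hx
      have := mul_mem hk hx'
      rwa [mul_assoc, inv_mul_cancel_left₀ hM0] at this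
    rw [hperpL, Set.inter_eq_right.2 hsub] at h1
    exact h1
  have hlim : weilIndex p ν (fun x => ψ (b * x)) = I / (‖I‖ : ℂ) := by
    refine Tendsto.limUnder_eq (tendsto_const_nhds.congr' ?_)
    filter_upwards [hev] with k hk
    rw [hk]
  rw [hlim]
  exact div_ne_zero hI0 (by simpa using hI0)

end WeilIndex

/-! ### Integral matrices, unipotent matrices and leading minors -/

section IntegralMatrices

variable {R K : Type*} [CommRing R] [CommRing K] [Algebra R K] {O : Subalgebra R K}
  {ι κ l : Type*}

/-- The matrices with entries in the subring `O`. -/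
def IntMat (O : Subalgebra R K) (M : Matrix ι κ K) : Prop := ∀ i j, M i j ∈ O

theorem IntMat.mul [Fintype κ] {M : Matrix ι κ K} {N : Matrix κ l K} (hM : IntMat O M)
    (hN : IntMat O N) : IntMat O (M * N) := fun i j => by
  rw [Matrix.mul_apply]
  exact O.sum_mem fun k _ => O.mul_mem (hM i k) (hN k j)

theorem IntMat.add {M N : Matrix ι κ K} (hM : IntMat O M) (hN : IntMat O N) : IntMat O (M + N) :=
  fun i j => O.add_mem (hM i j) (hN i j)

theorem IntMat.neg {M : Matrix ι κ K} (hM : IntMat O M) : IntMat O (-M) :=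
  fun i j => O.neg_mem (hM i j)

theorem IntMat.sub {M N : Matrix ι κ K} (hM : IntMat O M) (hN : IntMat O N) : IntMat O (M - N) :=
  fun i j => O.sub_mem (hM i j) (hN i j)

theorem IntMat.transpose {M : Matrix ι κ K} (hM : IntMat O M) : IntMat O Mᵀ := fun i j => hM j i

theorem IntMat.submatrix {ι' κ' : Type*} {M : Matrix ι κ K} (hM : IntMat O M) (f : ι' → ι)
    (g : κ' → κ) : IntMat O (M.submatrix f g) := fun i j => hM (f i) (g j)

theorem IntMat.conjTranspose [StarRing K] (hs : ∀ x ∈ O, star x ∈ O) {M : Matrix ι κ K}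
    (hM : IntMat O M) : IntMat O Mᴴ := fun i j => hs _ (hM j i)

theorem IntMat.zero : IntMat O (0 : Matrix ι κ K) := fun _ _ => O.zero_mem

theorem IntMat.diagonal [DecidableEq ι] {c : ι → K} (hc : ∀ i, c i ∈ O) :
    IntMat O (diagonal c) := fun i j => by
  rw [Matrix.diagonal_apply]
  split_ifs
  exacts [hc i, O.zero_mem]

theorem IntMat.one [DecidableEq ι] : IntMat O (1 : Matrix ι ι K) :=
  IntMat.diagonal fun _ => O.one_mem

theorem IntMat.fromBlocks {ι' κ' : Type*} {A : Matrix ι κ K} {B : Matrix ι κ' K}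
    {C : Matrix ι' κ K} {D : Matrix ι' κ' K} (hA : IntMat O A) (hB : IntMat O B) (hC : IntMat O C)
    (hD : IntMat O D) : IntMat O (fromBlocks A B C D) := by
  rintro (i | i) (j | j)
  exacts [hA i j, hB i j, hC i j, hD i j]

theorem IntMat.fromRows {ι' : Type*} {A : Matrix ι κ K} {B : Matrix ι' κ K} (hA : IntMat O A)
    (hB : IntMat O B) : IntMat O (fromRows A B) := by
  rintro (i | i) j
  exacts [hA i j, hB i j]

theorem IntMat.fromCols {κ' : Type*} {A : Matrix ι κ K} {B : Matrix ι κ' K} (hA : IntMat O A)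
    (hB : IntMat O B) : IntMat O (fromCols A B) := by
  rintro i (j | j)
  exacts [hA i j, hB i j]

variable [Fintype ι] [DecidableEq ι]

/-- The inverse is the adjugate, whose entries are polynomials in those of g. -/
theorem mem_intGL_of_det_eq_one {g : GL ι K} (hg : IntMat O (g : Matrix ι ι K))
    (hdet : (g : Matrix ι ι K).det = 1) : g ∈ intGL O := by
  intro i j
  refine ⟨hg i j, ?_⟩
  rw [Matrix.coe_units_inv, Matrix.inv_def, hdet, Ring.inverse_one, one_smul]
  let M : Matrix ι ι O := fun i j => ⟨g i j, hg i j⟩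
  have hM : (g : Matrix ι ι K) = O.val.mapMatrix M := rfl
  rw [hM, ← AlgHom.map_adjugate]
  exact (M.adjugate i j).2

theorem intMat_of_mem_intGL {g : GL ι K} (hg : g ∈ intGL O) : IntMat O (g : Matrix ι ι K) :=
  fun i j => (hg i j).1

end IntegralMatrices

section Unipotent

variable {K : Type*} [CommRing K] {ι : Type*} [Fintype ι] [DecidableEq ι]

theorem det_eq_one_of_unipotent {b : ι → ℤ} {M : Matrix ι ι K}
    (hM : ∀ i j, b j ≤ b i → M i j = (1 : Matrix ι ι K) i j) : M.det = 1 := by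
  have htri : BlockTriangular M b := fun i j hij => by
    rw [hM i j hij.le, Matrix.one_apply_ne]
    rintro rfl
    exact lt_irrefl _ hij
  rw [htri.det]
  refine Finset.prod_eq_one fun a _ => ?_
  have : M.toSquareBlock b a = 1 := by
    ext i j
    rw [toSquareBlock_def, Matrix.of_apply, hM _ _ (by rw [i.2, j.2]), Matrix.one_apply,
      Matrix.one_apply]
    simp only [Subtype.ext_iff]
  rw [this, det_one]

theorem exists_mem_unipUpper {b : ι → ℤ} {M : Matrix ι ι K}
    (hM : ∀ i j, b j ≤ b i → M i j = (1 : Matrix ι ι K) i j) :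
    ∃ g ∈ unipUpper K b, (g : Matrix ι ι K) = M :=
  ⟨nonsingInvUnit M (by rw [det_eq_one_of_unipotent hM]; exact isUnit_one), hM, rfl⟩

theorem det_of_mem_unipUpper {b : ι → ℤ} {g : GL ι K} (hg : g ∈ unipUpper K b) :
    (g : Matrix ι ι K).det = 1 :=
  det_eq_one_of_unipotent hg

/-- A unipotent upper triangular factor on the right only adds earlier columns to later ones, so the
first k columns transform among themselves. -/
theorem mul_submatrix_castLE {κ κ' : Type*} {k n : ℕ} (h : k ≤ n) (X : Matrix κ (Fin n) K)
    {U : Matrix (Fin n) (Fin n) K} (hU : ∀ i j, j ≤ i → U i j = (1 : Matrix _ _ K) i j)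
    (f : κ' → κ) :
    (X * U).submatrix f (Fin.castLE h) =
      X.submatrix f (Fin.castLE h) * U.submatrix (Fin.castLE h) (Fin.castLE h) := by
  ext i j
  rw [submatrix_apply, Matrix.mul_apply, Matrix.mul_apply]
  refine (Fintype.sum_of_injective (Fin.castLE h) (Fin.castLE_injective h) _ _ ?_ ?_).symm
  · intro l hl
    have hlk : k ≤ (l : ℕ) := by
      by_contra! hlt
      exact hl ⟨⟨l, hlt⟩, Fin.ext rfl⟩
    have hlt : Fin.castLE h j < l := by
      rw [Fin.lt_def, Fin.val_castLE]
      omega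
    rw [hU _ _ hlt.le, Matrix.one_apply_ne hlt.ne', mul_zero]
  · intro l
    rfl

theorem unipotent_submatrix_castLE {k n : ℕ} (h : k ≤ n) {U : Matrix (Fin n) (Fin n) K}
    (hU : ∀ i j, j ≤ i → U i j = (1 : Matrix _ _ K) i j) (i j : Fin k) (hij : j ≤ i) :
    U.submatrix (Fin.castLE h) (Fin.castLE h) i j = (1 : Matrix _ _ K) i j := by
  rw [submatrix_apply, hU _ _ (by simpa using hij), Matrix.one_apply, Matrix.one_apply]
  simp only [(Fin.castLE_injective h).eq_iff]

theorem leadingMinor_mul_unipotent {m : ℕ} (Y : Matrix (Fin m) (Fin m) K)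
    {U : Matrix (Fin m) (Fin m) K} (hU : ∀ i j, j ≤ i → U i j = (1 : Matrix _ _ K) i j)
    (j : Fin m) : leadingMinor (Y * U) j = leadingMinor Y j := by
  rw [leadingMinor, mul_submatrix_castLE _ _ hU, det_mul,
    det_eq_one_of_unipotent (b := fun i : Fin (j + 1) => ((i : ℕ) : ℤ))
      (M := U.submatrix (Fin.castLE _) (Fin.castLE _)), mul_one, leadingMinor]
  intro i l hil
  exact unipotent_submatrix_castLE _ hU i l (by exact_mod_cast hil)

theorem leadingMinor_transpose {m : ℕ} (Y : Matrix (Fin m) (Fin m) K) (j : Fin m) :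
    leadingMinor Yᵀ j = leadingMinor Y j := by
  rw [leadingMinor, leadingMinor, ← det_transpose]
  rfl

theorem leadingMinor_unipotent_mul {m : ℕ} (Y : Matrix (Fin m) (Fin m) K)
    {U : Matrix (Fin m) (Fin m) K} (hU : ∀ i j, j ≤ i → U i j = (1 : Matrix _ _ K) i j)
    (j : Fin m) : leadingMinor (Uᵀ * Y) j = leadingMinor Y j := by
  rw [← leadingMinor_transpose, transpose_mul, transpose_transpose,
    leadingMinor_mul_unipotent _ hU, leadingMinor_transpose]

end Unipotent

/-! ### The big cell B⁻(𝒪)B(𝒪) -/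

section BigCell

variable (p : ℕ) [Fact p.Prime] (F : Type*) [Field F] [Algebra ℚ_[p] F]
  {K : Type*} [CommRing K] [Algebra F K] {m n : ℕ}

variable {p F} in
theorem mem_unipGL {g : GL (Fin n) K} : g ∈ unipGL p F K n ↔
    (∀ i j, j ≤ i → g.val i j = (1 : Matrix _ _ K) i j) ∧
      IntMat (intK p F K) g.val := by
  constructor
  · rintro ⟨h1, h2⟩
    exact ⟨fun i j hij => h1 i j (Int.ofNat_le.2 hij), intMat_of_mem_intGL h2⟩
  · rintro ⟨h1, h2⟩
    have h1' : g ∈ unipUpper K (fun i : Fin n => (i : ℤ)) := fun i j hij =>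
      h1 i j (Int.ofNat_le.1 hij)
    exact ⟨h1', mem_intGL_of_det_eq_one h2 (det_of_mem_unipUpper h1')⟩

theorem exists_mem_unipGL {M : Matrix (Fin n) (Fin n) K}
    (hM : ∀ i j, j ≤ i → M i j = (1 : Matrix _ _ K) i j) (hO : IntMat (intK p F K) M) :
    ∃ g ∈ unipGL p F K n, g.val = M := by
  obtain ⟨g, -, rfl⟩ := exists_mem_unipUpper (b := fun i : Fin n => (i : ℤ)) (M := M)
    fun i j hij => hM i j (by exact_mod_cast hij)
  exact ⟨g, mem_unipGL.2 ⟨hM, hO⟩, rfl⟩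

variable {p F} in
theorem intMat_of_mem_bigCell {Y : Matrix (Fin m) (Fin m) K} (hY : Y ∈ bigCell p F m) :
    IntMat (intK p F K) Y := by
  obtain ⟨b₁, h₁, b₂, h₂, -, -, rfl⟩ := hY
  exact (intMat_of_mem_intGL h₁).mul (intMat_of_mem_intGL h₂)

variable {p F} in
theorem diagonal_mem_bigCell {c : Fin m → Kˣ} (hc : ∀ i, (c i : K) ∈ intK p F K)
    (hc' : ∀ i, (c i)⁻¹.val ∈ intK p F K) :
    diagonal (fun i => (c i : K)) ∈ bigCell p F m := by
  refine ⟨diagGL c, fun i j => ⟨IntMat.diagonal hc i j, IntMat.diagonal hc' i j⟩, 1, one_mem _,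
    fun i j hij => diagonal_apply_ne _ hij.ne, fun i j hij => ?_, ?_⟩
  · rw [Units.val_one, Matrix.one_apply_ne hij.ne']
  · rw [Units.val_one, Matrix.mul_one]
    rfl

variable {p F} in
theorem mul_mem_bigCell {Y : Matrix (Fin m) (Fin m) K} (hY : Y ∈ bigCell p F m)
    {g : GL (Fin m) K} (hg : g ∈ unipGL p F K m) : Y * g.val ∈ bigCell p F m := by
  obtain ⟨b₁, h₁, b₂, h₂, t₁, t₂, rfl⟩ := hY
  refine ⟨b₁, h₁, b₂ * g, mul_mem h₂ hg.2, t₁, ?_, ?_⟩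
  · intro i j hij
    have hb : BlockTriangular b₂.val id := fun i j h => t₂ i j h
    have hgt : BlockTriangular g.val id := fun i j (h : j < i) => by
      rw [(mem_unipGL.1 hg).1 i j h.le, Matrix.one_apply_ne h.ne']
    exact (hb.mul hgt) hij
  · rw [Units.val_mul, Matrix.mul_assoc]

theorem exists_transpose_mem_intGL {b : GL (Fin m) K} (hb : b ∈ intGL (intK p F K)) :
    ∃ b' ∈ intGL (ι := Fin m) (intK p F K), b'.val = b.valᵀ := by
  refine ⟨⟨b.valᵀ, (b⁻¹).valᵀ, ?_, ?_⟩, fun i j => hb j i, rfl⟩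
  · rw [← transpose_mul, ← Units.val_mul, inv_mul_cancel, Units.val_one, transpose_one]
  · rw [← transpose_mul, ← Units.val_mul, mul_inv_cancel, Units.val_one, transpose_one]

variable {p F} in
theorem transpose_mem_bigCell {Y : Matrix (Fin m) (Fin m) K} (hY : Y ∈ bigCell p F m) :
    Yᵀ ∈ bigCell p F m := by
  obtain ⟨b₁, h₁, b₂, h₂, t₁, t₂, rfl⟩ := hY
  obtain ⟨c₁, k₁, e₁⟩ := exists_transpose_mem_intGL p F h₁
  obtain ⟨c₂, k₂, e₂⟩ := exists_transpose_mem_intGL p F h₂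
  refine ⟨c₂, k₂, c₁, k₁, fun i j hij => ?_, fun i j hij => ?_, ?_⟩
  · rw [e₂, transpose_apply, t₂ j i hij]
  · rw [e₁, transpose_apply, t₁ j i hij]
  · rw [transpose_mul, e₁, e₂]

variable {p F} in
theorem transpose_mul_mem_bigCell {Y : Matrix (Fin m) (Fin m) K} (hY : Y ∈ bigCell p F m)
    {g : GL (Fin m) K} (hg : g ∈ unipGL p F K m) :
    g.valᵀ * Y ∈ bigCell p F m := by
  have := transpose_mem_bigCell (mul_mem_bigCell (transpose_mem_bigCell hY) hg)
  rwa [transpose_mul, transpose_transpose] at this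

/-- An upper triangular matrix in `GL(𝒪)` is the product of a diagonal one and a unipotent one. -/
theorem exists_diagonal_mul_unipotent {b : GL (Fin m) K} (hb : b ∈ intGL (intK p F K))
    (ht : ∀ i j, j < i → b.val i j = 0) :
    ∃ c : Fin m → Kˣ, (∀ i, (c i).val ∈ intK p F K ∧ (c i)⁻¹.val ∈ intK p F K) ∧
      ∃ g ∈ unipGL p F K m, b.val = diagonal (fun i => (c i : K)) * g := by
  have htri : BlockTriangular b.val id := fun i j h => ht i j h
  have : Invertible b.val := b.invertible
  have htri' : BlockTriangular (b⁻¹).val id := by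
    rw [Matrix.coe_units_inv]
    exact blockTriangular_inv_of_blockTriangular htri
  have hmul : ∀ i, b.val i i * (b⁻¹).val i i = 1 := by
    intro i
    have h1 : (b.val * (b⁻¹).val) i i = 1 := by
      rw [← Units.val_mul, mul_inv_cancel, Units.val_one, Matrix.one_apply_eq]
    rw [Matrix.mul_apply, Finset.sum_eq_single i] at h1
    · exact h1
    · intro k _ hk
      rcases lt_or_gt_of_ne hk with h | h
      · rw [ht i k h, zero_mul]
      · rw [htri' h, mul_zero]
    · intro h
      exact absurd (Finset.mem_univ i) h
  let c : Fin m → Kˣ := fun i => ⟨_, _, hmul i, by rw [mul_comm, hmul i]⟩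
  have hc : ∀ i, (c i).val ∈ intK p F K ∧ (c i)⁻¹.val ∈ intK p F K :=
    fun i => ⟨(hb i i).1, (hb i i).2⟩
  obtain ⟨g, hg, hge⟩ := exists_mem_unipGL p F
    (M := diagonal (fun i => (c i)⁻¹.val) * b.val) (by
      intro i j hij
      rw [diagonal_mul]
      rcases hij.lt_or_eq with h | rfl
      · rw [ht i j h, mul_zero, Matrix.one_apply_ne h.ne']
      · rw [Matrix.one_apply_eq]
        exact (c j).inv_mul)
    ((IntMat.diagonal fun i => (hc i).2).mul (intMat_of_mem_intGL hb))
  refine ⟨c, hc, g, hg, ?_⟩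
  rw [hge, ← Matrix.mul_assoc, diagonal_mul_diagonal]
  simp

/-- Splitting off the diagonals of both triangular factors gives an integral LDU decomposition,
where only the diagonal is not removable by unipotent operations. -/
theorem exists_of_mem_bigCell {Y : Matrix (Fin m) (Fin m) K} (hY : Y ∈ bigCell p F m) :
    ∃ L ∈ unipGL p F K m, ∃ U ∈ unipGL p F K m, ∃ c : Fin m → Kˣ,
      (∀ i, (c i).val ∈ intK p F K ∧ (c i)⁻¹.val ∈ intK p F K) ∧
      Y = L.valᵀ * diagonal (fun i => (c i : K)) * U.val := by
  obtain ⟨b₁, h₁, b₂, h₂, t₁, t₂, rfl⟩ := hY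
  obtain ⟨b₁', h₁', e₁⟩ := exists_transpose_mem_intGL p F h₁
  obtain ⟨c₁, k₁, L, hL, f₁⟩ := exists_diagonal_mul_unipotent p F h₁' fun i j hij => by
    rw [e₁, transpose_apply, t₁ j i hij]
  obtain ⟨c₂, k₂, U, hU, f₂⟩ := exists_diagonal_mul_unipotent p F h₂ t₂
  refine ⟨L, hL, U, hU, fun i => c₁ i * c₂ i, fun i => ⟨mul_mem (k₁ i).1 (k₂ i).1, ?_⟩, ?_⟩
  · rw [mul_inv, Units.val_mul]
    exact mul_mem (k₁ i).2 (k₂ i).2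
  · have e₁' : b₁.val = L.valᵀ * diagonal fun i => (c₁ i : K) := by
      rw [← transpose_transpose b₁.val, ← e₁, f₁, transpose_mul, diagonal_transpose]
    rw [e₁', f₂, Matrix.mul_assoc, ← Matrix.mul_assoc (diagonal _), diagonal_mul_diagonal,
      ← Matrix.mul_assoc]
    simp only [Units.val_mul]

end BigCell

/-! ### Block rows of matrices and the unipotent group of `H` -/

section RowBlocks

variable {K : Type*} [CommRing K] {m n ε : ℕ} {κ l : Type*}

/-- The index `i` in the first block of `m` indices. -/
def rowT (ε : ℕ) (i : Fin m) : Row m ε := Sum.inl (Sum.inl i)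

/-- The index `m + i` in the second block of `m` indices. -/
def rowM (ε : ℕ) (i : Fin m) : Row m ε := Sum.inl (Sum.inr i)

/-- The index `2m + i` in the last block of `ε` indices. -/
def rowB (m : ℕ) (i : Fin ε) : Row m ε := Sum.inr i

/-- The first `m` rows. -/
def topRows (X : Matrix (Row m ε) κ K) : Matrix (Fin m) κ K := X.submatrix (rowT ε) id

/-- The rows `m + 1, …, 2m`. -/
def midRows (X : Matrix (Row m ε) κ K) : Matrix (Fin m) κ K := X.submatrix (rowM ε) id

/-- The last `ε` rows. -/
def botRows (X : Matrix (Row m ε) κ K) : Matrix (Fin ε) κ K := X.submatrix (rowB m) id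

omit [CommRing K] in
theorem topRows_apply (X : Matrix (Row m ε) κ K) (i j) : topRows X i j = X (rowT ε i) j := rfl

omit [CommRing K] in
theorem midRows_apply (X : Matrix (Row m ε) κ K) (i j) : midRows X i j = X (rowM ε i) j := rfl

omit [CommRing K] in
theorem botRows_apply (X : Matrix (Row m ε) κ K) (i j) : botRows X i j = X (rowB m i) j := rfl

theorem topRows_mul [Fintype κ] (X : Matrix (Row m ε) κ K) (A : Matrix κ l K) :
    topRows (X * A) = topRows X * A := rfl

theorem midRows_mul [Fintype κ] (X : Matrix (Row m ε) κ K) (A : Matrix κ l K) :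
    midRows (X * A) = midRows X * A := rfl

theorem botRows_mul [Fintype κ] (X : Matrix (Row m ε) κ K) (A : Matrix κ l K) :
    botRows (X * A) = botRows X * A := rfl

theorem forall_row {q : Row m ε → Prop} :
    (∀ i, q i) ↔ (∀ i, q (rowT ε i)) ∧ (∀ i, q (rowM ε i)) ∧ ∀ i, q (rowB m i) :=
  ⟨fun h => ⟨fun _ => h _, fun _ => h _, fun _ => h _⟩, fun ⟨h₁, h₂, h₃⟩ => by
    rintro ((i | i) | i)
    exacts [h₁ i, h₂ i, h₃ i]⟩

theorem sum_row {A : Type*} [AddCommMonoid A] (f : Row m ε → A) :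
    ∑ i, f i = ∑ i, f (rowT ε i) + ∑ i, f (rowM ε i) + ∑ i, f (rowB m i) := by
  rw [Fintype.sum_sum_type, Fintype.sum_sum_type]
  rfl

theorem submatrix_transpose_mul (v : Matrix (Row m ε) (Row m ε) K) (X : Matrix (Row m ε) κ K)
    (f : l → Row m ε) :
    (vᵀ * X).submatrix f id = (v.submatrix (rowT ε) f)ᵀ * topRows X +
      (v.submatrix (rowM ε) f)ᵀ * midRows X + (v.submatrix (rowB m) f)ᵀ * botRows X := by
  ext i j
  simp only [submatrix_apply, Matrix.mul_apply, Matrix.add_apply, sum_row, transpose_apply, id,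
    topRows_apply, midRows_apply, botRows_apply]

theorem formH_mul (X : Matrix (Row m ε) κ K) :
    topRows (formH K m ε * X) = midRows X ∧ midRows (formH K m ε * X) = topRows X ∧
      botRows (formH K m ε * X) = botRows X := by
  refine ⟨?_, ?_, ?_⟩ <;> ext i j <;>
    simp [topRows_apply, midRows_apply, botRows_apply, Matrix.mul_apply, formH, rowT, rowM, rowB,
      Matrix.one_apply]

theorem conjTranspose_mul_formH_mul [StarRing K] (X : Matrix (Row m ε) κ K)
    (X' : Matrix (Row m ε) l K) :
    Xᴴ * formH K m ε * X' =
      (topRows X)ᴴ * midRows X' + (midRows X)ᴴ * topRows X' + (botRows X)ᴴ * botRows X' := by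
  obtain ⟨h₁, h₂, h₃⟩ := formH_mul X'
  rw [Matrix.mul_assoc, ← h₁, ← h₂, ← h₃]
  ext i j
  simp only [Matrix.mul_apply, Matrix.add_apply, sum_row, conjTranspose_apply, topRows_apply,
    midRows_apply, botRows_apply]

/-- The isometry relation read block by block; `f` and `g` select the two block columns. -/
theorem blocks_of_mem_groupH [StarRing K] {v : GL (Row m ε) K} (hv : v ∈ groupH K m ε) {κ l : Type*}
    (f : κ → Row m ε) (g : l → Row m ε) :
    (v.val.submatrix (rowT ε) f)ᴴ * v.val.submatrix (rowM ε) g +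
      (v.val.submatrix (rowM ε) f)ᴴ * v.val.submatrix (rowT ε) g +
      (v.val.submatrix (rowB m) f)ᴴ * v.val.submatrix (rowB m) g =
      (formH K m ε).submatrix f g := by
  have h : v.valᴴ * formH K m ε * v.val = formH K m ε := hv
  rw [conjTranspose_mul_formH_mul] at h
  rw [← h]
  rfl

theorem blocks_of_mem_unipUpper {v : GL (Row m ε) K} (hv : v ∈ unipUpper K (orderH m ε)) :
    v.val.submatrix (rowM ε) (rowT ε) = 0 ∧ v.val.submatrix (rowB m) (rowT ε) = 0 ∧
      v.val.submatrix (rowM ε) (rowB m) = 0 ∧ v.val.submatrix (rowB m) (rowB m) = 1 ∧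
      ∀ i j, j ≤ i → v.val.submatrix (rowT ε) (rowT ε) i j = (1 : Matrix _ _ K) i j := by
  refine ⟨?_, ?_, ?_, ?_, ?_⟩
  · ext i j
    rw [submatrix_apply, hv _ _ (by simp only [orderH, rowM, rowT, Sum.elim_inl, Sum.elim_inr]; omega)]
    rfl
  · ext i j
    rw [submatrix_apply, hv _ _ (by simp only [orderH, rowB, rowT, Sum.elim_inl, Sum.elim_inr]; omega)]
    rfl
  · ext i j
    rw [submatrix_apply, hv _ _ (by simp only [orderH, rowB, rowM, Sum.elim_inl, Sum.elim_inr]; omega)]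
    rfl
  · ext i j
    rw [submatrix_apply, hv _ _ (by simp only [orderH, rowB, Sum.elim_inr]; omega)]
    simp [rowB, Matrix.one_apply]
  · intro i j hij
    rw [submatrix_apply, hv _ _ (by
      simp only [orderH, rowT, Sum.elim_inl]; have := Fin.le_def.1 hij; omega)]
    simp [rowT, Matrix.one_apply]

end RowBlocks

section UnipH

variable {p : ℕ} [Fact p.Prime] {F : Type*} [Field F] [Algebra ℚ_[p] F]
  {K : Type*} [CommRing K] [Algebra F K] [StarRing K] {m n ε : ℕ}

theorem mem_unipH {v : GL (Row m ε) K} : v ∈ unipH p F K m ε ↔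
    v ∈ groupH K m ε ∧ v ∈ unipUpper K (orderH m ε) ∧ IntMat (intK p F K) v.val := by
  constructor
  · rintro ⟨⟨h₁, h₂⟩, h₃⟩
    exact ⟨h₁, h₂, intMat_of_mem_intGL h₃⟩
  · rintro ⟨h₁, h₂, h₃⟩
    exact ⟨⟨h₁, h₂⟩, mem_intGL_of_det_eq_one h₃ (det_of_mem_unipUpper h₂)⟩

/-- The element is [N, B, C; 0, D, 0; 0, E, 1] in the row blocks of sizes m, m, ε. The last three
hypotheses are the isometry relations that do not hold automatically. -/
theorem exists_mem_unipH {N B D : Matrix (Fin m) (Fin m) K} {C : Matrix (Fin m) (Fin ε) K}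
    {E : Matrix (Fin ε) (Fin m) K}
    (hN : ∀ i j, j ≤ i → N i j = (1 : Matrix _ _ K) i j)
    (hD : ∀ i j, i ≤ j → D i j = (1 : Matrix _ _ K) i j)
    (iN : IntMat (intK p F K) N) (iB : IntMat (intK p F K) B) (iD : IntMat (intK p F K) D)
    (iC : IntMat (intK p F K) C) (iE : IntMat (intK p F K) E)
    (hND : Nᴴ * D = 1) (hB : Bᴴ * D + Dᴴ * B + Eᴴ * E = 0) (hC : Cᴴ * D + E = 0) :
    ∃ v ∈ unipH p F K m ε, v.val.submatrix (rowT ε) (rowT ε) = N ∧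
      v.val.submatrix (rowT ε) (rowM ε) = B ∧ v.val.submatrix (rowM ε) (rowM ε) = D ∧
      v.val.submatrix (rowT ε) (rowB m) = C ∧ v.val.submatrix (rowB m) (rowM ε) = E := by
  let M : Matrix (Row m ε) (Row m ε) K :=
    fromBlocks (fromBlocks N B 0 D) (fromRows C 0) (fromCols 0 E) 1
  -- Names for the constant blocks, so that each of the nine block relations can be displayed below.
  let Z : Matrix (Fin m) (Fin m) K := 0
  let Ib : Matrix (Fin ε) (Fin ε) K := 1
  let Zb : Matrix (Fin ε) (Fin m) K := 0
  let Zc : Matrix (Fin m) (Fin ε) K := 0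
  have hM : ∀ i j, orderH m ε j ≤ orderH m ε i → M i j = (1 : Matrix _ _ K) i j := by
    rintro ((i | i) | i) ((j | j) | j) hij <;>
      simp only [orderH, Sum.elim_inl, Sum.elim_inr] at hij
    · have : M (Sum.inl (Sum.inl i)) (Sum.inl (Sum.inl j)) = N i j := rfl
      rw [this, hN i j (by rw [Fin.le_def]; omega)]
      simp [Matrix.one_apply]
    · omega
    · omega
    · rfl
    · have : M (Sum.inl (Sum.inr i)) (Sum.inl (Sum.inr j)) = D i j := rfl
      rw [this, hD i j (by rw [Fin.le_def]; omega)]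
      simp [Matrix.one_apply]
    · rfl
    · rfl
    · omega
    · have : M (Sum.inr i) (Sum.inr j) = (1 : Matrix (Fin ε) (Fin ε) K) i j := rfl
      rw [this]
      simp [Matrix.one_apply]
  obtain ⟨v, hv, hvM⟩ := exists_mem_unipUpper hM
  have hDN : Dᴴ * N = 1 := by
    rw [← conjTranspose_one, ← hND, conjTranspose_mul, conjTranspose_conjTranspose]
  have hC' : Dᴴ * C + Eᴴ = 0 := by
    rw [← conjTranspose_zero, ← hC, conjTranspose_add, conjTranspose_mul,
      conjTranspose_conjTranspose]
  refine ⟨v, mem_unipH.2 ⟨?_, hv, ?_⟩, ?_⟩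
  · change v.valᴴ * formH K m ε * v.val = formH K m ε
    rw [hvM, conjTranspose_mul_formH_mul]
    ext ((i | i) | i) ((j | j) | j)
    · change (Nᴴ * Z + Zᴴ * N + Zbᴴ * Zb) i j = Z i j
      simp [Z, Zb]
    · change (Nᴴ * D + Zᴴ * B + Zbᴴ * E) i j = (1 : Matrix _ _ K) i j
      simp [hND, Z, Zb]
    · change (Nᴴ * Zc + Zᴴ * C + Zbᴴ * Ib) i j = Zc i j
      simp [Z, Zb, Zc, Ib]
    · change (Bᴴ * Z + Dᴴ * N + Eᴴ * Zb) i j = (1 : Matrix _ _ K) i j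
      simp [hDN, Z, Zb]
    · change (Bᴴ * D + Dᴴ * B + Eᴴ * E) i j = Z i j
      rw [hB]
    · change (Bᴴ * Zc + Dᴴ * C + Eᴴ * Ib) i j = Zc i j
      simpa [Zc, Ib] using congrFun₂ hC' i j
    · change (Cᴴ * Z + Zcᴴ * N + Ibᴴ * Zb) i j = Zb i j
      simp [Z, Zb, Zc, Ib]
    · change (Cᴴ * D + Zcᴴ * B + Ibᴴ * E) i j = Zb i j
      simpa [Zb, Zc, Ib] using congrFun₂ hC i j
    · change (Cᴴ * Zc + Zcᴴ * C + Ibᴴ * Ib) i j = (1 : Matrix _ _ K) i j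
      simp [Zc, Ib]
  · rw [hvM]
    exact ((iN.fromBlocks iB .zero iD).fromBlocks (iC.fromRows .zero) (IntMat.zero.fromCols iE) .one)
  · rw [hvM]
    exact ⟨rfl, rfl, rfl, rfl, rfl⟩

theorem exists_levi_mem_unipH (hs : ∀ x ∈ intK p F K, star x ∈ intK p F K) {g : GL (Fin m) K}
    (hg : g ∈ unipGL p F K m) : ∃ v ∈ unipH p F K m ε, ∀ (κ : Type) (X : Matrix (Row m ε) κ K),
      topRows (v.valᵀ * X) = g.valᵀ * topRows X := by
  obtain ⟨h₁, h₂⟩ := mem_unipGL.1 hg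
  obtain ⟨h₃, h₄⟩ := mem_unipGL.1 (inv_mem hg)
  obtain ⟨v, hv, e₁, -⟩ := exists_mem_unipH (p := p) (F := F) (N := g.val) (B := 0)
    (D := (g⁻¹).valᴴ) (C := (0 : Matrix (Fin m) (Fin ε) K)) (E := 0) h₁
    (fun i j hij => by
      rw [conjTranspose_apply, h₃ j i hij, Matrix.one_apply, Matrix.one_apply]
      by_cases h : i = j
      · rw [if_pos h, if_pos h.symm, star_one]
      · rw [if_neg h, if_neg (Ne.symm h), star_zero])
    h₂ .zero (h₄.conjTranspose hs) .zero .zero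
    (by rw [← conjTranspose_mul, ← Units.val_mul, inv_mul_cancel, Units.val_one, conjTranspose_one])
    (by simp) (by simp)
  refine ⟨v, hv, fun κ X => ?_⟩
  obtain ⟨b₁, b₂, -⟩ := blocks_of_mem_unipUpper (mem_unipH.1 hv).2.1
  rw [topRows, submatrix_transpose_mul, e₁, b₁, b₂]
  simp

/-- Used to clear the last row: it allows multiples of the top rows to be added to the bottom row
without changing the top ones. -/
theorem exists_mem_unipH_of_cols (hs : ∀ x ∈ intK p F K, star x ∈ intK p F K)
    {z : K} (hz : z ∈ intK p F K) (hz2 : 2 * z = 1) (hzs : star z = z)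
    {C : Matrix (Fin m) (Fin ε) K} (hC : IntMat (intK p F K) C) :
    ∃ v ∈ unipH p F K m ε, ∀ (κ : Type) (X : Matrix (Row m ε) κ K),
      topRows (v.valᵀ * X) = topRows X ∧ botRows (v.valᵀ * X) = Cᵀ * topRows X + botRows X := by
  -- With N = D = 1 and E = -Cᴴ the remaining relation is Bᴴ + B + CCᴴ = 0, solved by B = -½CCᴴ,
  -- where z stands for ½.
  have hB : IntMat (intK p F K) (-(z • (C * Cᴴ))) := fun i j =>
    neg_mem (mul_mem hz ((hC.mul (hC.conjTranspose hs)) i j))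
  obtain ⟨v, hv, e₁, e₂, e₃, e₄, e₅⟩ := exists_mem_unipH (p := p) (F := F)
    (N := (1 : Matrix (Fin m) (Fin m) K)) (B := -(z • (C * Cᴴ))) (D := 1) (C := C) (E := -Cᴴ)
    (fun _ _ _ => rfl) (fun _ _ _ => rfl) .one hB .one hC (hC.conjTranspose hs).neg
    (by simp) (by
      rw [conjTranspose_neg, conjTranspose_smul, hzs, conjTranspose_mul, conjTranspose_conjTranspose,
        conjTranspose_neg, conjTranspose_conjTranspose, conjTranspose_one, Matrix.mul_one,
        Matrix.one_mul, Matrix.neg_mul, Matrix.mul_neg, neg_neg]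
      ext i j
      simp only [Matrix.add_apply, Matrix.neg_apply, Matrix.smul_apply, smul_eq_mul,
        Matrix.zero_apply]
      linear_combination -(C * Cᴴ) i j * hz2) (by simp)
  refine ⟨v, hv, fun κ X => ?_⟩
  obtain ⟨b₁, b₂, b₃, b₄, -⟩ := blocks_of_mem_unipUpper (mem_unipH.1 hv).2.1
  refine ⟨?_, ?_⟩
  · rw [topRows, submatrix_transpose_mul, e₁, b₁, b₂]
    simp
  · rw [botRows, submatrix_transpose_mul, e₄, b₃, b₄]
    simp [botRows]

/-- These are the Siegel unipotents of H. They serve to change the anti-Hermitian part of the middle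
rows. -/
theorem exists_mem_unipH_of_antihermitian {B : Matrix (Fin m) (Fin m) K}
    (hB : IntMat (intK p F K) B) (hBB : Bᴴ + B = 0) :
    ∃ v ∈ unipH p F K m ε, ∀ (κ : Type) (X : Matrix (Row m ε) κ K),
      topRows (v.valᵀ * X) = topRows X ∧ midRows (v.valᵀ * X) = Bᵀ * topRows X + midRows X ∧
        botRows (v.valᵀ * X) = botRows X := by
  obtain ⟨v, hv, e₁, e₂, e₃, e₄, e₅⟩ := exists_mem_unipH (p := p) (F := F)
    (N := (1 : Matrix (Fin m) (Fin m) K)) (B := B) (D := 1)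
    (C := (0 : Matrix (Fin m) (Fin ε) K)) (E := 0)
    (fun _ _ _ => rfl) (fun _ _ _ => rfl) .one hB .one .zero .zero
    (by simp) (by simpa using hBB) (by simp)
  refine ⟨v, hv, fun κ X => ?_⟩
  obtain ⟨b₁, b₂, b₃, b₄, -⟩ := blocks_of_mem_unipUpper (mem_unipH.1 hv).2.1
  refine ⟨?_, ?_, ?_⟩
  · rw [topRows, submatrix_transpose_mul, e₁, b₁, b₂]
    simp
  · rw [midRows, submatrix_transpose_mul, e₂, e₃, e₅]
    simp [midRows]
  · rw [botRows, submatrix_transpose_mul, e₄, b₃, b₄]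
    simp [botRows]

end UnipH

/-! ### Invariance of the test function -/

section TestFunction

variable {p : ℕ} [Fact p.Prime] {F : Type*} [Field F] [Algebra ℚ_[p] F]
  {K : Type*} [CommRing K] [Algebra F K] {m n ε : ℕ}

variable (p F) in
/-- The support condition in the definition of `φ_χ`. -/
def IsSupported (hmn : m ≤ n) (X : Matrix (Row m ε) (Fin n) K) : Prop :=
  IntMat (intK p F K) X ∧ upperLeft hmn X ∈ bigCell p F m

open Classical in
-- Integrality of X₁ is implied by membership in the big cell, so the support condition can ask for
-- integrality of all of X.
theorem phiChi_eq (hmn : m ≤ n) (χ : Fin m → ((intK p F K)ˣ →* ℂˣ))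
    (X : Matrix (Row m ε) (Fin n) K) :
    phiChi p F hmn χ X = if IsSupported p F hmn X then
      ∏ j : Fin m, extendByZero p F (χ j) (leadingMinor (upperLeft hmn X) j) else 0 := by
  rw [phiChi]
  refine if_congr ⟨?_, ?_⟩ rfl rfl
  · rintro ⟨h₁, h₂, h₃, h₄⟩
    refine ⟨forall_row.2 ⟨fun i j => ?_, h₃, h₄⟩, h₁⟩
    by_cases hj : (j : ℕ) < m
    · exact intMat_of_mem_bigCell h₁ i ⟨j, hj⟩
    · exact h₂ i j (not_lt.1 hj)
  · rintro ⟨h₁, h₂⟩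
    exact ⟨h₂, fun i j _ => h₁ _ j, fun i j => h₁ _ j, fun i j => h₁ _ j⟩

theorem isSupported_of_phiChi_ne_zero {hmn : m ≤ n} {χ : Fin m → ((intK p F K)ˣ →* ℂˣ)}
    {X : Matrix (Row m ε) (Fin n) K} (h : phiChi p F hmn χ X ≠ 0) : IsSupported p F hmn X := by
  classical
  rw [phiChi_eq] at h
  by_contra hX
  exact h (if_neg hX)

theorem phiChi_eq_zero {hmn : m ≤ n} {χ : Fin m → ((intK p F K)ˣ →* ℂˣ)}
    {X : Matrix (Row m ε) (Fin n) K} (h : ¬ IsSupported p F hmn X) : phiChi p F hmn χ X = 0 :=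
  by_contra fun h' => h (isSupported_of_phiChi_ne_zero h')

theorem phiChi_congr {hmn : m ≤ n} (χ : Fin m → ((intK p F K)ˣ →* ℂˣ))
    {X X' : Matrix (Row m ε) (Fin n) K} (h : IsSupported p F hmn X ↔ IsSupported p F hmn X')
    (h' : ∀ j, leadingMinor (upperLeft hmn X) j = leadingMinor (upperLeft hmn X') j) :
    phiChi p F hmn χ X = phiChi p F hmn χ X' := by
  classical
  simp only [phiChi_eq, h, h']

theorem upperLeft_mul (hmn : m ≤ n) (X : Matrix (Row m ε) (Fin n) K) {A : Matrix (Fin n) (Fin n) K}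
    (hA : ∀ i j, j ≤ i → A i j = (1 : Matrix _ _ K) i j) :
    upperLeft hmn (X * A) = upperLeft hmn X * A.submatrix (Fin.castLE hmn) (Fin.castLE hmn) :=
  mul_submatrix_castLE hmn X hA _

omit [CommRing K] in
theorem upperLeft_eq (hmn : m ≤ n) (X : Matrix (Row m ε) (Fin n) K) :
    upperLeft hmn X = (topRows X).submatrix id (Fin.castLE hmn) := rfl

theorem upperLeft_transpose_mul (hmn : m ≤ n) (X : Matrix (Row m ε) (Fin n) K)
    {v : GL (Row m ε) K} (hv : v ∈ unipUpper K (orderH m ε)) :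
    upperLeft hmn (v.valᵀ * X) =
      (v.val.submatrix (rowT ε) (rowT ε))ᵀ * upperLeft hmn X := by
  obtain ⟨b₁, b₂, -⟩ := blocks_of_mem_unipUpper hv
  rw [upperLeft_eq, topRows, submatrix_transpose_mul, b₁, b₂, transpose_zero, transpose_zero,
    Matrix.zero_mul, Matrix.zero_mul, add_zero, add_zero]
  rfl

theorem IsSupported.mul {hmn : m ≤ n} {X : Matrix (Row m ε) (Fin n) K}
    (hX : IsSupported p F hmn X) {A : GL (Fin n) K} (hA : A ∈ unipGL p F K n) :
    IsSupported p F hmn (X * A.val) := by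
  obtain ⟨h₁, h₂⟩ := mem_unipGL.1 hA
  refine ⟨hX.1.mul h₂, ?_⟩
  obtain ⟨g, hg, e⟩ := exists_mem_unipGL p F (unipotent_submatrix_castLE hmn h₁)
    (h₂.submatrix (Fin.castLE hmn) (Fin.castLE hmn))
  rw [upperLeft_mul hmn X h₁, ← e]
  exact mul_mem_bigCell hX.2 hg

/-- X₁ is multiplied on the right by the upper left block of A, which is again unipotent. This
preserves the big cell and all leading minors. -/
theorem phiChi_mul {hmn : m ≤ n} (χ : Fin m → ((intK p F K)ˣ →* ℂˣ))
    (X : Matrix (Row m ε) (Fin n) K) {A : GL (Fin n) K} (hA : A ∈ unipGL p F K n) :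
    phiChi p F hmn χ (X * A.val) = phiChi p F hmn χ X := by
  refine phiChi_congr χ ⟨fun h => ?_, fun h => h.mul hA⟩ fun j => ?_
  · have := h.mul (inv_mem hA)
    rwa [Matrix.mul_assoc, ← Units.val_mul, mul_inv_cancel, Units.val_one, Matrix.mul_one] at this
  · have h₁ := (mem_unipGL.1 hA).1
    rw [upperLeft_mul hmn X h₁, leadingMinor_mul_unipotent _ (unipotent_submatrix_castLE hmn h₁)]

variable [StarRing K]

theorem IsSupported.transpose_mul {hmn : m ≤ n} {X : Matrix (Row m ε) (Fin n) K}
    (hX : IsSupported p F hmn X) {v : GL (Row m ε) K} (hv : v ∈ unipH p F K m ε) :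
    IsSupported p F hmn (v.valᵀ * X) := by
  obtain ⟨-, h₂, h₃⟩ := mem_unipH.1 hv
  refine ⟨h₃.transpose.mul hX.1, ?_⟩
  obtain ⟨g, hg, e⟩ := exists_mem_unipGL p F (blocks_of_mem_unipUpper h₂).2.2.2.2
    (h₃.submatrix (rowT ε) (rowT ε))
  rw [upperLeft_transpose_mul hmn X h₂, ← e]
  exact transpose_mul_mem_bigCell hX.2 hg

/-- The blocks of v below its first m rows vanish in its first m columns, so X₁ is multiplied on the
left by a lower unipotent matrix only. -/
theorem phiChi_transpose_mul {hmn : m ≤ n} (χ : Fin m → ((intK p F K)ˣ →* ℂˣ))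
    (X : Matrix (Row m ε) (Fin n) K) {v : GL (Row m ε) K} (hv : v ∈ unipH p F K m ε) :
    phiChi p F hmn χ (v.valᵀ * X) = phiChi p F hmn χ X := by
  refine phiChi_congr χ ⟨fun h => ?_, fun h => h.transpose_mul hv⟩ fun j => ?_
  · have := h.transpose_mul (inv_mem hv)
    rwa [← Matrix.mul_assoc, ← transpose_mul, ← Units.val_mul, mul_inv_cancel, Units.val_one,
      transpose_one, Matrix.one_mul] at this
  · have h₂ := (mem_unipH.1 hv).2.1
    rw [upperLeft_transpose_mul hmn X h₂,
      leadingMinor_unipotent_mul _ (blocks_of_mem_unipUpper h₂).2.2.2.2]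

end TestFunction

/-! ### Reduction of supported matrices to standard form -/

section Standard

variable {K : Type*} [CommRing K] {m n ε : ℕ}

/-- The `m × n` matrix `[1, 0]`. -/
def inclMat (K : Type*) [CommRing K] (hmn : m ≤ n) : Matrix (Fin m) (Fin n) K :=
  (1 : Matrix (Fin n) (Fin n) K).submatrix (Fin.castLE hmn) id

theorem inclMat_mul (hmn : m ≤ n) {κ : Type*} (V : Matrix (Fin n) κ K) :
    inclMat K hmn * V = V.submatrix (Fin.castLE hmn) id := by
  ext i j
  simp [inclMat, Matrix.mul_apply, Matrix.one_apply]

theorem inclMat_castLE (hmn : m ≤ n) (i j : Fin m) :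
    inclMat K hmn i (Fin.castLE hmn j) = (1 : Matrix _ _ K) i j := by
  simp only [inclMat, submatrix_apply, id, Matrix.one_apply, (Fin.castLE_injective hmn).eq_iff]

theorem inclMat_of_le (hmn : m ≤ n) (i : Fin m) {j : Fin n} (hj : m ≤ j) :
    inclMat K hmn i j = 0 := by
  refine Matrix.one_apply_ne fun h => ?_
  have h' : (i : ℕ) = j := congrArg Fin.val h
  omega

theorem exists_castLE_of_lt (hmn : m ≤ n) {j : Fin n} (hj : (j : ℕ) < m) :
    ∃ i : Fin m, Fin.castLE hmn i = j := ⟨⟨j, hj⟩, rfl⟩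

/-- The matrices whose first `m` rows are `[diag(c), 0]`, and whose last rows are `[0, *]`. -/
def IsStandard (hmn : m ≤ n) (c : Fin m → K) (Z : Matrix (Row m ε) (Fin n) K) : Prop :=
  topRows Z = diagonal c * inclMat K hmn ∧ ∀ k j, botRows Z k (Fin.castLE hmn j) = 0

theorem IsStandard.topRows_castLE {hmn : m ≤ n} {c : Fin m → K} {Z : Matrix (Row m ε) (Fin n) K}
    (h : IsStandard hmn c Z) (i j : Fin m) :
    topRows Z i (Fin.castLE hmn j) = diagonal c i j := by
  rw [h.1, diagonal_mul, inclMat_castLE, ← diagonal_mul, Matrix.mul_one]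

theorem IsStandard.topRows_of_le {hmn : m ≤ n} {c : Fin m → K} {Z : Matrix (Row m ε) (Fin n) K}
    (h : IsStandard hmn c Z) (i : Fin m) {j : Fin n} (hj : m ≤ j) : topRows Z i j = 0 := by
  rw [h.1, diagonal_mul, inclMat_of_le hmn i hj, mul_zero]

theorem IsStandard.upperLeft {hmn : m ≤ n} {c : Fin m → K} {Z : Matrix (Row m ε) (Fin n) K}
    (h : IsStandard hmn c Z) : upperLeft hmn Z = diagonal c := by
  ext i j
  exact h.topRows_castLE i j

end Standard

section Reduction

variable {p : ℕ} [Fact p.Prime] {F : Type*} [Field F] [Algebra ℚ_[p] F]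
  {K : Type*} [CommRing K] [Algebra F K] {m n ε : ℕ}

variable (p F) in
/-- The families of units of `𝒪`. -/
def IntUnits (c : Fin m → Kˣ) : Prop := ∀ i, (c i).val ∈ intK p F K ∧ (c i)⁻¹.val ∈ intK p F K

theorem IsStandard.isSupported {hmn : m ≤ n} {c : Fin m → Kˣ} (hc : IntUnits p F c)
    {Z : Matrix (Row m ε) (Fin n) K} (h : IsStandard hmn (fun i => (c i : K)) Z)
    (hZ : IntMat (intK p F K) Z) : IsSupported p F hmn Z :=
  ⟨hZ, h.upperLeft ▸ diagonal_mem_bigCell (fun i => (hc i).1) fun i => (hc i).2⟩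

theorem exists_topRows_eq {hmn : m ≤ n} {Z : Matrix (Row m ε) (Fin n) K}
    (hZ : IsSupported p F hmn Z) : ∃ L ∈ unipGL p F K m, ∃ V ∈ unipGL p F K n, ∃ c : Fin m → Kˣ,
      IntUnits p F c ∧
        topRows Z = L.valᵀ * diagonal (fun i => (c i : K)) * inclMat K hmn * V.val := by
  obtain ⟨L, hL, U, hU, c, hc, e⟩ := exists_of_mem_bigCell p F hZ.2
  let W : Matrix (Fin m) (Fin n) K :=
    diagonal (fun i => (c i)⁻¹.val) * ((L⁻¹).valᵀ * topRows Z)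
  have hLL : (L⁻¹).valᵀ * L.valᵀ = 1 := by
    rw [← transpose_mul, ← Units.val_mul, mul_inv_cancel, Units.val_one, transpose_one]
  have hLL' : L.valᵀ * (L⁻¹).valᵀ = 1 := by
    rw [← transpose_mul, ← Units.val_mul, inv_mul_cancel, Units.val_one, transpose_one]
  have hcc : diagonal (fun i => (c i)⁻¹.val) * diagonal (fun i => (c i : K)) = 1 := by
    rw [diagonal_mul_diagonal]
    simp
  have hcc' : diagonal (fun i => (c i : K)) * diagonal (fun i => (c i)⁻¹.val) = 1 := by
    rw [diagonal_mul_diagonal]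
    simp
  have hWU : ∀ i j, W i (Fin.castLE hmn j) = U.val i j := by
    intro i j
    have h₁ : W.submatrix id (Fin.castLE hmn) =
        diagonal (fun i => (c i)⁻¹.val) * ((L⁻¹).valᵀ * upperLeft hmn Z) := rfl
    rw [e, Matrix.mul_assoc, ← Matrix.mul_assoc _ L.valᵀ, hLL, Matrix.one_mul, ← Matrix.mul_assoc,
      hcc, Matrix.one_mul] at h₁
    rw [← h₁]
    rfl
  have hW : IntMat (intK p F K) W := (IntMat.diagonal fun i => (hc i).2).mul
    ((mem_unipGL.1 (inv_mem hL)).2.transpose.mul (hZ.1.submatrix _ _))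
  -- Top rows of Z divided by their lower triangular and diagonal parts have the form W = [U, *];
  -- completing W by rows of the identity gives a unipotent matrix.
  let M : Matrix (Fin n) (Fin n) K := fun i j =>
    if h : (i : ℕ) < m then W ⟨i, h⟩ j else (1 : Matrix _ _ K) i j
  obtain ⟨V, hV, hVM⟩ := exists_mem_unipGL p F (M := M) (by
    intro i j hij
    by_cases h : (i : ℕ) < m
    · obtain ⟨i, rfl⟩ := exists_castLE_of_lt hmn h
      obtain ⟨j, rfl⟩ := exists_castLE_of_lt hmn (lt_of_le_of_lt (Fin.le_def.1 hij) h)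
      have : M (Fin.castLE hmn i) (Fin.castLE hmn j) = W i (Fin.castLE hmn j) := dif_pos h
      rw [this, hWU, (mem_unipGL.1 hU).1 i j hij, ← inclMat_castLE hmn]
      rfl
    · exact dif_neg h) (by
    intro i j
    by_cases h : (i : ℕ) < m
    · have : M i j = W ⟨i, h⟩ j := dif_pos h
      rw [this]
      exact hW _ _
    · have : M i j = (1 : Matrix _ _ K) i j := dif_neg h
      rw [this]
      exact IntMat.one i j)
  refine ⟨L, hL, V, hV, c, hc, ?_⟩
  have hVW : inclMat K hmn * V.val = W := by
    rw [inclMat_mul, hVM]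
    ext i j
    exact dif_pos i.2
  rw [Matrix.mul_assoc _ (inclMat K hmn), hVW, Matrix.mul_assoc, ← Matrix.mul_assoc (diagonal _),
    hcc', Matrix.one_mul, ← Matrix.mul_assoc, hLL', Matrix.one_mul]

variable [StarRing K]

/-- The LDU decomposition of X₁ is cleared by a Levi element of U_H on the left and an element of
U_GL on the right. The diagonal units that remain are pivots for clearing the bottom rows in the
first m columns. -/
theorem exists_isStandard (hs : ∀ x ∈ intK p F K, star x ∈ intK p F K)
    {z : K} (hz : z ∈ intK p F K) (hz2 : 2 * z = 1) (hzs : star z = z)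
    {hmn : m ≤ n} {Z : Matrix (Row m ε) (Fin n) K} (hZ : IsSupported p F hmn Z) :
    ∃ v ∈ unipH p F K m ε, ∃ A ∈ unipGL p F K n, ∃ c : Fin m → Kˣ, IntUnits p F c ∧
      IsStandard hmn (fun i => (c i : K)) (v.valᵀ * Z * A.val) := by
  obtain ⟨L, hL, V, hV, c, hc, e⟩ := exists_topRows_eq hZ
  obtain ⟨v₁, hv₁, t₁⟩ := exists_levi_mem_unipH (ε := ε) hs (inv_mem hL)
  set Z₁ := v₁.valᵀ * Z * (V⁻¹).val with hZ₁
  have top₁ : topRows Z₁ = diagonal (fun i => (c i : K)) * inclMat K hmn := by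
    rw [hZ₁, topRows_mul, t₁, e]
    have h₁ : (L⁻¹).valᵀ * L.valᵀ = 1 := by
      rw [← transpose_mul, ← Units.val_mul, mul_inv_cancel, Units.val_one, transpose_one]
    have h₂ : V.val * (V⁻¹).val = 1 := by
      rw [← Units.val_mul, mul_inv_cancel, Units.val_one]
    simp only [Matrix.mul_assoc, h₂, Matrix.mul_one]
    rw [← Matrix.mul_assoc, h₁, Matrix.one_mul]
  have int₁ : IntMat (intK p F K) Z₁ :=
    ((mem_unipH.1 hv₁).2.2.transpose.mul hZ.1).mul (mem_unipGL.1 (inv_mem hV)).2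
  let C : Matrix (Fin m) (Fin ε) K := fun j k =>
    -(botRows Z₁ k (Fin.castLE hmn j) * (c j)⁻¹.val)
  obtain ⟨v₂, hv₂, t₂⟩ := exists_mem_unipH_of_cols hs hz hz2 hzs (C := C)
    fun j k => neg_mem (mul_mem (int₁ _ _) (hc j).2)
  refine ⟨v₁ * v₂, mul_mem hv₁ hv₂, V⁻¹, inv_mem hV, c, hc, ?_⟩
  have hprod : (v₁ * v₂).valᵀ * Z * (V⁻¹).val = v₂.valᵀ * Z₁ := by
    rw [Units.val_mul, transpose_mul, hZ₁]
    simp only [Matrix.mul_assoc]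
  obtain ⟨t₃, t₄⟩ := t₂ _ Z₁
  rw [hprod]
  refine ⟨t₃.trans top₁, fun k j => ?_⟩
  rw [t₄, top₁, ← Matrix.mul_assoc, Matrix.add_apply, inclMat]
  have : (Cᵀ * diagonal (fun i => (c i : K)) * inclMat K hmn) k (Fin.castLE hmn j) =
      (Cᵀ * diagonal fun i => (c i : K)) k j := by
    have h₁ : (inclMat K hmn).submatrix id (Fin.castLE hmn) = 1 := by
      ext i j
      exact inclMat_castLE hmn i j
    have h₂ : (Cᵀ * diagonal (fun i => (c i : K)) * inclMat K hmn).submatrix id (Fin.castLE hmn) =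
      Cᵀ * diagonal (fun i => (c i : K)) * (inclMat K hmn).submatrix id (Fin.castLE hmn) := rfl
    rw [h₁, Matrix.mul_one] at h₂
    exact congrFun₂ h₂ k j
  rw [← inclMat, this, mul_diagonal, transpose_apply]
  change -(botRows Z₁ k (Fin.castLE hmn j) * (c j)⁻¹.val) * (c j : K) + _ = 0
  rw [neg_mul, mul_assoc, Units.inv_mul, mul_one, neg_add_cancel]

omit [StarRing K] in
theorem mem_of_mul_unit_mem {c : Fin m → Kˣ} (hc : IntUnits p F c) {x : K} {i : Fin m}
    (h : x * (c i : K) ∈ intK p F K) : x ∈ intK p F K := by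
  have := mul_mem h (hc i).2
  rwa [mul_assoc, Units.mul_inv, mul_one] at this

/-- A rigidity statement: on its first m columns a standard Z is [diag(c); *; 0] with c a family of
units, so integrality of ᵗvZ can be solved for the entries of v. It confines the integrand of the
H-side to tUt⁻¹. -/
theorem mem_unipH_of_isSupported (hs : ∀ x ∈ intK p F K, star x ∈ intK p F K) {hmn : m ≤ n}
    {c : Fin m → Kˣ} (hc : IntUnits p F c) {Z : Matrix (Row m ε) (Fin n) K}
    (hZ : IntMat (intK p F K) Z) (hstd : IsStandard hmn (fun i => (c i : K)) Z)
    {v : GL (Row m ε) K} (hv : v ∈ groupH K m ε) (hv' : v ∈ unipUpper K (orderH m ε))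
    (h : IsSupported p F hmn (v.valᵀ * Z)) : v ∈ unipH p F K m ε := by
  obtain ⟨b₁, b₂, b₃, b₄, b₅⟩ := blocks_of_mem_unipUpper hv'
  have htop : (topRows Z).submatrix id (Fin.castLE hmn) = diagonal fun i => (c i : K) := by
    ext i j
    exact hstd.topRows_castLE i j
  have hbot : (botRows Z).submatrix id (Fin.castLE hmn) = 0 := by
    ext i j
    exact hstd.2 i j
  have key : ∀ {l : Type} (f : l → Row m ε) (i : l) (j : Fin m),
      ((v.val.submatrix (rowT ε) f)ᵀ * diagonal (fun i => (c i : K)) +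
        (v.val.submatrix (rowM ε) f)ᵀ * (midRows Z).submatrix id (Fin.castLE hmn)) i j ∈
          intK p F K := by
    intro l f i j
    have h₁ : (v.valᵀ * Z).submatrix f (Fin.castLE hmn) =
        (v.val.submatrix (rowT ε) f)ᵀ * (topRows Z).submatrix id (Fin.castLE hmn) +
        (v.val.submatrix (rowM ε) f)ᵀ * (midRows Z).submatrix id (Fin.castLE hmn) +
        (v.val.submatrix (rowB m) f)ᵀ * (botRows Z).submatrix id (Fin.castLE hmn) := by
      have := congrArg (fun M => M.submatrix id (Fin.castLE hmn))
        (submatrix_transpose_mul v.val Z f)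
      exact this
    rw [htop, hbot, Matrix.mul_zero, add_zero] at h₁
    rw [← h₁]
    exact h.1 _ _
  have iN : IntMat (intK p F K) (v.val.submatrix (rowT ε) (rowT ε)) := by
    intro i j
    have := key (rowT ε) j i
    rw [b₁, transpose_zero, Matrix.zero_mul, add_zero, mul_diagonal] at this
    exact mem_of_mul_unit_mem hc this
  have iC : IntMat (intK p F K) (v.val.submatrix (rowT ε) (rowB m)) := by
    intro i j
    have := key (rowB m) j i
    rw [b₃, transpose_zero, Matrix.zero_mul, add_zero, mul_diagonal] at this
    exact mem_of_mul_unit_mem hc this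
  obtain ⟨g, hg, hgN⟩ := exists_mem_unipGL p F b₅ iN
  have hJ₁ : (formH K m ε).submatrix (rowT ε) (rowM ε) = 1 := by
    ext i j
    simp [formH, rowT, rowM]
  have hJ₂ : (formH K m ε).submatrix (rowB m) (rowM ε) = 0 := by
    ext i j
    simp [formH, rowB, rowM]
  have r₁ := blocks_of_mem_groupH hv (rowT ε) (rowM ε)
  rw [b₁, b₂, conjTranspose_zero, conjTranspose_zero, Matrix.zero_mul, Matrix.zero_mul, add_zero,
    add_zero, hJ₁, ← hgN] at r₁
  -- N and C were read off directly. The isometry relations now give D = (Nᴴ)⁻¹ and E = -CᴴD, and B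
  -- is what is left in the second block of rows of ᵗvZ.
  have hD : v.val.submatrix (rowM ε) (rowM ε) = (g⁻¹).valᴴ := by
    have h₁ : (g⁻¹).valᴴ * g.valᴴ = 1 := by
      rw [← conjTranspose_mul, ← Units.val_mul, mul_inv_cancel, Units.val_one, conjTranspose_one]
    rw [← Matrix.mul_one (g⁻¹).valᴴ, ← r₁, ← Matrix.mul_assoc, h₁, Matrix.one_mul]
  have iD : IntMat (intK p F K) (v.val.submatrix (rowM ε) (rowM ε)) := by
    rw [hD]
    exact (mem_unipGL.1 (inv_mem hg)).2.conjTranspose hs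
  have r₂ := blocks_of_mem_groupH hv (rowB m) (rowM ε)
  rw [b₃, b₄, conjTranspose_zero, Matrix.zero_mul, add_zero, conjTranspose_one, Matrix.one_mul,
    hJ₂] at r₂
  have iE : IntMat (intK p F K) (v.val.submatrix (rowB m) (rowM ε)) := by
    rw [← neg_eq_of_add_eq_zero_right r₂]
    exact ((iC.conjTranspose hs).mul iD).neg
  have iB : IntMat (intK p F K) (v.val.submatrix (rowT ε) (rowM ε)) := by
    intro i j
    have h₁ := key (rowM ε) j i
    have h₂ := (iD.transpose.mul (hZ.submatrix (rowM ε) (Fin.castLE hmn))) j i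
    rw [Matrix.add_apply, mul_diagonal] at h₁
    have h₃ := sub_mem h₁ h₂
    have e : (v.val.submatrix (rowM ε) (rowM ε))ᵀ * (midRows Z).submatrix id (Fin.castLE hmn) =
      (v.val.submatrix (rowM ε) (rowM ε))ᵀ * Z.submatrix (rowM ε) (Fin.castLE hmn) := rfl
    rw [e, add_sub_cancel_right] at h₃
    exact mem_of_mul_unit_mem hc h₃
  refine mem_unipH.2 ⟨hv, hv', forall_row.2 ⟨fun i => ?_, fun i => ?_, fun i => ?_⟩⟩
  · exact forall_row.2 ⟨fun j => iN i j, fun j => iB i j, fun j => iC i j⟩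
  · refine forall_row.2 ⟨fun j => ?_, fun j => iD i j, fun j => ?_⟩
    · have : v.val (rowM ε i) (rowT ε j) = 0 := congrFun₂ b₁ i j
      rw [this]
      exact zero_mem _
    · have : v.val (rowM ε i) (rowB m j) = 0 := congrFun₂ b₃ i j
      rw [this]
      exact zero_mem _
  · refine forall_row.2 ⟨fun j => ?_, fun j => iE i j, fun j => ?_⟩
    · have : v.val (rowB m i) (rowT ε j) = 0 := congrFun₂ b₂ i j
      rw [this]
      exact zero_mem _
    · have : v.val (rowB m i) (rowB m j) = (1 : Matrix _ _ K) i j := congrFun₂ b₄ i j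
      rw [this]
      exact IntMat.one i j

omit [StarRing K] in
-- The top rows of ZV are diag(c) times the first m rows of V. The support condition says nothing
-- usable about the other rows of V, whence the separate integrality hypothesis.
theorem mem_unipGL_of_isSupported {hmn : m ≤ n} {c : Fin m → Kˣ} (hc : IntUnits p F c)
    {Z : Matrix (Row m ε) (Fin n) K} (hstd : IsStandard hmn (fun i => (c i : K)) Z)
    {V : GL (Fin n) K} (hV : ∀ i j, j ≤ i → V.val i j = (1 : Matrix _ _ K) i j)
    (hV' : ∀ i j : Fin n, m ≤ (i : ℕ) → V.val i j ∈ intK p F K)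
    (h : IsSupported p F hmn (Z * V.val)) : V ∈ unipGL p F K n := by
  refine mem_unipGL.2 ⟨hV, fun i j => ?_⟩
  by_cases hi : (i : ℕ) < m
  · obtain ⟨i, rfl⟩ := exists_castLE_of_lt hmn hi
    have h₁ : topRows (Z * V.val) i j ∈ intK p F K := h.1 _ _
    rw [topRows_mul, hstd.1, Matrix.mul_assoc, diagonal_mul, inclMat_mul, mul_comm] at h₁
    exact mem_of_mul_unit_mem hc h₁
  · exact hV' i j (not_lt.1 hi)

end Reduction

/-! ### Torus elements, Gram matrices and normal forms -/

section Torus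

variable {K : Type*} [CommRing K] {m n ε : ℕ} (a : Fin m → Kˣ) (u d : Kˣ)

theorem breveEntries_castLE (hmn : m ≤ n) (i : Fin m) :
    breveEntries n a d (Fin.castLE hmn i) = a i := by
  simp [breveEntries]

theorem breveEntries_of_le {j : Fin n} (hj : m ≤ j) : breveEntries n a d j = d :=
  dif_neg (not_lt.2 hj)

theorem mul_breveA_apply {κ : Type*} (X : Matrix κ (Fin n) K) (i : κ) (j : Fin n) :
    (X * (breveA n a d).val) i j = X i j * (breveEntries n a d j : K) :=
  mul_diagonal _ _ _ _

theorem diagonal_mul_inclMat_castLE (hmn : m ≤ n) (c : Fin m → K) (i j : Fin m) :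
    (diagonal c * inclMat K hmn) i (Fin.castLE hmn j) = diagonal c i j := by
  rw [diagonal_mul, inclMat_castLE, ← diagonal_mul, Matrix.mul_one]

variable [StarRing K]

theorem topRows_torusH_mul {κ : Type*} (X : Matrix (Row m ε) κ K) (i j) :
    topRows ((torusH ε a u).valᵀ * X) i j = a i * topRows X i j := by
  simp [topRows, torusH, diagGL, rowT]

theorem midRows_torusH_mul {κ : Type*} (X : Matrix (Row m ε) κ K) (i j) :
    midRows ((torusH ε a u).valᵀ * X) i j = (star (a i))⁻¹.val * midRows X i j := by
  simp [midRows, torusH, diagGL, rowM]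

theorem botRows_torusH_mul {κ : Type*} (X : Matrix (Row m ε) κ K) (i j) :
    botRows ((torusH ε a u).valᵀ * X) i j = u * botRows X i j := by
  simp [botRows, torusH, diagGL, rowB]

end Torus

section NormalForm

variable {p : ℕ} [Fact p.Prime] {F : Type*} [Field F] [Algebra ℚ_[p] F]
  {K : Type*} [CommRing K] [Algebra F K] [StarRing K] {m n ε : ℕ}

/-- The matrix `ᵗX̄ J X`. -/
def gram (X : Matrix (Row m ε) (Fin n) K) : Matrix (Fin n) (Fin n) K := Xᴴ * formH K m ε * X

theorem gram_apply (X : Matrix (Row m ε) (Fin n) K) (j k : Fin n) :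
    gram X j k = ∑ i, star (topRows X i j) * midRows X i k +
      ∑ i, star (midRows X i j) * topRows X i k + ∑ i, star (botRows X i j) * botRows X i k := by
  rw [gram, conjTranspose_mul_formH_mul]
  simp only [Matrix.add_apply, Matrix.mul_apply, conjTranspose_apply]

theorem conjTranspose_gram (X : Matrix (Row m ε) (Fin n) K) : (gram X)ᴴ = gram X := by
  have h : (formH K m ε)ᴴ = formH K m ε := by
    simp [formH, fromBlocks_conjTranspose]
  rw [gram, conjTranspose_mul, conjTranspose_mul, conjTranspose_conjTranspose, h, Matrix.mul_assoc]

theorem gram_mul (X : Matrix (Row m ε) (Fin n) K) (A : Matrix (Fin n) (Fin n) K) :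
    gram (X * A) = Aᴴ * gram X * A := by
  simp only [gram, conjTranspose_mul, Matrix.mul_assoc]

/-- The Gram matrix of ᵗvX involves v̄ J ᵗv rather than ᵗv̄ J v. As J² = 1, isometries also satisfy
v J ᵗv̄ = J, whose transpose is the relation needed. -/
theorem gram_transpose_mul {v : GL (Row m ε) K} (hv : v ∈ groupH K m ε)
    (X : Matrix (Row m ε) (Fin n) K) : gram (v.valᵀ * X) = gram X := by
  have hJ : formH K m ε * formH K m ε = 1 := by
    simp [formH, fromBlocks_multiply]
  have hJt : (formH K m ε)ᵀ = formH K m ε := by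
    simp [formH, fromBlocks_transpose]
  have h : v.valᴴ * formH K m ε * v.val = formH K m ε := hv
  have h₁ : (formH K m ε * v.valᴴ * formH K m ε) * v.val = 1 := by
    rw [Matrix.mul_assoc, Matrix.mul_assoc, ← Matrix.mul_assoc v.valᴴ, h, hJ]
  have h₂ : v.val * (formH K m ε * v.valᴴ * formH K m ε) = 1 := mul_eq_one_comm.1 h₁
  have h₃ : v.val * formH K m ε * v.valᴴ = formH K m ε := by
    have := congrArg (fun M => M * formH K m ε) h₂
    simp only [Matrix.mul_assoc, hJ, Matrix.mul_one, Matrix.one_mul] at this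
    rw [Matrix.mul_assoc, this]
  have h₄ := congrArg Matrix.transpose h₃
  rw [transpose_mul, transpose_mul, hJt] at h₄
  have h₅ : (v.valᵀ)ᴴ = (v.valᴴ)ᵀ := rfl
  rw [gram, conjTranspose_mul, h₅, gram]
  calc Xᴴ * (v.valᴴ)ᵀ * formH K m ε * (v.valᵀ * X)
      = Xᴴ * ((v.valᴴ)ᵀ * (formH K m ε * v.valᵀ)) * X := by simp only [Matrix.mul_assoc]
    _ = _ := by rw [h₄]

variable (p F) in
/-- The representatives `X`, modulo `U_{H, 𝒪}` on the left and `U_{GL, 𝒪}` on the right, of the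
matrices at which the two sides of the equivariance do not vanish. -/
structure IsNormal (hmn : m ≤ n) (a : Fin m → Kˣ) (u : Kˣ) (c : Fin m → Kˣ)
    (X : Matrix (Row m ε) (Fin n) K) : Prop where
  units : IntUnits p F c
  top : ∀ i j, (a i : K) * topRows X i j = (diagonal (fun i => (c i : K)) * inclMat K hmn) i j
  bot : ∀ k j, botRows X k (Fin.castLE hmn j) = 0
  mid_mem : ∀ i j, (star (a i))⁻¹.val * midRows X i j ∈ intK p F K
  bot_mem : ∀ k j, (u : K) * botRows X k j ∈ intK p F K

theorem isNormal_of_isStandard {hmn : m ≤ n} {a : Fin m → Kˣ} {u : Kˣ} {c : Fin m → Kˣ}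
    {X : Matrix (Row m ε) (Fin n) K} (hc : IntUnits p F c)
    (hstd : IsStandard hmn (fun i => (c i : K)) ((torusH ε a u).valᵀ * X))
    (hint : IntMat (intK p F K) ((torusH ε a u).valᵀ * X)) : IsNormal p F hmn a u c X where
  units := hc
  top i j := by rw [← topRows_torusH_mul, hstd.1]
  bot k j := by
    have := hstd.2 k j
    rwa [botRows_torusH_mul, Units.mul_right_eq_zero] at this
  mid_mem i j := by
    rw [← midRows_torusH_mul (ε := ε) a u]
    exact hint _ _
  bot_mem k j := by
    rw [← botRows_torusH_mul (ε := ε) a u]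
    exact hint _ _

namespace IsNormal

variable {hmn : m ≤ n} {a : Fin m → Kˣ} {u d : Kˣ} {c : Fin m → Kˣ}
  {X : Matrix (Row m ε) (Fin n) K} (h : IsNormal p F hmn a u c X)

include h

theorem topRows_of_le (i : Fin m) {j : Fin n} (hj : m ≤ j) : topRows X i j = 0 := by
  have := h.top i j
  rwa [diagonal_mul, inclMat_of_le hmn i hj, mul_zero, Units.mul_right_eq_zero] at this

theorem topRows_castLE (i j : Fin m) :
    topRows X i (Fin.castLE hmn j) = (a i)⁻¹.val * diagonal (fun i => (c i : K)) i j := by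
  rw [← Units.inv_mul_cancel_left (a i) (topRows X i (Fin.castLE hmn j)), h.top,
    diagonal_mul_inclMat_castLE]

theorem isStandard_torusH_mul :
    IsStandard hmn (fun i => (c i : K)) ((torusH ε a u).valᵀ * X) := by
  refine ⟨?_, fun k j => ?_⟩
  · ext i j
    rw [topRows_torusH_mul, h.top]
  · rw [botRows_torusH_mul, h.bot, mul_zero]

theorem intMat_torusH_mul : IntMat (intK p F K) ((torusH ε a u).valᵀ * X) := by
  refine forall_row.2 ⟨fun i j => ?_, fun i j => ?_, fun i j => ?_⟩
  · change topRows ((torusH ε a u).valᵀ * X) i j ∈ intK p F K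
    rw [h.isStandard_torusH_mul.1]
    exact (IntMat.diagonal fun i => (h.units i).1).mul (IntMat.one.submatrix _ _) i j
  · change midRows ((torusH ε a u).valᵀ * X) i j ∈ intK p F K
    rw [midRows_torusH_mul]
    exact h.mid_mem i j
  · change botRows ((torusH ε a u).valᵀ * X) i j ∈ intK p F K
    rw [botRows_torusH_mul]
    exact h.bot_mem i j

theorem isStandard_mul_breveA :
    IsStandard hmn (fun i => (c i : K)) (X * (breveA n a d).val) := by
  refine ⟨?_, fun k j => ?_⟩
  · ext i j
    rw [topRows_mul, mul_breveA_apply]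
    by_cases hj : (j : ℕ) < m
    · obtain ⟨j, rfl⟩ := exists_castLE_of_lt hmn hj
      rw [h.topRows_castLE, breveEntries_castLE, diagonal_mul_inclMat_castLE]
      by_cases hij : i = j
      · subst hij
        rw [mul_comm, Units.mul_inv_cancel_left]
      · rw [diagonal_apply_ne _ hij, mul_zero, zero_mul]
    · rw [h.topRows_of_le i (not_lt.1 hj), zero_mul, diagonal_mul,
        inclMat_of_le hmn i (not_lt.1 hj), mul_zero]
  · rw [botRows_mul, mul_breveA_apply, h.bot, zero_mul]

/-- Passing from ᵗtX to X A(t̆) multiplies the middle entries by ā_i t̆_j and the bottom entries in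
the columns beyond m by du⁻¹; both factors are integral. -/
theorem intMat_mul_breveA
    (hab : ∀ i j, star (a i : K) * (breveEntries n a d j : K) ∈ intK p F K)
    (hdu : Fin ε → m < n → (d : K) * (u⁻¹ : Kˣ) ∈ intK p F K) :
    IntMat (intK p F K) (X * (breveA n a d).val) := by
  refine forall_row.2 ⟨fun i j => ?_, fun i j => ?_, fun k j => ?_⟩
  · change topRows (X * (breveA n a d).val) i j ∈ intK p F K
    rw [(h.isStandard_mul_breveA (d := d)).1]
    exact (IntMat.diagonal fun i => (h.units i).1).mul (IntMat.one.submatrix _ _) i j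
  · have e : (X * (breveA n a d).val) (rowM ε i) j =
        ((star (a i))⁻¹.val * midRows X i j) * (star (a i : K) * (breveEntries n a d j : K)) := by
      rw [mul_breveA_apply, ← Units.coe_star, midRows_apply]
      have := (star (a i)).inv_mul
      linear_combination (- X (rowM ε i) j * (breveEntries n a d j : K)) * this
    rw [e]
    exact mul_mem (h.mid_mem i j) (hab i j)
  · rw [mul_breveA_apply]
    by_cases hj : (j : ℕ) < m
    · obtain ⟨j, rfl⟩ := exists_castLE_of_lt hmn hj
      have e : X (rowB m k) (Fin.castLE hmn j) = 0 := h.bot k j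
      rw [e, zero_mul]
      exact zero_mem _
    · have e : X (rowB m k) j * (breveEntries n a d j : K) =
          ((u : K) * botRows X k j) * ((d : K) * (u⁻¹ : Kˣ)) := by
        rw [breveEntries_of_le a d (not_lt.1 hj), botRows_apply]
        have := u.mul_inv
        linear_combination (- X (rowB m k) j * (d : K)) * this
      rw [e]
      exact mul_mem (h.bot_mem k j) (hdu k (lt_of_le_of_lt (not_lt.1 hj) j.2))

/-- Since t is an isometry, the Gram matrix of X is that of the integral matrix ᵗtX: the factors a_i
and u cancel in each product. -/
theorem intMat_gram (hs : ∀ x ∈ intK p F K, star x ∈ intK p F K)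
    (hu : Fin ε → star (u : K) * u = 1) : IntMat (intK p F K) (gram X) := by
  have key : ∀ i j k, star (topRows X i j) * midRows X i k ∈ intK p F K := by
    intro i j k
    have e : star (topRows X i j) * midRows X i k =
        star ((a i : K) * topRows X i j) * ((star (a i))⁻¹.val * midRows X i k) := by
      rw [star_mul', ← Units.coe_star]
      have := (star (a i)).mul_inv
      linear_combination (- star (topRows X i j) * midRows X i k) * this
    rw [e, h.top]
    exact mul_mem (hs _ ((IntMat.diagonal fun i => (h.units i).1).mul
      (IntMat.one.submatrix _ _) i j)) (h.mid_mem i k)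
  intro j k
  rw [gram_apply]
  refine add_mem (add_mem (sum_mem fun i _ => key i j k) (sum_mem fun i _ => ?_))
    (sum_mem fun i _ => ?_)
  · have := hs _ (key i k j)
    rwa [star_mul', star_star, mul_comm] at this
  · have e : star (botRows X i j) * botRows X i k =
        star ((u : K) * botRows X i j) * ((u : K) * botRows X i k) := by
      rw [star_mul']
      linear_combination (- star (botRows X i j) * botRows X i k) * hu i
    rw [e]
    exact mul_mem (hs _ (h.bot_mem i j)) (h.bot_mem i k)

/-- Both arguments are integral and have the upper left block diag(c). -/
theorem phiChi_torusH_mul (χ : Fin m → ((intK p F K)ˣ →* ℂˣ))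
    (hab : ∀ i j, star (a i : K) * (breveEntries n a d j : K) ∈ intK p F K)
    (hdu : Fin ε → m < n → (d : K) * (u⁻¹ : Kˣ) ∈ intK p F K) :
    phiChi p F hmn χ ((torusH ε a u).valᵀ * X) = phiChi p F hmn χ (X * (breveA n a d).val) := by
  have h₁ := h.isStandard_torusH_mul
  have h₂ := h.isStandard_mul_breveA (d := d)
  refine phiChi_congr χ ⟨fun _ => ?_, fun _ => ?_⟩ fun j => ?_
  · exact h₂.isSupported h.units (h.intMat_mul_breveA hab hdu)
  · exact h₁.isSupported h.units h.intMat_torusH_mul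
  · rw [h₁.upperLeft, h₂.upperLeft]

end IsNormal

/-- A row operation on ᵗtX by v is one on X by tvt⁻¹, which stays in U_H because t contracts this
group. -/
theorem exists_isNormal_of_isSupported_torusH_mul (hs : ∀ x ∈ intK p F K, star x ∈ intK p F K)
    {z : K} (hz : z ∈ intK p F K) (hz2 : 2 * z = 1) (hzs : star z = z) {hmn : m ≤ n}
    {a : Fin m → Kˣ} {u : Kˣ}
    (ht : ∀ w ∈ unipH p F K m ε, torusH ε a u * w * (torusH ε a u)⁻¹ ∈ unipH p F K m ε)
    {X : Matrix (Row m ε) (Fin n) K} (hX : IsSupported p F hmn ((torusH ε a u).valᵀ * X)) :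
    ∃ v ∈ unipH p F K m ε, ∃ A ∈ unipGL p F K n, ∃ c, IsNormal p F hmn a u c
      (v.valᵀ * X * A.val) := by
  obtain ⟨v, hv, A, hA, c, hc, hstd⟩ := exists_isStandard hs hz hz2 hzs hX
  have hint : IntMat (intK p F K) (v.valᵀ * ((torusH ε a u).valᵀ * X) * A.val) :=
    ((mem_unipH.1 hv).2.2.transpose.mul hX.1).mul (mem_unipGL.1 hA).2
  have e : v.valᵀ * ((torusH ε a u).valᵀ * X) * A.val = (torusH ε a u).valᵀ *
      ((torusH ε a u * v * (torusH ε a u)⁻¹).valᵀ * X * A.val) := by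
    have h₁ : v.valᵀ * (torusH ε a u).valᵀ =
        (torusH ε a u).valᵀ * (torusH ε a u * v * (torusH ε a u)⁻¹).valᵀ := by
      rw [← transpose_mul, ← transpose_mul, ← Units.val_mul, ← Units.val_mul,
        inv_mul_cancel_right]
    rw [← Matrix.mul_assoc, h₁]
    simp only [Matrix.mul_assoc]
  rw [e] at hstd hint
  exact ⟨_, ht v hv, A, hA, c, isNormal_of_isStandard hc hstd hint⟩

/-- Support of φ at X A(t̆) bounds the middle rows only after multiplication by A(t̆), which is
weaker than the bound `mid_mem` of the normal form. The missing information is in the Gram matrix,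
once the anti-Hermitian part, invisible to it, has been removed. The hypothesis `hbot` does the same
for the bottom row. -/
theorem exists_isNormal_of_isSupported_mul_breveA (hs : ∀ x ∈ intK p F K, star x ∈ intK p F K)
    {z : K} (hz : z ∈ intK p F K) (hz2 : 2 * z = 1) (hzs : star z = z) {hmn : m ≤ n}
    {a : Fin m → Kˣ} {u d : Kˣ}
    (ht : ∀ A ∈ unipGL p F K n, breveA n a d * A * (breveA n a d)⁻¹ ∈ unipGL p F K n)
    (hbot : m < n → ∀ r : Fin ε → K, ∑ k, star (r k) * r k ∈ intK p F K →
      (∀ k, r k * (d : K) ∈ intK p F K) → ∀ k, (u : K) * r k ∈ intK p F K)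
    {X : Matrix (Row m ε) (Fin n) K} (hY : IntMat (intK p F K) (gram X))
    (hX : IsSupported p F hmn (X * (breveA n a d).val)) :
    ∃ v ∈ unipH p F K m ε, ∃ A ∈ unipGL p F K n, ∃ c, IsNormal p F hmn a u c
      (v.valᵀ * X * A.val) := by
  obtain ⟨v, hv, A, hA, c, hc, hstd⟩ := exists_isStandard hs hz hz2 hzs hX
  set X₂ := v.valᵀ * X * (breveA n a d * A * (breveA n a d)⁻¹).val with hX₂
  have e : v.valᵀ * (X * (breveA n a d).val) * A.val = X₂ * (breveA n a d).val := by
    have h₁ : (breveA n a d).val * A.val =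
        (breveA n a d * A * (breveA n a d)⁻¹).val * (breveA n a d).val := by
      rw [← Units.val_mul, ← Units.val_mul, inv_mul_cancel_right]
    rw [hX₂, Matrix.mul_assoc, Matrix.mul_assoc, h₁]
    simp only [Matrix.mul_assoc]
  have hint : IntMat (intK p F K) (X₂ * (breveA n a d).val) := by
    rw [← e]
    exact ((mem_unipH.1 hv).2.2.transpose.mul hX.1).mul (mem_unipGL.1 hA).2
  rw [e] at hstd
  have hY₂ : IntMat (intK p F K) (gram X₂) := by
    have hA' := (mem_unipGL.1 (ht A hA)).2
    rw [hX₂, gram_mul, gram_transpose_mul (mem_unipH.1 hv).1]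
    exact ((hA'.conjTranspose hs).mul hY).mul hA'
  clear_value X₂
  -- remove the anti-Hermitian part of the second block of rows
  let G : Matrix (Fin m) (Fin m) K := fun i j =>
    midRows (X₂ * (breveA n a d).val) i (Fin.castLE hmn j) * (c j)⁻¹.val
  have iG : IntMat (intK p F K) G := fun i j => mul_mem (hint _ _) (hc j).2
  have iB : IntMat (intK p F K) (z • (Gᴴ - G)ᵀ) := fun i j =>
    mul_mem hz (((iG.conjTranspose hs).sub iG).transpose i j)
  obtain ⟨v₂, hv₂, t₂⟩ := exists_mem_unipH_of_antihermitian (p := p) (F := F) (ε := ε) iB (by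
    ext i j
    simp only [Matrix.add_apply, conjTranspose_apply, Matrix.smul_apply, transpose_apply,
      Matrix.sub_apply, smul_eq_mul, star_mul', star_sub, star_star, hzs, Matrix.zero_apply]
    ring)
  obtain ⟨s₁, s₂, s₃⟩ := t₂ _ X₂
  set X₃ := v₂.valᵀ * X₂ with hX₃
  have hY₃ : IntMat (intK p F K) (gram X₃) := by
    rw [hX₃, gram_transpose_mul (mem_unipH.1 hv₂).1]
    exact hY₂
  clear_value X₃
  have htop : ∀ i j, (a i : K) * topRows X₃ i j =
      (diagonal (fun i => (c i : K)) * inclMat K hmn) i j := by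
    intro i j
    rw [s₁, ← hstd.1, topRows_mul, mul_breveA_apply]
    by_cases hj : (j : ℕ) < m
    · obtain ⟨j, rfl⟩ := exists_castLE_of_lt hmn hj
      rw [breveEntries_castLE, mul_comm]
      by_cases hij : i = j
      · rw [hij]
      · have h₁ := hstd.topRows_castLE i j
        rw [diagonal_apply_ne _ hij, topRows_mul, mul_breveA_apply, Units.mul_left_eq_zero] at h₁
        rw [h₁, zero_mul, zero_mul]
    · have h₁ := hstd.topRows_of_le i (not_lt.1 hj)
      rw [topRows_mul, mul_breveA_apply, Units.mul_left_eq_zero] at h₁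
      rw [h₁, zero_mul, mul_zero]
  have hbot₃ : ∀ k j, botRows X₃ k (Fin.castLE hmn j) = 0 := by
    intro k j
    have h₁ := hstd.2 k j
    rwa [botRows_mul, mul_breveA_apply, Units.mul_left_eq_zero, ← s₃] at h₁
  have top_castLE : ∀ i j, topRows X₃ i (Fin.castLE hmn j) =
      (a i)⁻¹.val * diagonal (fun i => (c i : K)) i j := fun i j => by
    rw [← Units.inv_mul_cancel_left (a i) (topRows X₃ i (Fin.castLE hmn j)), htop,
      diagonal_mul_inclMat_castLE]
  have top_of_le : ∀ i {j : Fin n}, m ≤ (j : ℕ) → topRows X₃ i j = 0 := fun i j hj => by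
    have := htop i j
    rwa [diagonal_mul, inclMat_of_le hmn i hj, mul_zero, Units.mul_right_eq_zero] at this
  -- The middle rows of X₂ are G c a⁻¹ in the first m columns; adding ½(Gᴴ - G) times the top rows c
  -- a⁻¹ leaves the Hermitian half ½(G + Gᴴ) c a⁻¹.
  have hmid : ∀ i j, midRows X₃ i (Fin.castLE hmn j) =
      z * (Gᴴ i j + G i j) * (c j : K) * (a j)⁻¹.val := by
    intro i j
    have h₁ : midRows X₂ i (Fin.castLE hmn j) = G i j * (c j : K) * (a j)⁻¹.val := by
      change _ = midRows (X₂ * (breveA n a d).val) i (Fin.castLE hmn j) * (c j)⁻¹.val *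
        (c j : K) * (a j)⁻¹.val
      rw [midRows_mul, mul_breveA_apply, breveEntries_castLE, Units.inv_mul_cancel_right,
        Units.mul_inv_cancel_right]
    have h₂ : topRows X₂ = topRows X₃ := s₁.symm
    rw [s₂, Matrix.add_apply, Matrix.mul_apply, h₁, Finset.sum_eq_single j]
    · rw [h₂, top_castLE, diagonal_apply_eq]
      simp only [transpose_apply, Matrix.smul_apply, Matrix.sub_apply, smul_eq_mul]
      linear_combination (- G i j * (c j : K) * (a j)⁻¹.val) * hz2
    · intro k _ hk
      rw [h₂, top_castLE, diagonal_apply_ne _ hk, mul_zero, mul_zero]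
    · intro hj
      exact absurd (Finset.mem_univ j) hj
  have hfirst : ∀ j k, ∑ i, star (topRows X₃ i (Fin.castLE hmn j)) * midRows X₃ i k =
      star (c j : K) * ((star (a j))⁻¹.val * midRows X₃ j k) := by
    intro j k
    rw [Finset.sum_eq_single j]
    · rw [top_castLE, diagonal_apply_eq, star_mul', ← Units.coe_star, ← star_inv]
      ring
    · intro i _ hi
      rw [top_castLE, diagonal_apply_ne _ hi, mul_zero, star_zero, zero_mul]
    · intro hj
      exact absurd (Finset.mem_univ j) hj
  have hcancel : ∀ j x, star (c j : K) * x ∈ intK p F K → x ∈ intK p F K := by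
    intro j x hx
    have h₁ := mul_mem (hs _ (hc j).2) hx
    rwa [← mul_assoc, ← star_mul', Units.inv_mul, star_one, one_mul] at h₁
  refine ⟨v * v₂, mul_mem hv hv₂, _, ht A hA, c, ?_⟩
  have hprod : (v * v₂).valᵀ * X * (breveA n a d * A * (breveA n a d)⁻¹).val = X₃ := by
    rw [Units.val_mul, transpose_mul, hX₃, hX₂]
    simp only [Matrix.mul_assoc]
  rw [hprod]
  refine ⟨hc, htop, hbot₃, fun j k => hcancel j _ ?_, fun k j => ?_⟩
  · have h₁ := hY₃ (Fin.castLE hmn j) k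
    rw [gram_apply, hfirst] at h₁
    have h₃ : ∑ i, star (botRows X₃ i (Fin.castLE hmn j)) * botRows X₃ i k = 0 :=
      Finset.sum_eq_zero fun i _ => by rw [hbot₃, star_zero, zero_mul]
    rw [h₃, add_zero] at h₁
    by_cases hk : (k : ℕ) < m
    · obtain ⟨k, rfl⟩ := exists_castLE_of_lt hmn hk
      -- Because ½(G + Gᴴ) is Hermitian, the two cross terms of the Gram entry coincide. The entry
      -- is twice the quantity to be bounded, up to a unit.
      have h₂ : ∑ i, star (midRows X₃ i (Fin.castLE hmn j)) * topRows X₃ i (Fin.castLE hmn k) =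
          star (c j : K) * ((star (a j))⁻¹.val * midRows X₃ j (Fin.castLE hmn k)) := by
        rw [Finset.sum_eq_single k]
        · rw [top_castLE, diagonal_apply_eq, hmid, hmid]
          simp only [star_mul', star_add, conjTranspose_apply, star_star, hzs]
          rw [← Units.coe_star, ← Units.coe_star, star_inv]
          ring
        · intro i _ hi
          rw [top_castLE, diagonal_apply_ne _ hi, mul_zero, mul_zero]
        · intro hj
          exact absurd (Finset.mem_univ k) hj
      rw [h₂] at h₁
      have h₄ := mul_mem hz h₁
      rwa [← two_mul, ← mul_assoc, mul_comm z 2, hz2, one_mul] at h₄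
    · have h₂ : ∑ i, star (midRows X₃ i (Fin.castLE hmn j)) * topRows X₃ i k = 0 :=
        Finset.sum_eq_zero fun i _ => by rw [top_of_le i (not_lt.1 hk), mul_zero]
      rwa [h₂, add_zero] at h₁
  · by_cases hj : (j : ℕ) < m
    · obtain ⟨j, rfl⟩ := exists_castLE_of_lt hmn hj
      rw [hbot₃, mul_zero]
      exact zero_mem _
    · have hj' := not_lt.1 hj
      refine hbot (lt_of_le_of_lt hj' j.2) (fun k => botRows X₃ k j) ?_ (fun k => ?_) k
      -- In a column beyond m the top rows vanish, and the diagonal Gram entry is the norm of the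
      -- bottom entries alone.
      · have h₁ := hY₃ j j
        rw [gram_apply, Finset.sum_eq_zero fun i _ => by rw [top_of_le i hj', star_zero, zero_mul],
          Finset.sum_eq_zero fun i _ => by rw [top_of_le i hj', mul_zero], zero_add, zero_add] at h₁
        exact h₁
      · have h₁ : botRows (X₂ * (breveA n a d).val) k j ∈ intK p F K := hint _ _
        rwa [botRows_mul, mul_breveA_apply, breveEntries_of_le a d hj', ← s₃] at h₁

end NormalForm

/-! ### The unipotent group of `G` -/

section UnipG

variable {p : ℕ} [Fact p.Prime] {F : Type*} [Field F] [Algebra ℚ_[p] F]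
  {K : Type*} [CommRing K] [Algebra F K] [StarRing K] {m n ε : ℕ}

theorem mem_unipG {w : GL (Fin n ⊕ Fin n) K} : w ∈ unipG p F K n ↔
    w ∈ groupG K n ∧ w ∈ unipUpper K (orderG n) ∧ IntMat (intK p F K) w.val := by
  constructor
  · rintro ⟨⟨h₁, h₂⟩, h₃⟩
    exact ⟨h₁, h₂, intMat_of_mem_intGL h₃⟩
  · rintro ⟨h₁, h₂, h₃⟩
    exact ⟨⟨h₁, h₂⟩, mem_intGL_of_det_eq_one h₃ (det_of_mem_unipUpper h₂)⟩

omit [StarRing K] in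
theorem toBlocks₂₁_of_mem_unipUpper {w : GL (Fin n ⊕ Fin n) K}
    (hw : w ∈ unipUpper K (orderG n)) : w.val.toBlocks₂₁ = 0 := by
  ext i j
  have h := hw (Sum.inr i) (Sum.inl j) (by simp only [orderG, Sum.elim_inl, Sum.elim_inr]; omega)
  exact h

omit [StarRing K] in
theorem toBlocks₁₁_of_mem_unipUpper {w : GL (Fin n ⊕ Fin n) K}
    (hw : w ∈ unipUpper K (orderG n)) (i j : Fin n) (hij : j ≤ i) :
    w.val.toBlocks₁₁ i j = (1 : Matrix _ _ K) i j := by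
  have h := hw (Sum.inl i) (Sum.inl j) (by
    simp only [orderG, Sum.elim_inl]; have := Fin.le_def.1 hij; omega)
  rw [toBlocks₁₁, of_apply, h]
  simp [Matrix.one_apply]

omit [StarRing K] in
theorem eq_fromBlocks_of_mem_unipUpper {w : GL (Fin n ⊕ Fin n) K}
    (hw : w ∈ unipUpper K (orderG n)) :
    w.val = fromBlocks w.val.toBlocks₁₁ w.val.toBlocks₁₂ 0 w.val.toBlocks₂₂ := by
  rw [← toBlocks₂₁_of_mem_unipUpper hw, fromBlocks_toBlocks]

theorem blocks_of_mem_groupG {w : GL (Fin n ⊕ Fin n) K} (hw : w ∈ groupG K n)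
    (hw' : w ∈ unipUpper K (orderG n)) :
    w.val.toBlocks₁₁ᴴ * w.val.toBlocks₂₂ = 1 ∧
      w.val.toBlocks₁₂ᴴ * w.val.toBlocks₂₂ = w.val.toBlocks₂₂ᴴ * w.val.toBlocks₁₂ := by
  have h : w.valᴴ * formG K n * w.val = formG K n := hw
  rw [eq_fromBlocks_of_mem_unipUpper hw', formG, fromBlocks_conjTranspose, fromBlocks_multiply,
    fromBlocks_multiply, fromBlocks_inj] at h
  obtain ⟨-, h₁, -, h₂⟩ := h
  refine ⟨by simpa using h₁, ?_⟩
  have h₃ : -(w.val.toBlocks₂₂ᴴ * w.val.toBlocks₁₂) +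
      w.val.toBlocks₁₂ᴴ * w.val.toBlocks₂₂ = 0 := by simpa using h₂
  rw [neg_add_eq_zero] at h₃
  exact h₃.symm

/-- The Hermitian matrix `S` such that `[A, B; 0, D] = [1, S; 0, 1] [A, 0; 0, D]`. -/
def siegelPart (w : Matrix (Fin n ⊕ Fin n) (Fin n ⊕ Fin n) K) : Matrix (Fin n) (Fin n) K :=
  w.toBlocks₁₂ * w.toBlocks₁₁ᴴ

theorem conjTranspose_siegelPart {w : GL (Fin n ⊕ Fin n) K} (hw : w ∈ unipG p F K n) :
    (siegelPart w.val)ᴴ = siegelPart w.val := by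
  obtain ⟨h₁, h₂, -⟩ := mem_unipG.1 hw
  obtain ⟨r₁, r₂⟩ := blocks_of_mem_groupG h₁ h₂
  have r₃ : w.val.toBlocks₂₂ * w.val.toBlocks₁₁ᴴ = 1 := mul_eq_one_comm.1 r₁
  have r₄ : w.val.toBlocks₁₁ * w.val.toBlocks₂₂ᴴ = 1 := by
    rw [← conjTranspose_one, ← r₃, conjTranspose_mul, conjTranspose_conjTranspose]
  rw [siegelPart, conjTranspose_mul, conjTranspose_conjTranspose]
  calc w.val.toBlocks₁₁ * w.val.toBlocks₁₂ᴴ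
      = w.val.toBlocks₁₁ * (w.val.toBlocks₁₂ᴴ * w.val.toBlocks₂₂) * w.val.toBlocks₁₁ᴴ := by
        rw [Matrix.mul_assoc, Matrix.mul_assoc, r₃, Matrix.mul_one]
    _ = _ := by rw [r₂, ← Matrix.mul_assoc, r₄, Matrix.one_mul]

/-- The semidirect product law for w = [1, S; 0, 1][A, 0; 0, D]: the Levi part acts on Hermitian
matrices by S ↦ A S ᵗĀ. -/
theorem blocks_mul {v w : GL (Fin n ⊕ Fin n) K} (hv : v ∈ unipG p F K n)
    (hw : w ∈ unipG p F K n) :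
    (v * w).val.toBlocks₁₁ = v.val.toBlocks₁₁ * w.val.toBlocks₁₁ ∧
      siegelPart (v * w).val =
        v.val.toBlocks₁₁ * siegelPart w.val * v.val.toBlocks₁₁ᴴ + siegelPart v.val := by
  have e₁ := eq_fromBlocks_of_mem_unipUpper (mem_unipG.1 hv).2.1
  have e₂ := eq_fromBlocks_of_mem_unipUpper (mem_unipG.1 hw).2.1
  have r₃ := mul_eq_one_comm.1 (blocks_of_mem_groupG (mem_unipG.1 hw).1 (mem_unipG.1 hw).2.1).1
  have e₃ := fromBlocks_multiply v.val.toBlocks₁₁ v.val.toBlocks₁₂ 0 v.val.toBlocks₂₂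
    w.val.toBlocks₁₁ w.val.toBlocks₁₂ 0 w.val.toBlocks₂₂
  rw [← e₁, ← e₂, ← Units.val_mul] at e₃
  have e₄ : (v * w).val.toBlocks₁₁ = v.val.toBlocks₁₁ * w.val.toBlocks₁₁ := by
    rw [e₃, toBlocks_fromBlocks₁₁, Matrix.mul_zero, add_zero]
  refine ⟨e₄, ?_⟩
  have e₅ : (v * w).val.toBlocks₁₂ =
      v.val.toBlocks₁₁ * w.val.toBlocks₁₂ + v.val.toBlocks₁₂ * w.val.toBlocks₂₂ := by
    rw [e₃, toBlocks_fromBlocks₁₂]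
  rw [siegelPart, e₄, e₅, conjTranspose_mul, Matrix.add_mul, siegelPart, siegelPart]
  congr 1
  · simp only [Matrix.mul_assoc]
  · rw [← Matrix.mul_assoc, Matrix.mul_assoc v.val.toBlocks₁₂, r₃, Matrix.mul_one]

theorem exists_mem_unipG (hs : ∀ x ∈ intK p F K, star x ∈ intK p F K) {g : GL (Fin n) K}
    (hg : g ∈ unipGL p F K n) {S : Matrix (Fin n) (Fin n) K} (hS : IntMat (intK p F K) S)
    (hS' : Sᴴ = S) :
    ∃ w ∈ unipG p F K n, w.val = fromBlocks g.val (S * (g⁻¹).valᴴ) 0 (g⁻¹).valᴴ := by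
  obtain ⟨h₁, h₂⟩ := mem_unipGL.1 hg
  obtain ⟨h₃, h₄⟩ := mem_unipGL.1 (inv_mem hg)
  have iD := h₄.conjTranspose hs
  have e : g.valᴴ * (g⁻¹).valᴴ = 1 := by
    rw [← conjTranspose_mul, ← Units.val_mul, inv_mul_cancel, Units.val_one, conjTranspose_one]
  have e' : (g⁻¹).val * g.val = 1 := by
    rw [← Units.val_mul, inv_mul_cancel, Units.val_one]
  obtain ⟨w, hw, hwM⟩ := exists_mem_unipUpper (b := orderG n)
    (M := fromBlocks g.val (S * (g⁻¹).valᴴ) 0 (g⁻¹).valᴴ) (by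
      rintro (i | i) (j | j) hij <;> simp only [orderG, Sum.elim_inl, Sum.elim_inr] at hij
      · rw [fromBlocks_apply₁₁, h₁ i j (by rw [Fin.le_def]; omega)]
        simp [Matrix.one_apply]
      · omega
      · rfl
      · rw [fromBlocks_apply₂₂, conjTranspose_apply, h₃ j i (by rw [Fin.le_def]; omega)]
        simp only [Matrix.one_apply, Sum.inr.injEq, eq_comm (a := j)]
        split_ifs <;> simp)
  refine ⟨w, mem_unipG.2 ⟨?_, hw, ?_⟩, hwM⟩
  · change w.valᴴ * formG K n * w.val = formG K n
    rw [hwM, formG, fromBlocks_conjTranspose, fromBlocks_multiply, fromBlocks_multiply,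
      fromBlocks_inj]
    refine ⟨by simp, ?_, ?_, ?_⟩
    · rw [Matrix.mul_zero, Matrix.mul_one, conjTranspose_zero, Matrix.zero_mul, Matrix.zero_mul,
        zero_add, add_zero, e, Matrix.zero_mul, zero_add]
    · rw [Matrix.mul_zero, Matrix.mul_neg, Matrix.mul_one, conjTranspose_conjTranspose, zero_add,
        Matrix.neg_mul, Matrix.mul_zero, add_zero, e']
    simp [conjTranspose_mul, hS', Matrix.mul_assoc]
  · rw [hwM]
    exact h₂.fromBlocks (hS.mul iD) .zero iD

theorem siegelPart_eq {g : GL (Fin n) K} {S : Matrix (Fin n) (Fin n) K}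
    {w : GL (Fin n ⊕ Fin n) K} (hw : w.val = fromBlocks g.val (S * (g⁻¹).valᴴ) 0 (g⁻¹).valᴴ) :
    siegelPart w.val = S := by
  have e : (g⁻¹).valᴴ * g.valᴴ = 1 := by
    rw [← conjTranspose_mul, ← Units.val_mul, mul_inv_cancel, Units.val_one, conjTranspose_one]
  rw [siegelPart, hw, toBlocks_fromBlocks₁₁, toBlocks_fromBlocks₁₂, Matrix.mul_assoc, e,
    Matrix.mul_one]

theorem intMat_siegelPart (hs : ∀ x ∈ intK p F K, star x ∈ intK p F K)
    {w : GL (Fin n ⊕ Fin n) K} (hw : w ∈ unipG p F K n) :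
    IntMat (intK p F K) (siegelPart w.val) := by
  have h := (mem_unipG.1 hw).2.2
  exact IntMat.mul (fun i j => h _ _) (IntMat.conjTranspose hs fun i j => h _ _)

omit [StarRing K] in
theorem toBlocks₁₁_one : (1 : Matrix (Fin n ⊕ Fin n) (Fin n ⊕ Fin n) K).toBlocks₁₁ = 1 := by
  rw [← fromBlocks_one, toBlocks_fromBlocks₁₁]

/-- The homomorphism `[A, B; 0, D] ↦ A`. -/
def leviHom (p : ℕ) [Fact p.Prime] (F : Type*) [Field F] [Algebra ℚ_[p] F]
    (K : Type*) [CommRing K] [Algebra F K] [StarRing K] (n : ℕ) :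
    unipG p F K n →* unipGL p F K n where
  toFun w := ⟨⟨w.1.val.toBlocks₁₁, (w⁻¹).1.val.toBlocks₁₁, by
      rw [← (blocks_mul w.2 (w⁻¹).2).1, ← Subgroup.coe_mul, mul_inv_cancel]
      exact toBlocks₁₁_one, by
      rw [← (blocks_mul (w⁻¹).2 w.2).1, ← Subgroup.coe_mul, inv_mul_cancel]
      exact toBlocks₁₁_one⟩,
    mem_unipGL.2 ⟨toBlocks₁₁_of_mem_unipUpper (mem_unipG.1 w.2).2.1,
      fun i j => (mem_unipG.1 w.2).2.2 _ _⟩⟩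
  map_one' := Subtype.ext (Units.ext toBlocks₁₁_one)
  map_mul' v w := Subtype.ext (Units.ext (blocks_mul v.2 w.2).1)

theorem leviHom_val (w : unipG p F K n) : (leviHom p F K n w).1.val = w.1.val.toBlocks₁₁ := rfl

theorem leviHom_surjective (hs : ∀ x ∈ intK p F K, star x ∈ intK p F K) :
    Function.Surjective (leviHom p F K n) := by
  rintro ⟨g, hg⟩
  obtain ⟨w, hw, e⟩ := exists_mem_unipG hs hg .zero conjTranspose_zero
  refine ⟨⟨w, hw⟩, Subtype.ext (Units.ext ?_)⟩
  rw [leviHom_val, e, toBlocks_fromBlocks₁₁]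

theorem breveT_val (a : Fin m → Kˣ) (d : Kˣ) : (breveT n a d).val =
    fromBlocks (breveA n a d).val 0 0 (diagonal fun j => (star (breveEntries n a d j))⁻¹.val) := by
  rw [breveA, breveT, diagGL, diagGL, fromBlocks_diagonal]
  ext (i | i) <;> rfl

theorem breveT_inv_val (a : Fin m → Kˣ) (d : Kˣ) : ((breveT n a d)⁻¹).val =
    fromBlocks ((breveA n a d)⁻¹).val 0 0 (diagonal fun j => star (breveEntries n a d j : K)) := by
  have h : ((breveT n a d)⁻¹).val = diagonal (fun i : Fin n ⊕ Fin n => ((Sum.elim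
    (breveEntries n a d) (fun j => (star (breveEntries n a d j))⁻¹) i)⁻¹ : Kˣ).val) := rfl
  have h' : ((breveA n a d)⁻¹).val = diagonal (fun i => (breveEntries n a d i)⁻¹.val) := rfl
  rw [h, h', fromBlocks_diagonal]
  congr 1
  ext (i | i)
  · rfl
  · simp

theorem conj_breveA_mem_unipGL (hs : ∀ x ∈ intK p F K, star x ∈ intK p F K) {a : Fin m → Kˣ}
    {d : Kˣ} (ht : ∀ w ∈ unipG p F K n, breveT n a d * w * (breveT n a d)⁻¹ ∈ unipG p F K n)
    {A : GL (Fin n) K} (hA : A ∈ unipGL p F K n) :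
    breveA n a d * A * (breveA n a d)⁻¹ ∈ unipGL p F K n := by
  obtain ⟨w, hw, e⟩ := exists_mem_unipG hs hA .zero conjTranspose_zero
  have h := (leviHom p F K n ⟨_, ht w hw⟩).2
  convert h using 1
  ext1
  rw [leviHom_val]
  simp only [Units.val_mul, breveT_val, breveT_inv_val, e, fromBlocks_multiply,
    toBlocks_fromBlocks₁₁]
  simp

/-- Conjugation by `t̆` sends S to A(t̆) S A(t̆)ᴴ. Applied to the matrix S all of whose entries are
1, the contraction property yields every product t̆_i times the conjugate of t̆_j. -/
theorem breveEntries_mul_star_mem (hs : ∀ x ∈ intK p F K, star x ∈ intK p F K) {a : Fin m → Kˣ}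
    {d : Kˣ} (ht : ∀ w ∈ unipG p F K n, breveT n a d * w * (breveT n a d)⁻¹ ∈ unipG p F K n)
    (i j : Fin n) :
    (breveEntries n a d i : K) * star (breveEntries n a d j : K) ∈ intK p F K := by
  obtain ⟨w, hw, e⟩ := exists_mem_unipG (S := Matrix.of fun _ _ => (1 : K)) hs
    (one_mem (unipGL p F K n)) (fun _ _ => one_mem _) (by ext; simp)
  have h := (mem_unipG.1 (ht w hw)).2.2 (Sum.inl i) (Sum.inr j)
  rw [Units.val_mul, Units.val_mul, breveT_val, breveT_inv_val, e, fromBlocks_multiply,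
    fromBlocks_multiply, fromBlocks_apply₁₂] at h
  have hA : (breveA n a d).val = diagonal fun i => (breveEntries n a d i : K) := rfl
  rw [hA] at h
  simpa [mul_diagonal, diagonal_mul] using h

end UnipG

/-! ### The character ψ on Hermitian matrices -/

section Character

variable {p : ℕ} [Fact p.Prime] {F : Type*} [Field F] [Algebra ℚ_[p] F] [FiniteDimensional ℚ_[p] F]
  [TopologicalSpace F] {K : Type*} [CommRing K] [Algebra F K] [StarRing K] {n : ℕ}
  (hK : IsCoefficientAlgebra p F K)

theorem star_trace_mul {S Y : Matrix (Fin n) (Fin n) K} (hS : Sᴴ = S) (hY : Yᴴ = Y) :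
    star (trace (S * Y)) = trace (S * Y) := by
  rw [← trace_conjTranspose, conjTranspose_mul, hS, hY, trace_mul_comm]

include hK

omit [FiniteDimensional ℚ_[p] F] [TopologicalSpace F] in
theorem IsCoefficientAlgebra.toBase_add {x y : K} (hx : star x = x) (hy : star y = y) :
    toBase F (x + y) = toBase F x + toBase F y := by
  apply hK.algebraMap_injective
  rw [map_add, hK.algebraMap_toBase hx, hK.algebraMap_toBase hy, hK.algebraMap_toBase]
  rw [star_add, hx, hy]

theorem apply_trace_eq_one (hp : p ≠ 2) {ψ : AddChar F ℂ} (hψ : HasConductorIntegers p ψ)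
    {S Y : Matrix (Fin n) (Fin n) K} (hS : Sᴴ = S) (hY : Yᴴ = Y) (iS : IntMat (intK p F K) S)
    (iY : IntMat (intK p F K) Y) : ψ (2⁻¹ * toBase F (trace (S * Y))) = 1 := by
  refine hψ.eq_one p (mul_mem (inv_two_mem_intF p hp) (hK.mem_intF_of_algebraMap_mem ?_))
  rw [hK.algebraMap_toBase (star_trace_mul hS hY)]
  exact sum_mem fun i _ => (iS.mul iY) i i

/-- The test matrices sE_ij + s̄E_ji give tr(sY_ji) ∈ 𝒪_F for every s ∈ 𝒪, and the trace pairing is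
perfect. -/
theorem intMat_of_forall_apply_trace_eq_one (hp : p ≠ 2) {ψ : AddChar F ℂ}
    (hψ : HasConductorIntegers p ψ) {Y : Matrix (Fin n) (Fin n) K} (hY : Yᴴ = Y)
    (h : ∀ S : Matrix (Fin n) (Fin n) K, IntMat (intK p F K) S → Sᴴ = S →
      ψ (2⁻¹ * toBase F (trace (S * Y))) = 1) : IntMat (intK p F K) Y := by
  have : CharZero F := charZero_of_injective_algebraMap (algebraMap ℚ_[p] F).injective
  intro j i
  refine hK.mem_of_forall_trace_mem hp fun s hs => ?_
  have htr : ∀ s : K, trace ((single i j s + single j i (star s)) * Y) =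
      s * Y j i + star (s * Y j i) := by
    intro s
    have : star (Y j i) = Y i j := by
      conv_rhs => rw [← hY, conjTranspose_apply]
    rw [Matrix.add_mul, trace_add, trace_single_mul, trace_single_mul, star_mul', this,
      smul_eq_mul, smul_eq_mul]
  have hfix : ∀ x : K, star (x + star x) = x + star x := fun x => by
    rw [star_add, star_star, add_comm]
  have h₁ : 2⁻¹ * toBase F (s * Y j i + star (s * Y j i)) ∈ intF p F := by
    -- The conductor condition concerns ψ on all 𝒪_F-multiples of the argument; these are obtained
    -- by replacing s by cs.
    rw [← hψ.2]
    intro c hc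
    have hcs : algebraMap F K c * s ∈ intK p F K :=
      mul_mem (IsCoefficientAlgebra.algebraMap_mem_intK hc) hs
    have h₂ := h (single i j (algebraMap F K c * s) + single j i (star (algebraMap F K c * s)))
      (by
        refine IntMat.add (fun k l => ?_) (fun k l => ?_) <;> rw [Matrix.single_apply] <;> split_ifs
        exacts [hcs, zero_mem _, hK.star_mem hcs, zero_mem _])
      (by rw [conjTranspose_add, conjTranspose_single, conjTranspose_single, star_star, add_comm])
    rw [htr] at h₂
    rw [← h₂]
    congr 1
    rw [mul_assoc]
    congr 1
    apply hK.algebraMap_injective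
    rw [map_mul, hK.algebraMap_toBase (hfix _), hK.algebraMap_toBase (hfix _), mul_assoc]
    simp only [star_mul', hK.star_algebraMap]
    ring
  have h₃ := IsCoefficientAlgebra.algebraMap_mem_intK (K := K)
    (mul_mem (natCast_mem (intF p F) 2) h₁)
  rwa [Nat.cast_ofNat, mul_inv_cancel_left₀ two_ne_zero, hK.algebraMap_toBase (hfix _)] at h₃

end Character

/-! ### Volumes of open subgroups and conjugates -/

section OpenSubgroups

/-- The cosets are disjoint, with the same positive measure, in a space of finite measure. -/
theorem finiteIndex_of_isOpen {G : Type*} [Group G] [TopologicalSpace G] [ContinuousMul G]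
    [MeasurableSpace G] [BorelSpace G] (μ : Measure G) [μ.IsHaarMeasure] [IsFiniteMeasure μ]
    {W : Subgroup G} (hW : IsOpen (W : Set G)) : W.FiniteIndex := by
  have hpos : 0 < μ (W : Set G) := hW.measure_pos μ ⟨1, W.one_mem⟩
  have hcoset : ∀ g : G, (QuotientGroup.mk : G → G ⧸ W) ⁻¹' {(g : G ⧸ W)} =
      (fun x => g⁻¹ * x) ⁻¹' (W : Set G) := by
    intro g
    ext x
    rw [Set.mem_preimage, Set.mem_singleton_iff, eq_comm, QuotientGroup.eq]
    rfl
  have hfin := Measure.finite_const_le_meas_of_disjoint_iUnion μ hpos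
    (As := fun q : G ⧸ W => (QuotientGroup.mk : G → G ⧸ W) ⁻¹' {q})
    (fun q => by
      obtain ⟨g, rfl⟩ := QuotientGroup.mk_surjective q
      rw [hcoset]
      exact (hW.preimage (continuous_const_mul g⁻¹)).measurableSet)
    (fun q r hqr => Disjoint.preimage _ (Set.disjoint_singleton.2 hqr)) (measure_ne_top _ _)
  have huniv : {q : G ⧸ W | μ (W : Set G) ≤ μ ((QuotientGroup.mk : G → G ⧸ W) ⁻¹' {q})} =
      Set.univ := by
    refine Set.eq_univ_of_forall fun q => ?_
    obtain ⟨g, rfl⟩ := QuotientGroup.mk_surjective q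
    change _ ≤ μ (QuotientGroup.mk ⁻¹' {(g : G ⧸ W)})
    rw [hcoset, measure_preimage_mul]
  rw [huniv] at hfin
  have := Set.finite_univ_iff.1 hfin
  exact Subgroup.finiteIndex_of_finite_quotient

/-- Both volumes are the inverse of the index, and a surjective homomorphism preserves the index
under inverse image. -/
theorem measureReal_comap_of_surjective {G H : Type*} [Group G] [TopologicalSpace G]
    [ContinuousMul G] [MeasurableSpace G] [BorelSpace G] [Group H] [TopologicalSpace H]
    [ContinuousMul H] [MeasurableSpace H] [BorelSpace H] (μ : Measure G) [μ.IsHaarMeasure]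
    [IsProbabilityMeasure μ] (ν : Measure H) [ν.IsHaarMeasure] [IsProbabilityMeasure ν] {f : G →* H}
    (hf : Continuous f) (hf' : Function.Surjective f) {W : Subgroup H}
    (hW : IsOpen (W : Set H)) : μ.real (W.comap f : Set G) = ν.real (W : Set H) := by
  have hW' : IsOpen (W.comap f : Set G) := hW.preimage hf
  have := finiteIndex_of_isOpen ν hW
  have := finiteIndex_of_isOpen μ hW'
  have h₁ := (W.comap f).index_mul_measure hW'.measurableSet μ
  have h₂ := W.index_mul_measure hW.measurableSet ν
  rw [Subgroup.index_comap_of_surjective W hf', measure_univ] at h₁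
  rw [measure_univ, ← h₁] at h₂
  rw [Measure.real, Measure.real, (ENNReal.mul_right_inj ?_ ?_).1 h₂]
  · exact_mod_cast Subgroup.FiniteIndex.index_ne_zero
  · exact ENNReal.natCast_ne_top _

end OpenSubgroups

section ConjugateSubgroup

variable {ι : Type*} [Fintype ι] [DecidableEq ι] {K : Type*} [CommRing K]

theorem diagGL_inv_mul_mul_mem_unipUpper (f : ι → Kˣ) {b : ι → ℤ} {w : GL ι K}
    (hw : w ∈ unipUpper K b) : (diagGL f)⁻¹ * w * diagGL f ∈ unipUpper K b := by
  intro i j hij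
  have h₁ : ((diagGL f)⁻¹).val = diagonal fun i => ((f i)⁻¹ : Kˣ).val := rfl
  have h₂ : (diagGL f).val = diagonal fun i => (f i : K) := rfl
  rw [Units.val_mul, Units.val_mul, h₁, h₂, mul_diagonal, diagonal_mul, hw i j hij,
    Matrix.one_apply]
  split_ifs with h
  · rw [h, mul_one, Units.inv_mul]
  · simp

/-- The subgroup `t U t⁻¹ ∩ U` of `U`. -/
def conjSubgroup (U : Subgroup (GL ι K)) (t : GL ι K) : Subgroup U :=
  (U.map (MulAut.conj t).toMonoidHom).subgroupOf U

theorem mem_conjSubgroup {U : Subgroup (GL ι K)} {t : GL ι K} {w : U} :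
    w ∈ conjSubgroup U t ↔ t⁻¹ * w.1 * t ∈ U := by
  rw [conjSubgroup, Subgroup.mem_subgroupOf, Subgroup.mem_map]
  constructor
  · rintro ⟨v, hv, e⟩
    rw [← e]
    simpa [mul_assoc] using hv
  · intro h
    exact ⟨_, h, by simp [mul_assoc]⟩

theorem conjVol_eq (U : Subgroup (GL ι K)) [MeasurableSpace U] (μ : Measure U) (t : GL ι K) :
    conjVol U μ t = μ.real (conjSubgroup U t : Set U) := by
  rw [conjVol]
  congr 1
  ext w
  rw [SetLike.mem_coe, mem_conjSubgroup]
  constructor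
  · rintro ⟨v, hv, e⟩
    rw [e]
    simpa [mul_assoc] using hv
  · intro h
    exact ⟨_, h, by simp [mul_assoc]⟩

variable [TopologicalSpace K]

theorem isOpen_intGL {R : Type*} [CommRing R] [Algebra R K] {O : Subalgebra R K}
    (hO : IsOpen (O : Set K)) : IsOpen (intGL (ι := ι) O : Set (GL ι K)) := by
  have : (intGL (ι := ι) O : Set (GL ι K)) = ⋂ i, ⋂ j,
      (fun g : GL ι K => g.val i j) ⁻¹' O ∩ (fun g : GL ι K => (g⁻¹).val i j) ⁻¹' O := by
    ext g
    simp only [Set.mem_iInter]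
    rfl
  rw [this]
  refine isOpen_iInter_of_finite fun i => isOpen_iInter_of_finite fun j => ?_
  exact (hO.preimage (Units.continuous_val.matrix_elem i j)).inter
    (hO.preimage (Units.continuous_coe_inv.matrix_elem i j))

/-- Conjugation by t⁻¹ preserves all conditions defining U except integrality, which is an open
condition. -/
theorem isOpen_conjSubgroup [IsTopologicalRing K] {R : Type*} [CommRing R] [Algebra R K]
    {O : Subalgebra R K} (hO : IsOpen (O : Set K)) {U V : Subgroup (GL ι K)} {t : GL ι K}
    (hU : U = V ⊓ intGL O) (hV : ∀ w ∈ V, t⁻¹ * w * t ∈ V) :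
    IsOpen (conjSubgroup U t : Set U) := by
  have : (conjSubgroup U t : Set U) = (fun w : U => t⁻¹ * w.1 * t) ⁻¹'
      (intGL O : Subgroup (GL ι K)) := by
    ext w
    rw [SetLike.mem_coe, mem_conjSubgroup, Set.mem_preimage, SetLike.mem_coe]
    subst hU
    exact ⟨fun h => h.2, fun h => ⟨hV _ w.2.1, h⟩⟩
  rw [this]
  exact (isOpen_intGL hO).preimage (by fun_prop)

theorem conjVol_pos {U : Subgroup (GL ι K)} [MeasurableSpace U] {μ : Measure U}
    [μ.IsHaarMeasure] [IsFiniteMeasure μ] {t : GL ι K}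
    (h : IsOpen (conjSubgroup U t : Set U)) : 0 < conjVol U μ t := by
  rw [conjVol_eq, measureReal_def, ENNReal.toReal_pos_iff]
  exact ⟨h.measure_pos μ ⟨1, one_mem _⟩, measure_lt_top _ _⟩

end ConjugateSubgroup

section UnipotentGroups

variable {p : ℕ} [Fact p.Prime] {F : Type*} [Field F] [Algebra ℚ_[p] F]
  {K : Type*} [CommRing K] [Algebra F K] [StarRing K] {m n ε : ℕ}
  [TopologicalSpace K] [IsTopologicalRing K]

theorem isOpen_conjSubgroup_unipH (hO : IsOpen (intK p F K : Set K)) {a : Fin m → Kˣ} {u : Kˣ}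
    (ht : torusH ε a u ∈ groupH K m ε) :
    IsOpen (conjSubgroup (unipH p F K m ε) (torusH ε a u) : Set (unipH p F K m ε)) :=
  isOpen_conjSubgroup hO rfl fun _ hw => 
    ⟨(groupH K m ε).mul_mem ((groupH K m ε).mul_mem ((groupH K m ε).inv_mem ht) hw.1) ht,
    diagGL_inv_mul_mul_mem_unipUpper _ hw.2⟩

omit [StarRing K] in
theorem isOpen_conjSubgroup_unipGL (hO : IsOpen (intK p F K : Set K)) (a : Fin m → Kˣ) (d : Kˣ) :
    IsOpen (conjSubgroup (unipGL p F K n) (breveA n a d) : Set (unipGL p F K n)) :=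
  isOpen_conjSubgroup hO rfl fun _ hw => diagGL_inv_mul_mul_mem_unipUpper _ hw

omit [IsTopologicalRing K] in
theorem continuous_leviHom : Continuous (leviHom p F K n) := by
  have h : ∀ f : unipG p F K n → Matrix (Fin n ⊕ Fin n) (Fin n ⊕ Fin n) K, Continuous f →
      Continuous fun w => (f w).toBlocks₁₁ := fun f hf =>
    continuous_matrix fun i j => hf.matrix_elem (Sum.inl i) (Sum.inl j)
  refine Continuous.subtype_mk (Units.continuous_iff.2 ⟨?_, ?_⟩) _
  · exact h _ (Units.continuous_val.comp continuous_subtype_val)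
  · exact h _ (Units.continuous_coe_inv.comp continuous_subtype_val)

end UnipotentGroups

/-! ### The operator on the side of `H` -/

section OperatorH

variable {p : ℕ} [Fact p.Prime] {F : Type*} [Field F] [Algebra ℚ_[p] F]
  {K : Type*} [CommRing K] [Algebra F K] [StarRing K] {m n ε : ℕ}
  [TopologicalSpace K] [IsTopologicalRing K]
  [MeasurableSpace (unipH p F K m ε)] [BorelSpace (unipH p F K m ε)]
  (μ : Measure (unipH p F K m ε)) {hmn : m ≤ n} (χ : Fin m → ((intK p F K)ˣ →* ℂˣ))
  (X : Matrix (Row m ε) (Fin n) K)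

omit [TopologicalSpace K] [IsTopologicalRing K] [BorelSpace (unipH p F K m ε)] in
theorem upH_mul (t : GL (Row m ε) K) {A : GL (Fin n) K} (hA : A ∈ unipGL p F K n) :
    upH p μ t (phiChi p F hmn χ) (X * A.val) = upH p μ t (phiChi p F hmn χ) X := by
  simp only [upH, weilH, ← Matrix.mul_assoc, phiChi_mul χ _ hA]

theorem upH_transpose_mul [μ.IsMulLeftInvariant] (t : GL (Row m ε) K)
    (φ : Matrix (Row m ε) (Fin n) K → ℂ) {v : GL (Row m ε) K} (hv : v ∈ unipH p F K m ε) :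
    upH p μ t φ (v.valᵀ * X) = upH p μ t φ X := by
  symm
  rw [upH, upH, ← integral_mul_left_eq_self _ (⟨v, hv⟩ : unipH p F K m ε)]
  refine integral_congr_ae (ae_of_all _ fun w => ?_)
  simp only [weilH, Subgroup.coe_mul, Units.val_mul, transpose_mul, Matrix.mul_assoc]

omit [TopologicalSpace K] [IsTopologicalRing K] [BorelSpace (unipH p F K m ε)] in
theorem exists_isSupported_of_upH_ne_zero {t : GL (Row m ε) K}
    (h : upH p μ t (phiChi p F hmn χ) X ≠ 0) :
    ∃ w ∈ unipH p F K m ε, IsSupported p F hmn (t.valᵀ * (w.valᵀ * X)) := by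
  by_contra! H
  refine h (integral_eq_zero_of_ae (ae_of_all _ fun w => ?_))
  simp only [weilH, Units.val_mul, transpose_mul, Matrix.mul_assoc, Pi.zero_apply]
  exact phiChi_eq_zero (H w.1 w.2)

/-- Write ᵗ(wt)X = ᵗ(t⁻¹wt)·ᵗtX. If t⁻¹wt is integral it does not change φ; otherwise the rigidity
of the standard matrix ᵗtX makes φ vanish. -/
theorem IsNormal.upH_eq (hs : ∀ x ∈ intK p F K, star x ∈ intK p F K)
    (hO : IsOpen (intK p F K : Set K)) {a : Fin m → Kˣ} {u : Kˣ} {c : Fin m → Kˣ}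
    (ht : torusH ε a u ∈ groupH K m ε) {X : Matrix (Row m ε) (Fin n) K}
    (h : IsNormal p F hmn a u c X) :
    upH p μ (torusH ε a u) (phiChi p F hmn χ) X =
      conjVol (unipH p F K m ε) μ (torusH ε a u) *
        phiChi p F hmn χ ((torusH ε a u).valᵀ * X) := by
  set t := torusH ε a u with htdef
  have e : ∀ w : unipH p F K m ε, weilH (w.1 * t) (phiChi p F hmn χ) X =
      (conjSubgroup (unipH p F K m ε) t : Set _).indicator
        (fun _ => phiChi p F hmn χ (t.valᵀ * X)) w := by
    intro w
    have e₁ : ((w.1 * t).val)ᵀ * X = (t⁻¹ * w.1 * t).valᵀ * (t.valᵀ * X) := by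
      rw [← Matrix.mul_assoc, ← transpose_mul, ← Units.val_mul]
      simp only [mul_assoc, mul_inv_cancel_left]
    rw [weilH, e₁]
    by_cases hw : w ∈ conjSubgroup (unipH p F K m ε) t
    · rw [Set.indicator_of_mem hw, phiChi_transpose_mul χ _ (mem_conjSubgroup.1 hw)]
    · rw [Set.indicator_of_notMem hw]
      refine phiChi_eq_zero fun hsupp => hw (mem_conjSubgroup.2 ?_)
      refine mem_unipH_of_isSupported hs h.units h.intMat_torusH_mul h.isStandard_torusH_mul
        ?_ ?_ hsupp
      · exact mul_mem (mul_mem (inv_mem ht) (mem_unipH.1 w.2).1) ht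
      · exact diagGL_inv_mul_mul_mem_unipUpper _ (mem_unipH.1 w.2).2.1
  rw [upH, integral_congr_ae (ae_of_all _ e),
    integral_indicator_const _ (isOpen_conjSubgroup_unipH hO ht).measurableSet, conjVol_eq]
  exact Complex.real_smul

end OperatorH

/-! ### The operator on the side of `G` -/

section OperatorG

variable {p : ℕ} [Fact p.Prime] {F : Type*} [Field F] [Algebra ℚ_[p] F] [FiniteDimensional ℚ_[p] F]
  [TopologicalSpace F]
  {K : Type*} [CommRing K] [Algebra F K] [StarRing K] {m n ε : ℕ}
  [TopologicalSpace K] [IsTopologicalRing K]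
  [MeasurableSpace (unipG p F K n)] [BorelSpace (unipG p F K n)]
  (ψ : AddChar F ℂ) (μ : Measure (unipG p F K n)) {hmn : m ≤ n}
  (χ : Fin m → ((intK p F K)ˣ →* ℂˣ))

/-- The operator `∫_{U_{G, 𝒪}} (action by w t) dw` for `t = diag(T, *)`, up to the factors that
depend on `det T`. -/
def siegelIntegral (T : GL (Fin n) K) (φ : Matrix (Row m ε) (Fin n) K → ℂ)
    (X : Matrix (Row m ε) (Fin n) K) : ℂ :=
  ∫ w : unipG p F K n, ψ (2⁻¹ * toBase F (trace (siegelPart w.1.val * gram X))) *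
    φ (X * (leviHom p F K n w).1.val * T.val) ∂μ

variable (X : Matrix (Row m ε) (Fin n) K)

omit [FiniteDimensional ℚ_[p] F] [TopologicalSpace F] [TopologicalSpace K] [IsTopologicalRing K]
  [BorelSpace (unipG p F K n)] in
theorem siegelIntegral_transpose_mul (T : GL (Fin n) K) {v : GL (Row m ε) K}
    (hv : v ∈ unipH p F K m ε) :
    siegelIntegral ψ μ T (phiChi p F hmn χ) (v.valᵀ * X) =
      siegelIntegral ψ μ T (phiChi p F hmn χ) X := by
  simp only [siegelIntegral, gram_transpose_mul (mem_unipH.1 hv).1, Matrix.mul_assoc,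
    phiChi_transpose_mul χ _ hv]

omit [FiniteDimensional ℚ_[p] F] [TopologicalSpace F] in
-- Translation of the Haar measure by v, combined with the product law for S. For v in the Levi part
-- it gives right invariance; for v = [1, S; 0, 1] it gives equivariance under the character S ↦ ψ(½
-- Tr S·ᵗX̄JX).
theorem siegelIntegral_eq_mul [μ.IsMulLeftInvariant] (hK : IsCoefficientAlgebra p F K)
    (T : GL (Fin n) K) (φ : Matrix (Row m ε) (Fin n) K → ℂ) {v : GL (Fin n ⊕ Fin n) K}
    (hv : v ∈ unipG p F K n) :
    siegelIntegral ψ μ T φ X = ψ (2⁻¹ * toBase F (trace (siegelPart v.val * gram X))) *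
      siegelIntegral ψ μ T φ (X * v.val.toBlocks₁₁) := by
  rw [siegelIntegral, siegelIntegral, ← integral_const_mul,
    ← integral_mul_left_eq_self _ (⟨v, hv⟩ : unipG p F K n)]
  refine integral_congr_ae (ae_of_all _ fun w => ?_)
  obtain ⟨e₁, e₂⟩ := blocks_mul hv w.2
  simp only [leviHom_val, Subgroup.coe_mul, e₁, e₂]
  have e₃ : trace (v.val.toBlocks₁₁ * siegelPart w.1.val * v.val.toBlocks₁₁ᴴ * gram X) =
      trace (siegelPart w.1.val * gram (X * v.val.toBlocks₁₁)) := by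
    rw [gram_mul, Matrix.mul_assoc, Matrix.mul_assoc, trace_mul_comm]
    simp only [Matrix.mul_assoc]
  rw [Matrix.add_mul, trace_add, e₃, hK.toBase_add
    (star_trace_mul (conjTranspose_siegelPart w.2) (conjTranspose_gram _))
    (star_trace_mul (conjTranspose_siegelPart hv) (conjTranspose_gram _)), mul_add,
    AddChar.map_add_eq_mul]
  simp only [Matrix.mul_assoc]
  ring

omit [FiniteDimensional ℚ_[p] F] [TopologicalSpace F] in
theorem siegelIntegral_mul [μ.IsMulLeftInvariant] (hK : IsCoefficientAlgebra p F K)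
    (T : GL (Fin n) K) (φ : Matrix (Row m ε) (Fin n) K → ℂ) {A : GL (Fin n) K}
    (hA : A ∈ unipGL p F K n) :
    siegelIntegral ψ μ T φ (X * A.val) = siegelIntegral ψ μ T φ X := by
  obtain ⟨w, hw, e⟩ := exists_mem_unipG (fun _ => hK.star_mem) hA .zero conjTranspose_zero
  have h := siegelIntegral_eq_mul ψ μ X hK T φ hw
  rw [siegelPart_eq e, e, toBlocks_fromBlocks₁₁, Matrix.zero_mul, trace_zero] at h
  have h0 : toBase F (0 : K) = 0 :=
    hK.algebraMap_injective (by rw [hK.algebraMap_toBase (star_zero K), map_zero])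
  rw [h, h0, mul_zero, AddChar.map_zero_eq_one, one_mul]

/-- Translating by [1, S; 0, 1] multiplies the integral by a phase, so a nonzero value forces all
these phases to be 1. -/
theorem intMat_gram_of_siegelIntegral_ne_zero [μ.IsMulLeftInvariant] (hp : p ≠ 2)
    (hK : IsCoefficientAlgebra p F K) (hψ : HasConductorIntegers p ψ) {T : GL (Fin n) K}
    {φ : Matrix (Row m ε) (Fin n) K → ℂ} (h : siegelIntegral ψ μ T φ X ≠ 0) :
    IntMat (intK p F K) (gram X) := by
  refine intMat_of_forall_apply_trace_eq_one hK hp hψ (conjTranspose_gram X) fun S hS hS' => ?_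
  obtain ⟨w, hw, e⟩ := exists_mem_unipG (fun _ => hK.star_mem) (one_mem (unipGL p F K n)) hS hS'
  have h₁ := siegelIntegral_eq_mul ψ μ X hK T φ hw
  rw [siegelPart_eq e, e, toBlocks_fromBlocks₁₁, Units.val_one, Matrix.mul_one] at h₁
  exact mul_right_cancel₀ h (by rw [← h₁, one_mul])

omit [FiniteDimensional ℚ_[p] F] [TopologicalSpace F] [TopologicalSpace K] [IsTopologicalRing K]
  [BorelSpace (unipG p F K n)] in
theorem exists_isSupported_of_siegelIntegral_ne_zero {T : GL (Fin n) K}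
    (h : siegelIntegral ψ μ T (phiChi p F hmn χ) X ≠ 0) :
    ∃ A ∈ unipGL p F K n, IsSupported p F hmn (X * A.val * T.val) := by
  by_contra! H
  refine h (integral_eq_zero_of_ae (ae_of_all _ fun w => ?_))
  simp only [phiChi_eq_zero (H _ (leviHom p F K n w).2), mul_zero, Pi.zero_apply]

/-- The Gram matrix is integral, so the phase disappears and the integrand depends on w only through
its Levi part A. Then the argument is that of the H-side, and the volume is transported from U_G to
U_GL. -/
theorem IsNormal.siegelIntegral_eq [μ.IsHaarMeasure] [IsProbabilityMeasure μ]
    [MeasurableSpace (unipGL p F K n)] [BorelSpace (unipGL p F K n)]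
    (μGL : Measure (unipGL p F K n)) [μGL.IsHaarMeasure] [IsProbabilityMeasure μGL] (hp : p ≠ 2)
    (hK : IsCoefficientAlgebra p F K) (hψ : HasConductorIntegers p ψ)
    (hO : IsOpen (intK p F K : Set K)) {a : Fin m → Kˣ} {u d : Kˣ} {c : Fin m → Kˣ}
    (hu : Fin ε → star (u : K) * u = 1) {X : Matrix (Row m ε) (Fin n) K}
    (h : IsNormal p F hmn a u c X) :
    siegelIntegral ψ μ (breveA n a d) (phiChi p F hmn χ) X =
      conjVol (unipGL p F K n) μGL (breveA n a d) *
        phiChi p F hmn χ (X * (breveA n a d).val) := by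
  have hs : ∀ x ∈ intK p F K, star x ∈ intK p F K := fun _ => hK.star_mem
  have hgram := h.intMat_gram hs hu
  set t := breveA n a d with htdef
  have e : ∀ w : unipG p F K n, ψ (2⁻¹ * toBase F (trace (siegelPart w.1.val * gram X))) *
      phiChi p F hmn χ (X * (leviHom p F K n w).1.val * t.val) =
      ((conjSubgroup (unipGL p F K n) t).comap (leviHom p F K n) : Set _).indicator
        (fun _ => phiChi p F hmn χ (X * t.val)) w := by
    intro w
    rw [apply_trace_eq_one hK hp hψ (conjTranspose_siegelPart w.2) (conjTranspose_gram X)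
      (intMat_siegelPart hs w.2) hgram, one_mul]
    set A := leviHom p F K n w with hA
    have e₁ : X * A.1.val * t.val = X * t.val * (t⁻¹ * A.1 * t).val := by
      rw [Matrix.mul_assoc, Matrix.mul_assoc, ← Units.val_mul, ← Units.val_mul]
      congr 2
      group
    rw [e₁]
    by_cases hw : A ∈ conjSubgroup (unipGL p F K n) t
    · rw [Set.indicator_of_mem (show w ∈ _ from hw), phiChi_mul χ _ (mem_conjSubgroup.1 hw)]
    · rw [Set.indicator_of_notMem (show w ∉ _ from hw)]
      refine phiChi_eq_zero fun hsupp => hw (mem_conjSubgroup.2 ?_)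
      have hupper : t⁻¹ * A.1 * t ∈ unipUpper K (fun i : Fin n => (i : ℤ)) :=
        diagGL_inv_mul_mul_mem_unipUpper _ A.2.1
      refine mem_unipGL_of_isSupported h.units h.isStandard_mul_breveA
        (fun i j hij => hupper i j (Int.ofNat_le.2 hij)) (fun i j hi => ?_) hsupp
      rcases le_or_gt j i with hij | hij
      · rw [hupper i j (Int.ofNat_le.2 hij)]
        exact IntMat.one i j
      -- Rows from m on: there both torus entries are the same d, so conjugation leaves the entry of
      -- A unchanged. This is the integrality that the support condition cannot supply.
      · have hj : m ≤ (j : ℕ) := hi.trans (Fin.le_def.1 hij.le)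
        have h₁ : (t⁻¹).val = diagonal fun i => ((breveEntries n a d i)⁻¹ : Kˣ).val := rfl
        have h₂ : t.val = diagonal fun i => (breveEntries n a d i : K) := rfl
        rw [Units.val_mul, Units.val_mul, h₁, h₂, mul_diagonal, diagonal_mul,
          breveEntries_of_le a d hi, breveEntries_of_le a d hj, mul_right_comm, Units.inv_mul,
          one_mul]
        exact (mem_unipGL.1 A.2).2 i j
  have hW := isOpen_conjSubgroup_unipGL (n := n) hO a d
  have hW' : IsOpen ((conjSubgroup (unipGL p F K n) t).comap (leviHom p F K n) :
      Set (unipG p F K n)) := hW.preimage continuous_leviHom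
  rw [siegelIntegral, integral_congr_ae (ae_of_all _ e),
    integral_indicator_const _ hW'.measurableSet,
    measureReal_comap_of_surjective μ μGL continuous_leviHom (leviHom_surjective hs) hW,
    conjVol_eq]
  exact Complex.real_smul

end OperatorG

/-! ### Comparison of the two operators -/

section Comparison

variable {p : ℕ} [Fact p.Prime] {F : Type*} [Field F] [Algebra ℚ_[p] F] [FiniteDimensional ℚ_[p] F]
  [TopologicalSpace F] {K : Type*} [CommRing K] [Algebra F K] [StarRing K] {m n ε : ℕ}

theorem star_mul_self_of_torusH_mem {a : Fin m → Kˣ} {u : Kˣ}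
    (ht : torusH ε a u ∈ groupH K m ε) (k : Fin ε) : star (u : K) * u = 1 := by
  have h := congrFun (congrFun ht (rowB m k)) (rowB m k)
  have h₁ : (torusH ε a u).val = diagonal (fun i =>
      ((Sum.elim (Sum.elim a fun i => (star (a i))⁻¹) fun _ => u) i : K)) := rfl
  rw [h₁, mul_diagonal, diagonal_conjTranspose, diagonal_mul] at h
  simpa [formH, rowB] using h

/-- The theorem without the scalar factors: the normalised sides have the same invariances, their
nonvanishing leads to the same normal form, and there both equal φ. -/
theorem inv_conjVol_mul_upH_eq [TopologicalSpace K] [IsTopologicalRing K] (hp : p ≠ 2)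
    (hK : IsCoefficientAlgebra p F K) (hO : IsOpen (intK p F K : Set K)) {ψ : AddChar F ℂ}
    (hψ : HasConductorIntegers p ψ)
    [MeasurableSpace (unipH p F K m ε)] [BorelSpace (unipH p F K m ε)]
    (μH : Measure (unipH p F K m ε)) [μH.IsHaarMeasure] [IsProbabilityMeasure μH]
    [MeasurableSpace (unipG p F K n)] [BorelSpace (unipG p F K n)]
    (μG : Measure (unipG p F K n)) [μG.IsHaarMeasure] [IsProbabilityMeasure μG]
    [MeasurableSpace (unipGL p F K n)] [BorelSpace (unipGL p F K n)]
    (μGL : Measure (unipGL p F K n)) [μGL.IsHaarMeasure] [IsProbabilityMeasure μGL]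
    {hmn : m ≤ n} (χ : Fin m → ((intK p F K)ˣ →* ℂˣ)) {a : Fin m → Kˣ} {u d : Kˣ}
    (ht : torusH ε a u ∈ TPlus (groupH K m ε) (unipH p F K m ε))
    (ht' : breveT n a d ∈ TPlus (groupG K n) (unipG p F K n))
    (hdu : Fin ε → m < n → (d : K) * (u⁻¹ : Kˣ) ∈ intK p F K)
    (hbot : m < n → ∀ r : Fin ε → K, ∑ k, star (r k) * r k ∈ intK p F K →
      (∀ k, r k * (d : K) ∈ intK p F K) → ∀ k, (u : K) * r k ∈ intK p F K)
    (X : Matrix (Row m ε) (Fin n) K) :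
    (conjVol (unipH p F K m ε) μH (torusH ε a u) : ℂ)⁻¹ *
        upH p μH (torusH ε a u) (phiChi p F hmn χ) X =
      (conjVol (unipGL p F K n) μGL (breveA n a d) : ℂ)⁻¹ *
        siegelIntegral ψ μG (breveA n a d) (phiChi p F hmn χ) X := by
  have : CharZero F := charZero_of_injective_algebraMap (algebraMap ℚ_[p] F).injective
  have hs : ∀ x ∈ intK p F K, star x ∈ intK p F K := fun _ => hK.star_mem
  have hab : ∀ i j, star (a i : K) * (breveEntries n a d j : K) ∈ intK p F K := fun i j => by
    have h := breveEntries_mul_star_mem hs ht'.2.2 j (Fin.castLE hmn i)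
    rwa [breveEntries_castLE, mul_comm] at h
  have hu : Fin ε → star (u : K) * u = 1 := star_mul_self_of_torusH_mem ht.1
  have hz2 := IsCoefficientAlgebra.two_mul_inv_two (F := F) (K := K)
  have hzs := hK.star_algebraMap 2⁻¹
  have hz := IsCoefficientAlgebra.inv_two_mem (F := F) (K := K) hp
  -- Unless both sides vanish at X, whichever does not puts X in normal form.
  by_cases hzero : upH p μH (torusH ε a u) (phiChi p F hmn χ) X = 0 ∧
    siegelIntegral ψ μG (breveA n a d) (phiChi p F hmn χ) X = 0
  · rw [hzero.1, hzero.2, mul_zero, mul_zero]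
  obtain ⟨v, hv, A, hA, c, hN⟩ : ∃ v ∈ unipH p F K m ε, ∃ A ∈ unipGL p F K n, ∃ c,
      IsNormal p F hmn a u c (v.valᵀ * X * A.val) := by
    rw [not_and_or] at hzero
    rcases hzero with h | h
    · obtain ⟨w, hw, hX⟩ := exists_isSupported_of_upH_ne_zero μH χ X h
      obtain ⟨v, hv, A, hA, c, hN⟩ :=
        exists_isNormal_of_isSupported_torusH_mul hs hz hz2 hzs ht.2.2 hX
      refine ⟨w * v, mul_mem hw hv, A, hA, c, ?_⟩
      rwa [Units.val_mul, transpose_mul, Matrix.mul_assoc v.valᵀ]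
    · obtain ⟨B, hB, hX⟩ := exists_isSupported_of_siegelIntegral_ne_zero ψ μG χ X h
      rw [← siegelIntegral_mul ψ μG X hK _ _ hB] at h
      obtain ⟨v, hv, A, hA, c, hN⟩ := exists_isNormal_of_isSupported_mul_breveA hs hz hz2 hzs
        (fun A hA => conj_breveA_mem_unipGL hs ht'.2.2 hA) hbot
        (intMat_gram_of_siegelIntegral_ne_zero ψ μG _ hp hK hψ h) hX
      refine ⟨v, hv, B * A, mul_mem hB hA, c, ?_⟩
      rwa [Units.val_mul, ← Matrix.mul_assoc, Matrix.mul_assoc v.valᵀ]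
  rw [← upH_transpose_mul μH X _ _ hv, ← upH_mul μH χ _ _ hA,
    ← siegelIntegral_transpose_mul ψ μG χ X _ hv, ← siegelIntegral_mul ψ μG _ hK _ _ hA,
    hN.upH_eq μH χ hs hO ht.1, hN.siegelIntegral_eq ψ μG χ μGL hp hK hψ hO hu,
    hN.phiChi_torusH_mul χ hab hdu, inv_mul_cancel_left₀, inv_mul_cancel_left₀]
  · exact_mod_cast (conjVol_pos (isOpen_conjSubgroup_unipGL hO a d)).ne'
  · exact_mod_cast (conjVol_pos (isOpen_conjSubgroup_unipH hO ht.1)).ne'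

end Comparison

/-! ### Weil index and character factors -/

section Factors

variable {p : ℕ} [Fact p.Prime] {F : Type*} [Field F] [Algebra ℚ_[p] F] [FiniteDimensional ℚ_[p] F]
  {K : Type*} [CommRing K] [Algebra F K]

omit [FiniteDimensional ℚ_[p] F] in
theorem absK_one : absK p F (1 : K) = 1 := by
  rw [absK, map_one, map_one, norm_one]

omit [FiniteDimensional ℚ_[p] F] in
theorem absK_pos [FiniteDimensional F K] (x : Kˣ) : 0 < absK p F (x : K) := by
  rw [absK, norm_pos_iff]
  exact ((x.isUnit.map (Algebra.norm F)).map (Algebra.norm ℚ_[p])).ne_zero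

variable [StarRing K] [TopologicalSpace F] [IsModuleTopology ℚ_[p] F] [MeasurableSpace F]
  [BorelSpace F] {P : DualPair} {ψ : AddChar F ℂ} (ν : Measure F) [ν.IsAddHaarMeasure]
  (χt : Kˣ →* ℂˣ)

theorem weilIndex_mul_div_two_ne_zero (hψ : HasConductorIntegers p ψ) {b : F} (hb : b ≠ 0) :
    weilIndex p ν (fun x => ψ (b * x / 2)) ≠ 0 := by
  have : CharZero F := charZero_of_injective_algebraMap (algebraMap ℚ_[p] F).injective
  simpa only [mul_div_right_comm] using weilIndex_ne_zero p hψ ν (div_ne_zero hb two_ne_zero)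

theorem siegelFactor_one (hP : P.Admissible p F K) (hψ : HasConductorIntegers p ψ) :
    siegelFactor p P ψ ν χt 1 (1 : K) = 1 := by
  cases P
  · rfl
  · have h := hP.isCoefficientAlgebra.toBase_algebraMap (1 : F)
    rw [map_one] at h
    have h₂ := weilIndex_mul_div_two_ne_zero ν hψ (one_ne_zero (α := F))
    simp only [one_mul] at h₂
    simp only [siegelFactor, relWeilIndex, h, one_mul, div_self h₂]
    simp
  · rfl
  · simp [siegelFactor]

/-- The two factors are formal inverses; the content is that no Weil index in the quotients is zero.
-/
theorem equivFactor_mul_siegelFactor (hP : P.Admissible p F K) (hψ : HasConductorIntegers p ψ)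
    (x : Kˣ) : equivFactor p P ψ ν χt x * siegelFactor p P ψ ν χt 1 (x : K) = 1 := by
  cases P
  · exact one_mul 1
  · have hK := hP.isCoefficientAlgebra
    have : Nontrivial K := hK.algebraMap_injective.nontrivial
    have hx : toBase F (x : K) ≠ 0 := by
      intro h
      have h' := hK.algebraMap_toBase (hP.2 (x : K))
      rw [h, map_zero] at h'
      exact x.ne_zero h'.symm
    have h₁ := weilIndex_mul_div_two_ne_zero ν hψ (one_ne_zero (α := F))
    have h₂ := weilIndex_mul_div_two_ne_zero ν hψ hx
    simp only [one_mul] at h₁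
    simp only [equivFactor, siegelFactor, Units.val_one, Int.cast_one, one_mul]
    exact mul_inv_cancel₀ (div_ne_zero h₂ h₁)
  · exact one_mul 1
  · simp [equivFactor, siegelFactor]

/-- The Levi block of a unipotent w has determinant 1 and `t̆` has B = 0. So the scalar factors come
from `t̆` alone and the phase from w alone. -/
theorem upG_breveT_eq {m n : ℕ} (hP : P.Admissible p F K) (hψ : HasConductorIntegers p ψ)
    [MeasurableSpace (unipG p F K n)] (μ : Measure (unipG p F K n)) (a : Fin m → Kˣ) (d : Kˣ)
    (φ : Matrix (Row m P.eps) (Fin n) K → ℂ) (X : Matrix (Row m P.eps) (Fin n) K) :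
    upG p P ψ ν χt μ (breveT n a d) 1 φ X =
      siegelFactor p P ψ ν χt 1 ((breveA n a d).det : K) *
        ((absK p F ((breveA n a d).det : K) ^ ((2 * (m : ℝ) + P.eps) / 2) : ℝ) : ℂ) *
        siegelIntegral ψ μ (breveA n a d) φ X := by
  have hK := hP.isCoefficientAlgebra
  have h0 : toBase F (0 : K) = 0 :=
    hK.algebraMap_injective (by rw [hK.algebraMap_toBase (star_zero K), map_zero])
  rw [upG, siegelIntegral, ← integral_const_mul]
  refine integral_congr_ae (ae_of_all _ fun w => ?_)
  have hdet : w.1.val.toBlocks₁₁.det = 1 := det_of_mem_unipUpper (leviHom p F K n w).2.1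
  have hdet' : (breveA n a d).val.det = ((breveA n a d).det : K) := rfl
  simp only [weilG, breveT_val, toBlocks_fromBlocks₁₁, toBlocks_fromBlocks₁₂, hdet, absK_one,
    siegelFactor_one ν χt hP hψ, Real.one_rpow, Matrix.zero_mul, trace_zero, h0, mul_zero,
    AddChar.map_zero_eq_one, one_mul, mul_one, Complex.ofReal_one, leviHom_val, siegelPart, gram,
    hdet']
  ring

end Factors

/-! ### Integrality of `d` and `u` -/

section Parameters

variable {p : ℕ} [Fact p.Prime] {F : Type*} [Field F] [Algebra ℚ_[p] F] [FiniteDimensional ℚ_[p] F]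
  {K : Type*} [CommRing K] [Algebra F K] [StarRing K]

/-- There is nothing to show if ε = 0. If K is a field, ūu = 1 makes u a unit, and d d̄ ∈ 𝒪 and r̄r
∈ 𝒪 make d and r integral. In the split case norms say too little, and du⁻¹ ∈ 𝒪ˣ takes their place.
-/
theorem integrality_of_parameters {P : DualPair} (hP : P.Admissible p F K) {m n : ℕ} {u d : Kˣ}
    (hu : Fin P.eps → star (u : K) * u = 1)
    (hd : m < n → (d : K) * star (d : K) ∈ intK p F K)
    (hdu : P = .U1 → m < n → IsSplit F K →
      ∃ v : (intK p F K)ˣ, ((v : intK p F K) : K) = d * (u⁻¹ : Kˣ)) :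
    (Fin P.eps → m < n → (d : K) * (u⁻¹ : Kˣ) ∈ intK p F K) ∧
      (m < n → ∀ r : Fin P.eps → K, ∑ k, star (r k) * r k ∈ intK p F K →
        (∀ k, r k * (d : K) ∈ intK p F K) → ∀ k, (u : K) * r k ∈ intK p F K) := by
  have hfield : (IsBaseField F K ∨ IsUnramifiedQuadratic p F K) → P.eps = 1 →
      (Fin P.eps → m < n → (d : K) * (u⁻¹ : Kˣ) ∈ intK p F K) ∧
      (m < n → ∀ r : Fin P.eps → K, ∑ k, star (r k) * r k ∈ intK p F K →
        (∀ k, r k * (d : K) ∈ intK p F K) → ∀ k, (u : K) * r k ∈ intK p F K) := by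
    intro h hε
    have hK := hP.isCoefficientAlgebra
    have : Subsingleton (Fin P.eps) := by rw [hε]; infer_instance
    have hmem : ∀ k : Fin P.eps, (u : K) ∈ intK p F K := fun k =>
      IsCoefficientAlgebra.mem_of_mul_star_mem h (by rw [mul_comm, hu k]; exact one_mem _)
    refine ⟨fun k hmn => mul_mem (IsCoefficientAlgebra.mem_of_mul_star_mem h (hd hmn)) ?_,
      fun hmn r hr _ k => mul_mem (hmem k) (IsCoefficientAlgebra.mem_of_mul_star_mem h ?_)⟩
    · rw [Units.inv_eq_of_mul_eq_one_left (hu k)]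
      exact hK.star_mem (hmem k)
    · rwa [Fintype.sum_subsingleton _ k, mul_comm] at hr
  cases P
  · exact ⟨fun k => k.elim0, fun _ _ _ _ k => k.elim0⟩
  · exact hfield (Or.inl hP) rfl
  · exact ⟨fun k => k.elim0, fun _ _ _ _ k => k.elim0⟩
  · rcases hP with h | h
    · refine ⟨fun _ hmn => ?_, fun hmn r _ hr k => ?_⟩
      · obtain ⟨v, hv⟩ := hdu rfl hmn h
        rw [← hv]
        exact (v : intK p F K).2
      · obtain ⟨v, hv⟩ := hdu rfl hmn h
        have h₁ : ((v⁻¹ : (intK p F K)ˣ) : intK p F K).1 * (v : intK p F K).1 = 1 := by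
          rw [← MulMemClass.coe_mul, Units.inv_mul]; rfl
        have h₂ : (u : K) * r k = r k * d * ((v⁻¹ : (intK p F K)ˣ) : intK p F K).1 := by
          calc (u : K) * r k = u * r k * (((v⁻¹ : (intK p F K)ˣ) : intK p F K).1 *
                (v : intK p F K).1) := by rw [h₁, mul_one]
            _ = r k * d * ((v⁻¹ : (intK p F K)ˣ) : intK p F K).1 * (u * (u⁻¹ : Kˣ)) := by
              rw [hv]; ring
            _ = _ := by rw [Units.mul_inv, mul_one]
        rw [h₂]
        exact mul_mem (hr k) (v⁻¹ : (intK p F K)ˣ).val.2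
    · exact hfield (Or.inr h) rfl

end Parameters

end UpEquiv

end

/-- The `U_p`-equivariance of the test Schwartz function `φ_χ`, in all four cases. -/
theorem theorem2p1
    (p : ℕ) [Fact p.Prime] (hp : p ≠ 2)
    -- the `p`-adic field `F`, with its topology, and the coefficient ring `K`
    (F : Type*) [Field F] [Algebra ℚ_[p] F] [FiniteDimensional ℚ_[p] F]
    [TopologicalSpace F] [IsModuleTopology ℚ_[p] F] [MeasurableSpace F] [BorelSpace F]
    (K : Type*) [CommRing K] [Algebra F K] [StarRing K]
    [TopologicalSpace K] [IsModuleTopology F K]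
    (P : UpEquiv.DualPair) (hP : P.Admissible p F K)
    (m n : ℕ) (hm : 0 < m) (hmn : m ≤ n)
    -- the additive character, the character `χ̃`, and a Haar measure on `F` to form Weil indices
    (ψ : AddChar F ℂ) (hψ : UpEquiv.HasConductorIntegers p ψ)
    (χt : Kˣ →* ℂˣ)
    (hχt : P = .U0 ∨ P = .U1 → UpEquiv.ExtendsQuadraticCharacter F K χt)
    (ν : Measure F) [ν.IsAddHaarMeasure]
    -- the Haar measures of total volume `1` on the groups of `𝒪`-points
    [MeasurableSpace (UpEquiv.unipH p F K m P.eps)] [BorelSpace (UpEquiv.unipH p F K m P.eps)]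
    (μH : Measure (UpEquiv.unipH p F K m P.eps)) [μH.IsHaarMeasure] [IsProbabilityMeasure μH]
    [MeasurableSpace (UpEquiv.unipG p F K n)] [BorelSpace (UpEquiv.unipG p F K n)]
    (μG : Measure (UpEquiv.unipG p F K n)) [μG.IsHaarMeasure] [IsProbabilityMeasure μG]
    [MeasurableSpace (UpEquiv.unipGL p F K n)] [BorelSpace (UpEquiv.unipGL p F K n)]
    (μGL : Measure (UpEquiv.unipGL p F K n)) [μGL.IsHaarMeasure] [IsProbabilityMeasure μGL]
    -- the finite-order characters of `𝒪ˣ`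
    (χ : Fin m → ((UpEquiv.intK p F K)ˣ →* ℂˣ))
    (hχ : ∀ j, Continuous (χ j) ∧ IsOfFinOrder (χ j))
    -- the elements `t` and `t̆`
    (a : Fin m → Kˣ) (u d : Kˣ)
    (ht : UpEquiv.torusH P.eps a u ∈
      UpEquiv.TPlus (UpEquiv.groupH K m P.eps) (UpEquiv.unipH p F K m P.eps))
    (ht' : UpEquiv.breveT n a d ∈
      UpEquiv.TPlus (UpEquiv.groupG K n) (UpEquiv.unipG p F K n))
    (hdu : P = .U1 → m < n → UpEquiv.IsSplit F K →
      ∃ v : (UpEquiv.intK p F K)ˣ, ((v : UpEquiv.intK p F K) : K) = d * (u⁻¹ : Kˣ)) :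
    ((UpEquiv.conjVol (UpEquiv.unipH p F K m P.eps) μH (UpEquiv.torusH P.eps a u) : ℂ))⁻¹ •
        UpEquiv.upH p μH (UpEquiv.torusH P.eps a u) (UpEquiv.phiChi p F hmn χ) =
      (UpEquiv.equivFactor p P ψ ν χt (UpEquiv.breveA n a d).det *
        ((UpEquiv.absK p F ((UpEquiv.breveA n a d).det : K) ^
          (-((2 * (m : ℝ) + P.eps) / 2)) : ℝ) : ℂ) *
        ((UpEquiv.conjVol (UpEquiv.unipGL p F K n) μGL (UpEquiv.breveA n a d) : ℂ))⁻¹) •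
        UpEquiv.upG p P ψ ν χt μG (UpEquiv.breveT n a d) 1 (UpEquiv.phiChi p F hmn χ) := by
  have hK := hP.isCoefficientAlgebra
  have : FiniteDimensional F K := hK.finiteDimensional
  have : IsTopologicalRing F := IsModuleTopology.isTopologicalRing ℚ_[p] F
  have : IsTopologicalRing K := IsModuleTopology.isTopologicalRing F K
  have hO := (UpEquiv.isClopen_intK p F K).isOpen
  -- The entry of index m, counted from 0, is the first d in A(`t̆`); it exists exactly when m < n.
  have hd : m < n → (d : K) * star (d : K) ∈ UpEquiv.intK p F K := fun h => by
    have hj := UpEquiv.breveEntries_mul_star_mem (fun _ => hK.star_mem) ht'.2.2 ⟨m, h⟩ ⟨m, h⟩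
    rwa [UpEquiv.breveEntries_of_le a d (le_refl m)] at hj
  obtain ⟨h₁, h₂⟩ := UpEquiv.integrality_of_parameters hP
    (UpEquiv.star_mul_self_of_torusH_mem ht.1) hd hdu
  funext X
  simp only [Pi.smul_apply, smul_eq_mul]
  rw [UpEquiv.inv_conjVol_mul_upH_eq hp hK hO hψ μH μG μGL χ ht ht' h₁ h₂ X,
    UpEquiv.upG_breveT_eq ν χt hP hψ]
  set x := (UpEquiv.breveA n a d).det
  have hx := UpEquiv.absK_pos (p := p) (F := F) x
  have e₁ := UpEquiv.equivFactor_mul_siegelFactor ν χt hP hψ x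
  have e₂ : ((UpEquiv.absK p F (x : K) ^ (-((2 * (m : ℝ) + P.eps) / 2)) : ℝ) : ℂ) *
      ((UpEquiv.absK p F (x : K) ^ ((2 * (m : ℝ) + P.eps) / 2) : ℝ) : ℂ) = 1 := by
    rw [← Complex.ofReal_mul, ← Real.rpow_add hx, neg_add_cancel, Real.rpow_zero,
      Complex.ofReal_one]
  generalize UpEquiv.siegelIntegral ψ μG (UpEquiv.breveA n a d) (UpEquiv.phiChi p F hmn χ) X = R
  -- The scalars pulled out of the G-side are κ⁻¹|det A|^((2m+ε)/2), and `e₁`, `e₂` cancel them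
  -- against the factors in the statement.
  linear_combination (-(UpEquiv.conjVol (UpEquiv.unipGL p F K n) μGL
    (UpEquiv.breveA n a d) : ℂ)⁻¹ * R) * (e₁ + UpEquiv.equivFactor p P ψ ν χt x *
    UpEquiv.siegelFactor p P ψ ν χt 1 (x : K) * e₂)
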